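/- Let $L/\mathbb{Q}_p$ be a finite extension with ring of integers $\mathfrak{o}$ and uniformizer $\varpi$, let $X_0$ be a smooth scheme over $\mathrm{Spec}\,\mathfrak{o}$, let $\mathcal{I}\subseteq\mathcal{O}_{X_0}$ be a coherent ideal sheaf containing $\varpi^N$, and let $\mathrm{pr}\colon X\to X_0$ be the blow-up of $\mathcal{I}$ (the relative $\mathrm{Proj}$ of $\bigoplus_n\mathcal{I}^n$). Fix integers $m\ge 0$ and $k\ge N$. For an affine open $U\subseteq X_0$ with local coordinates $x_1,\dots,x_n$ (that is, $dx_1,\dots,dx_n$ is a basis of $\Omega^1_{U/\mathfrak{o}}$), let $\partial_i$ be the dual derivations, let $\partial_i^{[\nu]}$ be the operators with $\nu!\,\partial_i^{[\nu]}=\partial_i^{\nu}$, and for $\nu\in\mathbb{N}^n$ put $\partial^{\langle\nu\rangle}=\prod_i q_{\nu_i}!\,\partial_i^{[\nu_i]}$ and $\tilde\partial^{\nu}=\varpi^{k|\nu|}\partial^{\langle\nu\rangle}$, where $q_j=\lfloor j/p^m\rfloor$. Let $\widetilde{\mathcal{D}}^{(m)}_{X_0,k}$ be the sheaf of rings of those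 operators on $\mathcal{O}_{X_0}$ that locally lie in the ring generated by the functions and the operators $\tilde\partial^{\nu}$ (so on $U$ it is the free left $\mathcal{O}_U$-module with basis the $\tilde\partial^{\nu}$). For $\mu\le\nu$ put $\left\{{\nu\atop\mu}\right\}=\prod_i \frac{q_{\nu_i}!}{q_{\mu_i}!\,q_{\nu_i-\mu_i}!}\in\mathbb{N}$. Then: (1) $\mathcal{O}_X$ can be endowed with a structure of $\mathrm{pr}^{-1}\widetilde{\mathcal{D}}^{(m)}_{X_0,k}$-module such that the map $\mathrm{pr}^{-1}\mathcal{O}_{X_0}\to\mathcal{O}_X$ is $\mathrm{pr}^{-1}\widetilde{\mathcal{D}}^{(m)}_{X_0,k}$-linear. Moreover this structure can be chosen compatible with the algebra structure of $\mathcal{O}_X$: local sections of $\mathrm{pr}^{-1}\mathcal{O}_{X_0}$ act by multiplication and, for all local coordinates as above and all local sections $s,t$ of $\mathcal{O}_X$ over an open subset of $\mathrm{pr}^{-1}(U)$, $$\tilde\partial^{\nu}(st)=\sum_{\mu\le\nu}\left\{{\nu\atop\mu}\right\}\tilde\partial^{\mu}(s)\,\tilde\partial^{\nu-\mu}(t).$$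 (2) With this action of (1), the $\mathcal{O}_X$-module $\mathrm{pr}^*\widetilde{\mathcal{D}}^{(m)}_{X_0,k}=\mathcal{O}_X\otimes_{\mathrm{pr}^{-1}\mathcal{O}_{X_0}}\mathrm{pr}^{-1}\widetilde{\mathcal{D}}^{(m)}_{X_0,k}$ carries a structure of sheaf of rings such that $s\mapsto s\otimes 1$ and $P\mapsto 1\otimes P$ are homomorphisms of sheaves of rings from $\mathcal{O}_X$ and $\mathrm{pr}^{-1}\widetilde{\mathcal{D}}^{(m)}_{X_0,k}$, left multiplication by $s\otimes 1$ is the $\mathcal{O}_X$-module structure, and for all local coordinates as above $$(1\otimes\tilde\partial^{\nu})(s\otimes 1)=\sum_{\mu\le\nu}\left\{{\nu\atop\mu}\right\}\tilde\partial^{\mu}(s)\otimes\tilde\partial^{\nu-\mu}.$$ -/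

import Mathlib

open AlgebraicGeometry CategoryTheory TopologicalSpace Opposite
open scoped Polynomial DirectSum

universe u

namespace ArithDiff

/-! ### Blow-ups -/

section Rees

variable {A : Type u} [CommRing A] (I : Ideal A)

/-- The degree `n` part `Iⁿ Tⁿ` of the Rees algebra `⨁ Iⁿ Tⁿ ⊆ A[T]`. -/
noncomputable def reesGrading (n : ℕ) : Submodule A (reesAlgebra I) where
  carrier := {f | ∀ i, i ≠ n → (f : A[X]).coeff i = 0}
  add_mem' := by
    intro a b ha hb i hi
    simp [ha i hi, hb i hi]
  zero_mem' := by simp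
  smul_mem' := by
    intro c a ha i hi
    simp [ha i hi]

/-- The degree `n` component of an element of the Rees algebra. -/
noncomputable def reesComponent (n : ℕ) (f : reesAlgebra I) : reesGrading I n :=
  ⟨⟨Polynomial.monomial n ((f : A[X]).coeff n), reesAlgebra.monomial_mem.2 (f.2 n)⟩, by
    intro i hi
    simp [Polynomial.coeff_monomial, hi.symm]⟩

instance : SetLike.GradedMonoid (reesGrading I) where
  one_mem := by
    intro i hi
    simp [Polynomial.coeff_one, hi]
  mul_mem := by
    intro m n a b ha hb i hi
    simp only [MulMemClass.coe_mul, Polynomial.coeff_mul]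
    refine Finset.sum_eq_zero fun x hx => ?_
    by_cases h : x.1 = m
    · have hx' := Finset.HasAntidiagonal.mem_antidiagonal.1 hx
      rw [hb x.2 (by rintro rfl; exact hi (by rw [← hx', h])), mul_zero]
    · rw [ha x.1 h, zero_mul]

/-- The decomposition of an element of the Rees algebra into its components. -/
noncomputable def reesDecompose (f : reesAlgebra I) : ⨁ n, reesGrading I n :=
  ∑ n ∈ (f : A[X]).support, DirectSum.of (fun n => reesGrading I n) n (reesComponent I n f)

noncomputable instance : GradedAlgebra (reesGrading I) where
  decompose' := reesDecompose I
  left_inv f := by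
    have h : DirectSum.coeAddMonoidHom (reesGrading I) (reesDecompose I f)
        = ∑ n ∈ (f : A[X]).support, (reesComponent I n f : reesAlgebra I) := by
      rw [reesDecompose, map_sum]
      simp
    rw [h]
    ext1
    rw [AddSubmonoidClass.coe_finsetSum]
    exact ((f : A[X]).as_sum_support).symm
  right_inv x := by
    have hcoeff : ∀ n (y : ⨁ n, reesGrading I n),
        (((DirectSum.coeAddMonoidHom (reesGrading I) y : reesAlgebra I) : A[X]).coeff n)
          = ((y n : reesAlgebra I) : A[X]).coeff n := by
      intro n y
      induction y using DirectSum.induction_on with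
      | zero => simp
      | of i y =>
        rw [DirectSum.coeAddMonoidHom_of]
        by_cases h : i = n
        · subst h; simp
        · rw [DirectSum.of_eq_of_ne _ _ _ (Ne.symm h), y.2 n (Ne.symm h)]; simp
      | add a b ha hb => simp_all
    refine DFinsupp.ext fun n => ?_
    ext i
    by_cases hi : i = n
    · subst hi
      have hdec : (reesDecompose I (DirectSum.coeAddMonoidHom (reesGrading I) x)) i
          = reesComponent I i (DirectSum.coeAddMonoidHom (reesGrading I) x) := by
        generalize DirectSum.coeAddMonoidHom (reesGrading I) x = g
        rw [reesDecompose, DFinsupp.finsetSum_apply]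
        by_cases hs : i ∈ (g : A[X]).support
        · rw [Finset.sum_eq_single_of_mem i hs fun j _ hj =>
            DirectSum.of_eq_of_ne _ _ _ (Ne.symm hj)]
          exact DirectSum.of_eq_same _ _
        · rw [Finset.sum_eq_zero fun j hj => DirectSum.of_eq_of_ne j i _ (by rintro rfl; exact hs hj)]
          ext
          simp [reesComponent, Polynomial.notMem_support_iff.1 hs]
      rw [hdec, ← hcoeff]
      simp [reesComponent]
    · rw [(Subtype.prop _ : _ ∈ reesGrading I n) i hi, (x n).2 i hi]

/-- The structure morphism `Proj (⨁ Iⁿ) ⟶ Spec A`. -/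
noncomputable def reesProjToSpec : Proj (reesGrading I) ⟶ Spec (.of A) :=
  Proj.toSpecZero (reesGrading I) ≫ Spec.map (CommRingCat.ofHom (algebraMap A (reesGrading I 0)))

end Rees

/-- `pr : X ⟶ Y` is the blow-up of `Y` in the quasi-coherent ideal sheaf `I`, that is, the relative
`Proj` of `⨁ Iⁿ`: over every affine open `V` of `Y` it is isomorphic to
`Proj (⨁ I(V)ⁿ) ⟶ Spec Γ(Y, V) = V`. -/
def IsBlowup {X Y : Scheme.{u}} (pr : X ⟶ Y) (I : Y.IdealSheafData) : Prop :=
  ∀ V : Y.affineOpens,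
    ∃ e : (pr ⁻¹ᵁ V.1).toScheme ≅ Proj (reesGrading (I.ideal V)),
      e.hom ≫ reesProjToSpec (I.ideal V) ≫ V.2.fromSpec = (pr ⁻¹ᵁ V.1).ι ≫ pr

/-! ### The sheaf of additive endomorphisms of the structure sheaf -/

section EndSheaf

variable (X : Scheme.{u})

/-- The ring of endomorphisms of the sheaf of abelian groups `𝒪_X|_V`. -/
def endRing (V : X.Opens) : Subring (∀ W : {W : X.Opens // W ≤ V}, AddMonoid.End Γ(X, W.1)) where
  carrier := {P | ∀ (W W' : {W : X.Opens // W ≤ V}) (h : W'.1 ≤ W.1) (s : Γ(X, W.1)),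
    P W' (X.presheaf.map (homOfLE h).op s) = X.presheaf.map (homOfLE h).op (P W s)}
  mul_mem' := by
    intro P Q hP hQ W W' h s
    change P W' (Q W' _) = X.presheaf.map (homOfLE h).op (P W (Q W s))
    rw [hQ W W' h, hP W W' h]
  one_mem' _ _ _ _ := rfl
  add_mem' := by
    intro P Q hP hQ W W' h s
    change P W' _ + Q W' _ = X.presheaf.map (homOfLE h).op (P W s + Q W s)
    rw [hP W W' h, hQ W W' h, map_add]
  zero_mem' := by
    intro W W' h s
    change 0 = X.presheaf.map (homOfLE h).op 0
    rw [map_zero]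
  neg_mem' := by
    intro P hP W W' h s
    change -(P W' _) = X.presheaf.map (homOfLE h).op (-(P W s))
    rw [hP W W' h, map_neg]

variable {X}

/-- The value of an endomorphism of `𝒪_X|_V` on sections over `W ⊆ V`. -/
def evalOp {V : X.Opens} (P : endRing X V) {W : X.Opens} (h : W ≤ V) :
    AddMonoid.End Γ(X, W) :=
  P.1 ⟨W, h⟩

/-- Restriction of endomorphisms of `𝒪_X|_V` to `V' ⊆ V`. -/
def endRing.res {V V' : X.Opens} (h : V' ≤ V) : endRing X V →+* endRing X V' where
  toFun P := ⟨fun W => P.1 ⟨W.1, W.2.trans h⟩, fun W W' hW s =>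
    P.2 ⟨W.1, W.2.trans h⟩ ⟨W'.1, W'.2.trans h⟩ hW s⟩
  map_one' := rfl
  map_mul' _ _ := rfl
  map_zero' := rfl
  map_add' _ _ := rfl

/-- Multiplication by `a ∈ Γ(X, V)`, as an endomorphism of `𝒪_X|_V`. -/
def mulOp (V : X.Opens) : Γ(X, V) →+* endRing X V where
  toFun a := ⟨fun W => AddMonoidHom.mulLeft (X.presheaf.map (homOfLE W.2).op a), by
    intro W W' h s
    change X.presheaf.map _ a * X.presheaf.map _ s
      = X.presheaf.map (homOfLE h).op (X.presheaf.map _ a * s)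
    rw [map_mul, ← CommRingCat.comp_apply, ← Functor.map_comp]
    rfl⟩
  map_one' := by
    ext W s
    change X.presheaf.map _ 1 * s = s
    rw [map_one, one_mul]
  map_mul' a b := by
    ext W s
    change X.presheaf.map _ (a * b) * s = X.presheaf.map _ a * (X.presheaf.map _ b * s)
    rw [map_mul, mul_assoc]
  map_zero' := by
    ext W s
    change X.presheaf.map _ 0 * s = 0
    rw [map_zero, zero_mul]
  map_add' a b := by
    ext W s
    change X.presheaf.map _ (a + b) * s = X.presheaf.map _ a * s + X.presheaf.map _ b * s
    rw [map_add, add_mul]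

lemma res_mulOp {V V' : X.Opens} (h : V' ≤ V) (a : Γ(X, V)) :
    endRing.res h (mulOp V a) = mulOp V' (X.presheaf.map (homOfLE h).op a) := by
  ext W s
  change X.presheaf.map _ a * s = X.presheaf.map _ (X.presheaf.map _ a) * s
  rw [← CommRingCat.comp_apply, ← Functor.map_comp]
  rfl

variable (X) in
/-- A family of subrings of the rings of endomorphisms of `𝒪_X|_V`, stable under restriction,
membership in which is local, and which contain the multiplications by functions. -/
structure LocalSubrings where
  ring : ∀ V : X.Opens, Subring (endRing X V)
  res_mem : ∀ {V V' : X.Opens} (h : V' ≤ V) (P : endRing X V),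
    P ∈ ring V → endRing.res h P ∈ ring V'
  mem_of_local : ∀ {V : X.Opens} (P : endRing X V),
    (∀ x ∈ V, ∃ (W : X.Opens) (h : W ≤ V), x ∈ W ∧ endRing.res h P ∈ ring W) → P ∈ ring V
  mulOp_mem : ∀ {V : X.Opens} (a : Γ(X, V)), mulOp V a ∈ ring V

namespace LocalSubrings

variable (S : LocalSubrings X)

/-- The presheaf of rings attached to a local family of subrings. -/
def presheaf : TopCat.Presheaf RingCat.{u} X where
  obj V := RingCat.of (S.ring V.unop)
  map {V V'} i := RingCat.ofHom
    (((endRing.res i.unop.le).comp (S.ring V.unop).subtype).codRestrict (S.ring V'.unop)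
      fun P => S.res_mem i.unop.le P.1 P.2)
  map_id _ := rfl
  map_comp _ _ := rfl

lemma presheaf_isSheaf : S.presheaf.IsSheaf := by
  rw [TopCat.Presheaf.isSheaf_iff_isSheafUniqueGluing]
  intro ι U sf hsf
  have hsf' : ∀ (i j : ι) (W : X.Opens) (hi : W ≤ U i) (hj : W ≤ U j) (s : Γ(X, W)),
      evalOp (sf i).1 hi s = evalOp (sf j).1 hj s := by
    intro i j W hi hj s
    have h := congrArg (fun P : S.ring (U i ⊓ U j) => evalOp P.1 (le_inf hi hj) s) (hsf i j)
    exact h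
  have hcov : ∀ W : {W : X.Opens // W ≤ iSup U}, W.1 ≤ ⨆ i, W.1 ⊓ U i := by
    intro W
    rw [← inf_iSup_eq]
    exact le_inf le_rfl W.2
  have hsep : ∀ (W : {W : X.Opens // W ≤ iSup U}) (s t : Γ(X, W.1)),
      (∀ i, X.presheaf.map (homOfLE (inf_le_left : W.1 ⊓ U i ≤ W.1)).op s
        = X.presheaf.map (homOfLE (inf_le_left : W.1 ⊓ U i ≤ W.1)).op t) → s = t := fun W s t h =>
    X.sheaf.eq_of_locally_eq' (fun i => W.1 ⊓ U i) W.1 (fun i => homOfLE inf_le_left) (hcov W) s t h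
  have hex : ∀ (W : {W : X.Opens // W ≤ iSup U}) (s : Γ(X, W.1)), ∃ t : Γ(X, W.1), ∀ i,
      X.presheaf.map (homOfLE (inf_le_left : W.1 ⊓ U i ≤ W.1)).op t
        = evalOp (sf i).1 (inf_le_right : W.1 ⊓ U i ≤ U i)
          (X.presheaf.map (homOfLE (inf_le_left : W.1 ⊓ U i ≤ W.1)).op s) := by
    intro W s
    refine (X.sheaf.existsUnique_gluing' (fun i => W.1 ⊓ U i) W.1 (fun i => homOfLE inf_le_left)
      (hcov W) (fun i => evalOp (sf i).1 (inf_le_right : W.1 ⊓ U i ≤ U i)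
          (X.presheaf.map (homOfLE (inf_le_left : W.1 ⊓ U i ≤ W.1)).op s)) ?_).exists
    intro i j
    have h1 := (sf i).1.2 ⟨W.1 ⊓ U i, inf_le_right⟩
      ⟨(W.1 ⊓ U i) ⊓ (W.1 ⊓ U j), inf_le_left.trans inf_le_right⟩ inf_le_left
      (X.presheaf.map (homOfLE (inf_le_left : W.1 ⊓ U i ≤ W.1)).op s)
    have h2 := (sf j).1.2 ⟨W.1 ⊓ U j, inf_le_right⟩
      ⟨(W.1 ⊓ U i) ⊓ (W.1 ⊓ U j), inf_le_right.trans inf_le_right⟩ inf_le_right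
      (X.presheaf.map (homOfLE (inf_le_left : W.1 ⊓ U j ≤ W.1)).op s)
    refine h1.symm.trans (Eq.trans ?_ h2)
    rw [← CommRingCat.comp_apply, ← CommRingCat.comp_apply, ← Functor.map_comp, ← Functor.map_comp]
    exact hsf' i j _ (inf_le_left.trans inf_le_right) (inf_le_right.trans inf_le_right) _
  choose G hG using hex
  have hadd : ∀ W s t, G W (s + t) = G W s + G W t := by
    intro W s t
    refine hsep W _ _ fun i => ?_
    rw [hG, map_add, map_add, map_add, hG, hG]
  have hloc : ∀ W i (hi : W.1 ≤ U i) s, G W s = evalOp (sf i).1 hi s := by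
    intro W i hi s
    refine hsep W _ _ fun j => ?_
    rw [hG]
    refine (hsf' j i _ inf_le_right (inf_le_left.trans hi) _).trans ?_
    exact (sf i).1.2 ⟨W.1, hi⟩ ⟨W.1 ⊓ U j, inf_le_left.trans hi⟩ inf_le_left s
  have hnat : ∀ (W W' : {W : X.Opens // W ≤ iSup U}) (h : W'.1 ≤ W.1) (s : Γ(X, W.1)),
      G W' (X.presheaf.map (homOfLE h).op s) = X.presheaf.map (homOfLE h).op (G W s) := by
    intro W W' h s
    refine hsep W' _ _ fun i => ?_
    have h0 : X.presheaf.map (homOfLE (inf_le_left : W'.1 ⊓ U i ≤ W'.1)).op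
          (X.presheaf.map (homOfLE h).op s)
        = X.presheaf.map (homOfLE (inf_le_left.trans h : W'.1 ⊓ U i ≤ W.1)).op s := by
      rw [← CommRingCat.comp_apply, ← Functor.map_comp]
      rfl
    rw [hG, h0, ← CommRingCat.comp_apply, ← Functor.map_comp]
    have h1 := (sf i).1.2 ⟨W.1 ⊓ U i, inf_le_right⟩ ⟨W'.1 ⊓ U i, inf_le_right⟩
      (inf_le_inf_right _ h) (X.presheaf.map (homOfLE (inf_le_left : W.1 ⊓ U i ≤ W.1)).op s)
    rw [← CommRingCat.comp_apply, ← Functor.map_comp] at h1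
    refine h1.trans ?_
    change X.presheaf.map _ (evalOp (sf i).1 (inf_le_right : W.1 ⊓ U i ≤ U i) _) = _
    rw [← hG W s i, ← CommRingCat.comp_apply, ← Functor.map_comp]
    rfl
  let P : endRing X (iSup U) := ⟨fun W => AddMonoidHom.mk' (G W) (hadd W), hnat⟩
  have hres : ∀ i, endRing.res (le_iSup U i) P = (sf i).1 := by
    intro i
    ext W s
    exact hloc ⟨W.1, W.2.trans (le_iSup U i)⟩ i W.2 s
  refine ⟨⟨P, S.mem_of_local P fun x hx => ?_⟩, fun i => Subtype.ext (hres i), ?_⟩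
  · obtain ⟨i, hi⟩ := Opens.mem_iSup.1 hx
    exact ⟨U i, le_iSup U i, hi, by rw [hres]; exact (sf i).2⟩
  · intro Q hQ
    refine Subtype.ext ?_
    ext W s
    refine hsep W _ _ fun i => ?_
    refine Eq.trans ?_ (hG W s i).symm
    refine (Q.1.2 W ⟨W.1 ⊓ U i, inf_le_left.trans W.2⟩ inf_le_left s).symm.trans ?_
    have h := congrArg (fun P : S.ring (U i) =>
      evalOp P.1 (inf_le_right : W.1 ⊓ U i ≤ U i) (X.presheaf.map (homOfLE inf_le_left).op s)) (hQ i)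
    exact h

/-- The sheaf of rings attached to a local family of subrings. -/
def sheaf : TopCat.Sheaf RingCat.{u} X := ⟨S.presheaf, S.presheaf_isSheaf⟩

/-- Functions act by multiplication. -/
def mulHom : X.ringCatSheaf ⟶ S.sheaf where
  hom := 
    { app V := RingCat.ofHom ((mulOp V.unop).codRestrict (S.ring V.unop) fun a => S.mulOp_mem a)
      naturality V V' i := by
        ext a
        exact Subtype.ext (res_mulOp i.unop.le a).symm }

/-- The sheaf of rings attached to a local family of subrings, as an `𝒪_X`-module by left
multiplication. -/
noncomputable def leftModule : X.Modules :=
  { val := (PresheafOfModules.restrictScalars S.mulHom.hom).obj (SheafOfModules.unit S.sheaf).val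
    isSheaf := (SheafOfModules.unit S.sheaf).isSheaf }

end LocalSubrings

variable (X) in
/-- All endomorphisms. -/
def endSubrings : LocalSubrings X where
  ring _ := ⊤
  res_mem _ _ _ := trivial
  mem_of_local _ _ := trivial
  mulOp_mem _ := trivial

variable (X) in
/-- The sheaf of rings `ℰnd(𝒪_X)` of endomorphisms of the sheaf of abelian groups `𝒪_X`. -/
def endSheaf : TopCat.Sheaf RingCat.{u} X := (endSubrings X).sheaf

end EndSheaf

/-! ### Arithmetic differential operators with congruence level -/

section Operators

variable {X : Scheme.{u}} {R : CommRingCat.{u}} (f : X ⟶ Spec R)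

/-- The structure map `R → Γ(X, V)` of an `R`-scheme `X`. -/
noncomputable def const (V : X.Opens) : R →+* Γ(X, V) :=
  ((Scheme.ΓSpecIso R).inv ≫ f.appTop ≫ X.presheaf.map (homOfLE le_top).op).hom

/-- Local coordinates `x₁, …, xₙ` on an affine open `U` of the `R`-scheme `X`, together with the
derivations `∂ᵢ` dual to `dxᵢ` and their divided powers `∂ᵢ^[ν]`, which satisfy `ν! ∂ᵢ^[ν] = ∂ᵢ^ν`.
The `∂ᵢ` (and, if `𝒪_X` is `ℤ`-torsion free, the `∂ᵢ^[ν]`) are determined by the `xᵢ`. -/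
structure Coordinates (U : X.Opens) where
  affine : IsAffineOpen U
  n : ℕ
  x : Fin n → Γ(X, U)
  span_dx : letI := (const f U).toAlgebra
    Submodule.span Γ(X, U) (Set.range fun i => KaehlerDifferential.D R Γ(X, U) (x i)) = ⊤
  pd : Fin n → endRing X U
  pd_mul : ∀ (i : Fin n) {W : X.Opens} (h : W ≤ U) (a b : Γ(X, W)),
    evalOp (pd i) h (a * b) = a * evalOp (pd i) h b + b * evalOp (pd i) h a
  pd_const : ∀ (i : Fin n) {W : X.Opens} (h : W ≤ U) (r : R), evalOp (pd i) h (const f W r) = 0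
  pd_x : ∀ i j, evalOp (pd i) le_rfl (x j) = if i = j then 1 else 0
  dpd : Fin n → ℕ → endRing X U
  factorial_mul_dpd : ∀ (i : Fin n) (ν : ℕ), ((Nat.factorial ν : ℕ) : endRing X U) * dpd i ν = pd i ^ ν

variable {f}

/-- The operator `ϖ^{k|ν|} ∂^⟨ν⟩`, where `∂^⟨ν⟩ = ∏ᵢ qᵢ! ∂ᵢ^[νᵢ]` and `qᵢ = ⌊νᵢ / p^m⌋`. -/
noncomputable def Coordinates.op {U : X.Opens} (c : Coordinates f U) (ϖ : R) (p m k : ℕ)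
    (ν : Fin c.n → ℕ) : endRing X U :=
  mulOp U (const f U ϖ ^ (k * ∑ i, ν i)) *
    (List.ofFn fun i => ((Nat.factorial (ν i / p ^ m) : ℕ) : endRing X U) * c.dpd i (ν i)).prod

variable (f)

/-- The multiplications by functions on `V` and the restrictions to `V` of the operators
`ϖ^{k|ν|} ∂^⟨ν⟩` for coordinates on an affine open containing `V`. -/
def generators (ϖ : R) (p m k : ℕ) (V : X.Opens) : Set (endRing X V) :=
  Set.range (mulOp V) ∪
    {P | ∃ (U : X.Opens) (h : V ≤ U) (c : Coordinates f U) (ν : Fin c.n → ℕ),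
      P = endRing.res h (c.op ϖ p m k ν)}

lemma res_mem_closure (ϖ : R) (p m k : ℕ) {V V' : X.Opens} (h : V' ≤ V) {P : endRing X V}
    (hP : P ∈ Subring.closure (generators f ϖ p m k V)) :
    endRing.res h P ∈ Subring.closure (generators f ϖ p m k V') := by
  have hle : Subring.closure (generators f ϖ p m k V) ≤
      (Subring.closure (generators f ϖ p m k V')).comap (endRing.res h) := by
    rw [Subring.closure_le]
    rintro Q (⟨a, rfl⟩ | ⟨U, hU, c, ν, rfl⟩)
    · exact Subring.subset_closure (Or.inl ⟨_, (res_mulOp h a).symm⟩)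
    · exact Subring.subset_closure (Or.inr ⟨U, h.trans hU, c, ν, rfl⟩)
  exact hle hP

/-- The differential operators of level `m` and congruence level `k`: the endomorphisms of
`𝒪_X|_V` that locally lie in the ring generated by the functions and the operators
`ϖ^{k|ν|} ∂^⟨ν⟩` attached to local coordinates. -/
def levelSubrings (ϖ : R) (p m k : ℕ) : LocalSubrings X where
  ring V :=
    { carrier := {P | ∀ x ∈ V, ∃ (W : X.Opens) (h : W ≤ V), x ∈ W ∧
        endRing.res h P ∈ Subring.closure (generators f ϖ p m k W)}
      mul_mem' := by
        intro P Q hP hQ x hx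
        obtain ⟨W, h, hxW, hW⟩ := hP x hx
        obtain ⟨W', h', hxW', hW'⟩ := hQ x hx
        refine ⟨W ⊓ W', inf_le_left.trans h, ⟨hxW, hxW'⟩, ?_⟩
        rw [map_mul]
        exact mul_mem (res_mem_closure f ϖ p m k inf_le_left hW)
          (res_mem_closure f ϖ p m k inf_le_right hW')
      one_mem' := by
        intro x hx
        exact ⟨V, le_rfl, hx, by rw [map_one]; exact one_mem _⟩
      add_mem' := by
        intro P Q hP hQ x hx
        obtain ⟨W, h, hxW, hW⟩ := hP x hx
        obtain ⟨W', h', hxW', hW'⟩ := hQ x hx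
        refine ⟨W ⊓ W', inf_le_left.trans h, ⟨hxW, hxW'⟩, ?_⟩
        rw [map_add]
        exact add_mem (res_mem_closure f ϖ p m k inf_le_left hW)
          (res_mem_closure f ϖ p m k inf_le_right hW')
      zero_mem' := by
        intro x hx
        exact ⟨V, le_rfl, hx, by rw [map_zero]; exact zero_mem _⟩
      neg_mem' := by
        intro P hP x hx
        obtain ⟨W, h, hxW, hW⟩ := hP x hx
        exact ⟨W, h, hxW, by rw [map_neg]; exact neg_mem hW⟩ }
  res_mem := by
    intro V V' h P hP x hx
    obtain ⟨W, hW, hxW, hP⟩ := hP x (h hx)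
    exact ⟨W ⊓ V', inf_le_right, ⟨hxW, hx⟩, res_mem_closure f ϖ p m k inf_le_left hP⟩
  mem_of_local := by
    intro V P hP x hx
    obtain ⟨W, h, hxW, hW⟩ := hP x hx
    obtain ⟨W', h', hxW', hW'⟩ := hW x hxW
    exact ⟨W', h'.trans h, hxW', hW'⟩
  mulOp_mem := by
    intro V a x hx
    exact ⟨V, le_rfl, hx, Subring.subset_closure (Or.inl ⟨a, rfl⟩)⟩

/-- The sheaf of rings `𝒟̃_{X,k}^{(m)}` of arithmetic differential operators of level `m` and
congruence level `k` on the `R`-scheme `X`. -/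
def levelSheaf (ϖ : R) (p m k : ℕ) : TopCat.Sheaf RingCat.{u} X := (levelSubrings f ϖ p m k).sheaf

/-- `𝒟̃_{X,k}^{(m)}` as an `𝒪_X`-module by left multiplication. -/
noncomputable def levelModule (ϖ : R) (p m k : ℕ) : X.Modules := (levelSubrings f ϖ p m k).leftModule

variable {f}

/-- `ϖ^{k|ν|} ∂^⟨ν⟩` as a section of `𝒟̃_{X,k}^{(m)}`. -/
noncomputable def Coordinates.levelSection {U : X.Opens} (c : Coordinates f U) (ϖ : R) (p m k : ℕ)
    (ν : Fin c.n → ℕ) : (levelSubrings f ϖ p m k).ring U :=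
  ⟨c.op ϖ p m k ν, fun _ hx =>
    ⟨U, le_rfl, hx, Subring.subset_closure (Or.inr ⟨U, le_rfl, c, ν, rfl⟩)⟩⟩

/-- The integer `∏ᵢ qᵢ! / (qᵢ'! qᵢ''!)`, where `qᵢ`, `qᵢ'`, `qᵢ''` are the quotients of `νᵢ`, `μᵢ`,
`νᵢ - μᵢ` by `p^m`. -/
def leibnizCoeff (p m : ℕ) {n : ℕ} (ν μ : Fin n → ℕ) : ℕ :=
  ∏ i, Nat.factorial (ν i / p ^ m) /
    (Nat.factorial (μ i / p ^ m) * Nat.factorial ((ν i - μ i) / p ^ m))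

end Operators

/-! ### Inverse images -/

section Pullback

variable {X Y : Scheme.{u}} (pr : X ⟶ Y)

/-- The inverse image `pr⁻¹ 𝒜` of a sheaf of rings. -/
noncomputable def inverseImage (𝒜 : TopCat.Sheaf RingCat.{u} Y) : TopCat.Sheaf RingCat.{u} X :=
  (TopCat.Sheaf.pullback RingCat.{u} pr.base).obj 𝒜

variable {pr}

/-- The map `𝒜(V) → ℬ(pr⁻¹ V)` induced by a morphism of sheaves of rings `pr⁻¹ 𝒜 ⟶ ℬ`. -/
noncomputable def onSections {𝒜 : TopCat.Sheaf RingCat.{u} Y} {ℬ : TopCat.Sheaf RingCat.{u} X}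
    (ψ : inverseImage pr 𝒜 ⟶ ℬ) (V : Y.Opens) :
    𝒜.obj.obj (op V) →+* ℬ.obj.obj (op (pr ⁻¹ᵁ V)) :=
  (((TopCat.Sheaf.pullbackPushforwardAdjunction RingCat.{u} pr.base).homEquiv 𝒜 ℬ ψ).hom.app
    (op V)).hom

/-- The section `1 ⊗ s` of `pr^* M` over `pr⁻¹ V`, for a section `s` of `M` over `V`. -/
noncomputable def pullbackSection (pr : X ⟶ Y) (M : Y.Modules) (V : Y.Opens) :
    Γ(M, V) →+ Γ((Scheme.Modules.pullback pr).obj M, pr ⁻¹ᵁ V) :=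
  (((Scheme.Modules.pullbackPushforwardAdjunction pr).unit.app M).app V).hom

end Pullback

/-! ### The structures on `X` -/

section Structures

variable {X Y : Scheme.{u}} {R : CommRingCat.{u}} (f : Y ⟶ Spec R) (ϖ : R) (p m k : ℕ) (pr : X ⟶ Y)

/-- The conditions on a `pr⁻¹ 𝒟̃_{Y,k}^{(m)}`-module structure on the sheaf of abelian groups `𝒪_X`,
given as a morphism of sheaves of rings `ρ : pr⁻¹ 𝒟̃_{Y,k}^{(m)} ⟶ ℰnd(𝒪_X)`, to be compatible with
the structure of `𝒪_X`. -/
structure IsCompatibleAction (ρ : inverseImage pr (levelSheaf f ϖ p m k) ⟶ endSheaf X) : Prop where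
  /-- The map `pr⁻¹ 𝒪_Y → 𝒪_X` is `pr⁻¹ 𝒟̃_{Y,k}^{(m)}`-linear. -/
  linear : ∀ (V : Y.Opens) (P : (levelSubrings f ϖ p m k).ring V) {W : Y.Opens} (h : W ≤ V)
    (a : Γ(Y, W)),
    evalOp (onSections ρ V P).1 (pr.preimage_mono h) (pr.app W a) = pr.app W (evalOp P.1 h a)
  /-- The action of `pr⁻¹ 𝒟̃_{Y,k}^{(m)}` extends the action of `pr⁻¹ 𝒪_Y` by multiplication. -/
  mul : ∀ (V : Y.Opens) (a : Γ(Y, V)),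
    (onSections ρ V ⟨mulOp V a, (levelSubrings f ϖ p m k).mulOp_mem a⟩).1
      = mulOp (pr ⁻¹ᵁ V) (pr.app V a)
  /-- The Leibniz formula. -/
  leibniz : ∀ {V : Y.Opens} (c : Coordinates f V) (ν : Fin c.n → ℕ) {U : X.Opens}
    (h : U ≤ pr ⁻¹ᵁ V) (s t : Γ(X, U)),
    evalOp (onSections ρ V (c.levelSection ϖ p m k ν)).1 h (s * t) =
      ∑ μ ∈ Finset.Iic ν, (leibnizCoeff p m ν μ : Γ(X, U)) *
        (evalOp (onSections ρ V (c.levelSection ϖ p m k μ)).1 h s *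
          evalOp (onSections ρ V (c.levelSection ϖ p m k (ν - μ))).1 h t)

/-- The `𝒪_X`-module `pr^* 𝒟̃_{Y,k}^{(m)} = 𝒪_X ⊗_{pr⁻¹ 𝒪_Y} pr⁻¹ 𝒟̃_{Y,k}^{(m)}`. -/
noncomputable def pullbackLevelModule : X.Modules :=
  (Scheme.Modules.pullback pr).obj (levelModule f ϖ p m k)

variable {f ϖ p m k pr}

/-- A structure of sheaf of rings on the `𝒪_X`-module `pr^* 𝒟̃_{Y,k}^{(m)}` associated with an action
`ρ` of `pr⁻¹ 𝒟̃_{Y,k}^{(m)}` on `𝒪_X`. -/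
structure PullbackRingStructure (ρ : inverseImage pr (levelSheaf f ϖ p m k) ⟶ endSheaf X) where
  /-- A sheaf of rings. -/
  ring : TopCat.Sheaf RingCat.{u} X
  /-- Its underlying sheaf of abelian groups is `pr^* 𝒟̃_{Y,k}^{(m)}`. -/
  iso : ring.obj ⋙ forget₂ RingCat.{u} Ab.{u} ≅ (pullbackLevelModule f ϖ p m k pr).presheaf
  /-- The ring homomorphism `s ↦ s ⊗ 1`. -/
  left : X.ringCatSheaf ⟶ ring
  /-- The ring homomorphism `P ↦ 1 ⊗ P`. -/
  right : inverseImage pr (levelSheaf f ϖ p m k) ⟶ ring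
  /-- Left multiplication by `s ⊗ 1` is the `𝒪_X`-module structure of `pr^* 𝒟̃_{Y,k}^{(m)}`. -/
  left_mul : ∀ (U : X.Opens) (s : Γ(X, U)) (r : ring.obj.obj (op U)),
    iso.hom.app (op U) (left.hom.app (op U) s * r : ring.obj.obj (op U)) =
      (s • (iso.hom.app (op U) r : Γ(pullbackLevelModule f ϖ p m k pr, U)) :
        Γ(pullbackLevelModule f ϖ p m k pr, U))
  /-- The homomorphism `right` is `P ↦ 1 ⊗ P`. -/
  right_eq : ∀ (V : Y.Opens) (P : (levelSubrings f ϖ p m k).ring V),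
    iso.hom.app (op (pr ⁻¹ᵁ V)) (onSections right V P) =
      pullbackSection pr (levelModule f ϖ p m k) V P
  /-- The commutation formula
  `(1 ⊗ ∂^⟨ν⟩)(s ⊗ 1) = ∑_{μ ≤ ν} {ν, μ} ∂^⟨μ⟩(s) ⊗ ∂^⟨ν - μ⟩`, with `∂^⟨ν⟩` scaled by `ϖ^{k|ν|}`. -/
  commutation : ∀ {V : Y.Opens} (c : Coordinates f V) (ν : Fin c.n → ℕ) {U : X.Opens}
    (h : U ≤ pr ⁻¹ᵁ V) (s : Γ(X, U)),
    ring.obj.map (homOfLE h).op (onSections right V (c.levelSection ϖ p m k ν)) *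
        (left.hom.app (op U) s : ring.obj.obj (op U)) =
      ∑ μ ∈ Finset.Iic ν, (leibnizCoeff p m ν μ : ring.obj.obj (op U)) *
        ((left.hom.app (op U) (evalOp (onSections ρ V (c.levelSection ϖ p m k μ)).1 h s) :
            ring.obj.obj (op U)) *
          ring.obj.map (homOfLE h).op (onSections right V (c.levelSection ϖ p m k (ν - μ))))

end Structures

end ArithDiff

/-!
The blow-up `X` is covered by charts on which every function is a fraction `b / aʳ` with `a ∈ Iⁿ`
and `b ∈ Iⁿʳ`. On these charts `ϖ` is a nonzerodivisor, and where `ϖ` is invertible `pr` is an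
isomorphism because `ϖ ^ N ∈ I`. Hence an operator on `𝒪_{X₀}` extends to `𝒪_X` in at most one
way, and an identity between extended operators holds as soon as it holds on `𝒪_{X₀}`.

For the existence, `∂̃^ν` maps every power of `I` into itself: applied to a product of `r`
functions in `I`, the Leibniz formula either leaves a factor undifferentiated or produces a factor
`ϖ^k ∈ I` for it. So all `∂̃^μ(aʳ)` and `∂̃^ν(b)` are divisible by `aʳ` on the chart, and the
Leibniz formula for `∂̃^ν(aʳ s) = ∂̃^ν(b)` determines `∂̃^ν(s)` by recursion on `ν`.

Finally, evaluation at the monomials in the coordinates shows that the `∂̃^ν` act on `𝒪_X` by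
operators that are linearly independent over `𝒪_X`. Hence `s ⊗ P ↦ s ρ(P)` identifies
`pr^* 𝒟̃^{(m)}` with the sheaf of rings of endomorphisms of `𝒪_X` generated by the functions and the
operators `ρ(P)`, and the ring structure is transported along this identification.
-/

namespace ArithDiff

/-! ### Valuations of factorials -/

section Factorial

variable {p : ℕ} [hp : Fact p.Prime]

lemma padicValNat_factorial_eq_sum_add (m n : ℕ) :
    padicValNat p n.factorial =
      ∑ i ∈ Finset.Ico 1 (m + 1), n / p ^ i + padicValNat p (n / p ^ m).factorial := by
  induction m with
  | zero => simp
  | succ m ih =>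
    rw [ih, Finset.sum_Ico_succ_top (Nat.le_add_left 1 m), ← padicValNat_mul_div_factorial,
      padicValNat_factorial_mul, Nat.div_div_eq_div_mul, ← pow_succ, add_assoc,
      add_comm (n / p ^ (m + 1))]

lemma padicValNat_factorial_div_add_sum (m a b : ℕ) :
    padicValNat p ((a + b) / p ^ m).factorial + ∑ i ∈ Finset.Ico 1 (m + 1), (a + b) / p ^ i =
      padicValNat p ((a / p ^ m).factorial * (b / p ^ m).factorial * (a + b).choose a)
        + ∑ i ∈ Finset.Ico 1 (m + 1), (a / p ^ i + b / p ^ i) := by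
  have hfac : ∀ n : ℕ, n.factorial ≠ 0 := Nat.factorial_ne_zero
  have hchoose : (a + b).choose a ≠ 0 := (Nat.choose_pos (Nat.le_add_right a b)).ne'
  have h := congrArg (padicValNat p) (Nat.add_choose_mul_factorial_mul_factorial a b)
  rw [← Nat.choose_symm_add, padicValNat.mul (mul_ne_zero hchoose (hfac _)) (hfac _),
    padicValNat.mul hchoose (hfac _), padicValNat_factorial_eq_sum_add m a,
    padicValNat_factorial_eq_sum_add m b, padicValNat_factorial_eq_sum_add m (a + b)] at h
  rw [padicValNat.mul (mul_ne_zero (hfac _) (hfac _)) hchoose, padicValNat.mul (hfac _) (hfac _),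
    Finset.sum_add_distrib]
  omega

lemma padicValNat_factorial_div_le (m a b : ℕ) :
    padicValNat p ((a + b) / p ^ m).factorial ≤
      padicValNat p ((a / p ^ m).factorial * (b / p ^ m).factorial * (a + b).choose a) := by
  have hsum : ∑ i ∈ Finset.Ico 1 (m + 1), (a / p ^ i + b / p ^ i) ≤
      ∑ i ∈ Finset.Ico 1 (m + 1), (a + b) / p ^ i :=
    Finset.sum_le_sum fun _ _ => Nat.div_add_div_le_add_div
  have := padicValNat_factorial_div_add_sum (p := p) m a b
  omega

lemma padicValNat_factorial_div_eq_of_dvd {m a : ℕ} (ha : p ^ m ∣ a) (b : ℕ) :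
    padicValNat p ((a + b) / p ^ m).factorial =
      padicValNat p ((a / p ^ m).factorial * (b / p ^ m).factorial * (a + b).choose a) := by
  have hsum : ∑ i ∈ Finset.Ico 1 (m + 1), (a / p ^ i + b / p ^ i) =
      ∑ i ∈ Finset.Ico 1 (m + 1), (a + b) / p ^ i := by
    refine Finset.sum_congr rfl fun i hi => (Nat.add_div_of_dvd_right ?_).symm
    exact (pow_dvd_pow p (Nat.le_of_lt_succ (Finset.mem_Ico.1 hi).2)).trans ha
  have := padicValNat_factorial_div_add_sum (p := p) m a b
  omega

lemma natCast_dvd_natCast_of_padicValNat_le {R : Type*} [CommRing R]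
    (hR : ∀ n : ℕ, ¬ p ∣ n → IsUnit (n : R)) {a b : ℕ} (hb : b ≠ 0)
    (h : padicValNat p b ≤ padicValNat p a) : (b : R) ∣ (a : R) := by
  rcases eq_or_ne a 0 with rfl | ha
  · rw [Nat.cast_zero]
    exact dvd_zero _
  obtain ⟨e, c, hc, rfl⟩ := Nat.exists_eq_pow_mul_and_not_dvd hb p hp.out.ne_one
  have hpow : p ^ e ∣ a := (padicValNat_dvd_iff_le ha).2
    (((padicValNat_dvd_iff_le hb).1 (Dvd.intro _ rfl)).trans h)
  rw [Nat.cast_mul, (hR c hc).mul_right_dvd]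
  exact Nat.cast_dvd_cast hpow

variable {R : Type*} [CommRing R] (hR : ∀ n : ℕ, ¬ p ∣ n → IsUnit (n : R))
include hR

lemma factorial_div_dvd_mul_choose (m a b : ℕ) :
    (((a + b) / p ^ m).factorial : R) ∣
      ((a / p ^ m).factorial * (b / p ^ m).factorial * (a + b).choose a : ℕ) :=
  natCast_dvd_natCast_of_padicValNat_le hR (Nat.factorial_ne_zero _)
    (padicValNat_factorial_div_le m a b)

lemma mul_choose_dvd_factorial_div {m a b : ℕ} (h : p ^ m ∣ a ∨ b = 0) :
    (((a / p ^ m).factorial * (b / p ^ m).factorial * (a + b).choose a : ℕ) : R) ∣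
      ((a + b) / p ^ m).factorial := by
  rcases h with ha | rfl
  · refine natCast_dvd_natCast_of_padicValNat_le hR ?_ (padicValNat_factorial_div_eq_of_dvd ha b).ge
    exact mul_ne_zero (mul_ne_zero (Nat.factorial_ne_zero _) (Nat.factorial_ne_zero _))
      (Nat.choose_pos (Nat.le_add_right a b)).ne'
  · simp

end Factorial

lemma factorial_div_mul_factorial_sub_div_dvd (d : ℕ) {ν μ : ℕ} (h : μ ≤ ν) :
    (μ / d).factorial * ((ν - μ) / d).factorial ∣ (ν / d).factorial := by
  refine (Nat.factorial_mul_factorial_dvd_factorial_add _ _).trans (Nat.factorial_dvd_factorial ?_)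
  refine Nat.div_add_div_le_add_div.trans ?_
  rw [Nat.add_sub_cancel' h]

/-! ### Rings of operators generated by commuting derivations -/

/-- Commuting derivations `δ i` of a commutative ring `A`, dual to elements `x i` and with divided
powers `dp i ν`, as elements of a ring `E` of operators on `A`. The functions act on `E` by
multiplication on the left. -/
structure DerivationSystem (A E : Type*) [CommRing A] [Ring E] [Module A E] [Module E A]
    (n : ℕ) where
  x : Fin n → A
  δ : Fin n → E
  dp : Fin n → ℕ → E
  δ_comm : ∀ i j, Commute (δ i) (δ j)
  δ_mul_smul : ∀ i (a : A) (P : E), δ i * a • P = a • (δ i * P) + (δ i • a) • P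
  δ_smul_x : ∀ i j, δ i • x j = if i = j then 1 else 0
  factorial_smul_dp : ∀ i (ν : ℕ), ν.factorial • dp i ν = δ i ^ ν

namespace DerivationSystem

variable {A E : Type*} [CommRing A] [Ring E] [Module A E] [Module E A] {n : ℕ}
  (S : DerivationSystem A E n)

/-- The commutative ring of operators with integral coefficients generated by the divided powers of
the derivations `δ i`. -/
def constOp : Subring E := Subring.closure (Set.range fun q : Fin n × ℕ => S.dp q.1 q.2)

/-- The divided powers `δ i ^ ν / ν!` as elements of the commutative ring `constOp`. -/
def dpc (i : Fin n) (ν : ℕ) : S.constOp := ⟨S.dp i ν, Subring.subset_closure ⟨(i, ν), rfl⟩⟩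

lemma coe_dpc_one (i : Fin n) : (S.dpc i 1 : E) = S.δ i := by
  have h := S.factorial_smul_dp i 1
  rwa [Nat.factorial_one, one_smul, pow_one] at h

lemma factorial_smul_dpc (i : Fin n) (ν : ℕ) : ν.factorial • S.dpc i ν = S.dpc i 1 ^ ν := by
  refine Subtype.ext ((S.factorial_smul_dp i ν).trans ?_)
  rw [Subring.coe_pow, coe_dpc_one]

variable [IsAddTorsionFree E]

lemma dp_comm (i j : Fin n) (a b : ℕ) : Commute (S.dp i a) (S.dp j b) := by
  refine nsmul_right_injective (mul_ne_zero a.factorial_ne_zero b.factorial_ne_zero) ?_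
  have h := ((S.δ_comm i j).pow_pow a b).eq
  rw [← S.factorial_smul_dp, ← S.factorial_smul_dp, smul_mul_smul_comm, smul_mul_smul_comm,
    mul_comm b.factorial] at h
  exact h

instance : IsMulCommutative S.constOp :=
  Subring.isMulCommutative_closure (by rintro _ ⟨q, rfl⟩ _ ⟨q', rfl⟩; exact S.dp_comm _ _ _ _)

open scoped IsMulCommutative in
noncomputable instance : CommRing S.constOp := inferInstance

instance : IsAddTorsionFree S.constOp :=
  Function.Injective.isAddTorsionFree S.constOp.subtype.toAddMonoidHom Subtype.val_injective

lemma dpc_zero (i : Fin n) : S.dpc i 0 = 1 := by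
  simpa using S.factorial_smul_dpc i 0

lemma dpc_mul_dpc (i : Fin n) (a b : ℕ) :
    S.dpc i a * S.dpc i b = (a + b).choose a • S.dpc i (a + b) := by
  have h : (a.factorial * b.factorial) • (S.dpc i a * S.dpc i b) =
      (a.factorial * b.factorial) • ((a + b).choose a • S.dpc i (a + b)) := by
    rw [← smul_mul_smul_comm, factorial_smul_dpc, factorial_smul_dpc, ← pow_add,
      ← factorial_smul_dpc, smul_smul, ← Nat.add_choose_mul_factorial_mul_factorial a b,
      Nat.choose_symm_add]
    congr 1
    ring
  exact nsmul_right_injective (mul_ne_zero a.factorial_ne_zero b.factorial_ne_zero) h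

/-- The operator `∂^[ν]`. -/
noncomputable def dpow (ν : Fin n → ℕ) : S.constOp := ∏ i, S.dpc i (ν i)

lemma dpow_zero : S.dpow 0 = 1 := by
  simp [dpow, dpc_zero]

lemma dpow_single (i : Fin n) (ν : ℕ) : S.dpow (Pi.single i ν) = S.dpc i ν := by
  rw [dpow, Finset.prod_eq_single i (fun j _ hj => by rw [Pi.single_eq_of_ne hj, dpc_zero])
    (fun h => absurd (Finset.mem_univ i) h), Pi.single_eq_same]

lemma dpow_mul_dpow (ν μ : Fin n → ℕ) :
    S.dpow ν * S.dpow μ = (∏ i, (ν i + μ i).choose (ν i)) • S.dpow (ν + μ) := by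
  simp only [dpow, ← Finset.prod_mul_distrib, dpc_mul_dpc, Finset.prod_smul, Pi.add_apply]

lemma δ_mul_dpow (i : Fin n) (ν : Fin n → ℕ) :
    S.δ i * S.dpow ν = (ν i + 1) • (S.dpow (ν + Pi.single i 1) : E) := by
  have hcoeff : ∏ j, ((Pi.single i 1 : Fin n → ℕ) j + ν j).choose
      ((Pi.single i 1 : Fin n → ℕ) j) = ν i + 1 := by
    rw [Finset.prod_eq_single i (fun j _ hj => by simp [Pi.single_eq_of_ne hj])
      (fun h => absurd (Finset.mem_univ i) h)]
    simp [add_comm]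
  have h := congrArg Subtype.val (S.dpow_mul_dpow (Pi.single i 1) ν)
  rw [dpow_single, Subring.coe_mul, coe_dpc_one] at h
  rw [h, add_comm ν, ← hcoeff]
  rfl

open TensorProduct in
/-- The map `P ⊗ Q ↦ P(a) Q`. -/
noncomputable def actTensor (a : A) : S.constOp ⊗[ℤ] S.constOp →ₗ[ℤ] E :=
  TensorProduct.lift <| LinearMap.mk₂ ℤ (fun P Q : S.constOp => ((P : E) • a) • (Q : E))
    (fun P P' Q => by rw [Subring.coe_add, add_smul, add_smul])
    (fun c P Q => by
      rw [AddSubgroupClass.coe_zsmul, smul_assoc c (P : E) a, smul_assoc c])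
    (fun P Q Q' => by rw [Subring.coe_add, smul_add])
    (fun c P Q => by rw [AddSubgroupClass.coe_zsmul, smul_comm])

open TensorProduct in
lemma actTensor_tmul (a : A) (P Q : S.constOp) :
    S.actTensor a (P ⊗ₜ Q) = ((P : E) • a) • (Q : E) := rfl

open TensorProduct in
lemma δ_mul_actTensor (i : Fin n) (a : A) (z : S.constOp ⊗[ℤ] S.constOp) :
    S.δ i * S.actTensor a z = S.actTensor a ((S.dpc i 1 ⊗ₜ 1 + 1 ⊗ₜ S.dpc i 1) * z) := by
  induction z using TensorProduct.induction_on with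
  | zero => simp
  | tmul P Q =>
    rw [add_mul, map_add, Algebra.TensorProduct.tmul_mul_tmul, Algebra.TensorProduct.tmul_mul_tmul,
      actTensor_tmul, actTensor_tmul, actTensor_tmul, one_mul, one_mul, Subring.coe_mul,
      Subring.coe_mul, coe_dpc_one, S.δ_mul_smul, mul_smul, add_comm]
  | add z w hz hw => rw [map_add, mul_add, mul_add, map_add, hz, hw]

open TensorProduct in
lemma δ_pow_mul_actTensor (i : Fin n) (a : A) (ν : ℕ) (z : S.constOp ⊗[ℤ] S.constOp) :
    S.δ i ^ ν * S.actTensor a z =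
      S.actTensor a ((S.dpc i 1 ⊗ₜ 1 + 1 ⊗ₜ S.dpc i 1) ^ ν * z) := by
  induction ν generalizing z with
  | zero => simp
  | succ ν ih => rw [pow_succ, mul_assoc, δ_mul_actTensor, ih, pow_succ, mul_assoc]

open TensorProduct in
lemma factorial_smul_sum_dpc_tmul_dpc (i : Fin n) (ν : ℕ) :
    ν.factorial • ∑ μ ∈ Finset.Iic ν, S.dpc i μ ⊗ₜ[ℤ] S.dpc i (ν - μ) =
      (S.dpc i 1 ⊗ₜ[ℤ] 1 + 1 ⊗ₜ[ℤ] S.dpc i 1) ^ ν := by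
  rw [(Commute.all _ _).add_pow', Finset.Nat.sum_antidiagonal_eq_sum_range_succ_mk,
    Nat.range_succ_eq_Iic, Finset.smul_sum]
  refine Finset.sum_congr rfl fun μ hμ => ?_
  have hν : ν.choose μ * (μ.factorial * (ν - μ).factorial) = ν.factorial := by
    rw [← mul_assoc, Nat.choose_mul_factorial_mul_factorial (Finset.mem_Iic.1 hμ)]
  rw [Algebra.TensorProduct.tmul_pow, Algebra.TensorProduct.tmul_pow, one_pow, one_pow,
    Algebra.TensorProduct.tmul_mul_tmul, one_mul, mul_one, ← factorial_smul_dpc,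
    ← factorial_smul_dpc, ← TensorProduct.smul_tmul', TensorProduct.tmul_smul, smul_smul, smul_smul,
    mul_assoc, hν]

open TensorProduct in
lemma dp_mul_actTensor (i : Fin n) (a : A) (ν : ℕ) (z : S.constOp ⊗[ℤ] S.constOp) :
    S.dp i ν * S.actTensor a z =
      S.actTensor a ((∑ μ ∈ Finset.Iic ν, S.dpc i μ ⊗ₜ S.dpc i (ν - μ)) * z) := by
  refine nsmul_right_injective ν.factorial_ne_zero ?_
  change ν.factorial • _ = ν.factorial • _
  rw [← smul_mul_assoc, S.factorial_smul_dp, S.δ_pow_mul_actTensor, ← map_nsmul, ← smul_mul_assoc,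
    factorial_smul_sum_dpc_tmul_dpc]

open TensorProduct in
lemma prod_mul_actTensor {ι : Type*} (s : Finset ι) (P : ι → S.constOp)
    (z : ι → S.constOp ⊗[ℤ] S.constOp) {a : A}
    (h : ∀ i w, (P i : E) * S.actTensor a w = S.actTensor a (z i * w))
    (w : S.constOp ⊗[ℤ] S.constOp) :
    ((∏ i ∈ s, P i : S.constOp) : E) * S.actTensor a w = S.actTensor a ((∏ i ∈ s, z i) * w) := by
  classical
  induction s using Finset.induction_on generalizing w with
  | empty => simp
  | insert i s hi ih =>
    rw [Finset.prod_insert hi, Finset.prod_insert hi, Subring.coe_mul, mul_assoc, ih, h, mul_assoc]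

open TensorProduct in
lemma prod_sum_dpc_tmul_dpc (ν : Fin n → ℕ) :
    ∏ i, ∑ μ ∈ Finset.Iic (ν i), S.dpc i μ ⊗ₜ[ℤ] S.dpc i (ν i - μ) =
      ∑ μ ∈ Finset.Iic ν, S.dpow μ ⊗ₜ[ℤ] S.dpow (ν - μ) := by
  rw [Finset.prod_univ_sum]
  refine Finset.sum_congr rfl fun μ _ => ?_
  have hsplit : ∀ P Q : S.constOp, P ⊗ₜ[ℤ] Q =
      Algebra.TensorProduct.includeLeft (R := ℤ) (S := ℤ) (B := S.constOp) P *
        Algebra.TensorProduct.includeRight (R := ℤ) (A := S.constOp) Q := by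
    simp
  simp only [hsplit, dpow, Finset.prod_mul_distrib, map_prod, Pi.sub_apply]

lemma dpow_mul_smul [IsScalarTower A E E] (ν : Fin n → ℕ) (a : A) (P : E) :
    S.dpow ν * a • P =
      ∑ μ ∈ Finset.Iic ν, ((S.dpow μ : E) • a) • ((S.dpow (ν - μ) : E) * P) := by
  have hone : a • P = S.actTensor a 1 * P := by
    rw [Algebra.TensorProduct.one_def, actTensor_tmul, Subring.coe_one, one_smul, smul_one_mul]
  rw [hone, ← mul_assoc, dpow, S.prod_mul_actTensor _ _ _ fun i w => S.dp_mul_actTensor i a (ν i) w,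
    mul_one, prod_sum_dpc_tmul_dpc, map_sum, Finset.sum_mul]
  exact Finset.sum_congr rfl fun μ _ => by rw [actTensor_tmul, smul_mul_assoc]

end DerivationSystem

lemma smul_one_smul_eq_mul (A E : Type*) [CommRing A] [Ring E] [Module A E] [Module E A]
    [IsScalarTower A E A] (a b : A) : (a • (1 : E)) • b = a * b := by
  rw [smul_assoc, one_smul, smul_eq_mul]

lemma isAddTorsionFree_of_isScalarTower (A E : Type*) [CommRing A] [Ring E] [Module A E]
    [Module E A] [IsScalarTower A E A] [IsAddTorsionFree E] : IsAddTorsionFree A :=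
  Function.Injective.isAddTorsionFree (LinearMap.toSpanSingleton A E 1).toAddMonoidHom
    fun a b (h : a • (1 : E) = b • 1) => by
      simpa only [smul_one_smul_eq_mul, mul_one] using congrArg (fun P : E => P • (1 : A)) h

lemma natCast_mem_nonZeroDivisors {B : Type*} [CommRing B] [IsAddTorsionFree B] {N : ℕ}
    (hN : N ≠ 0) : (N : B) ∈ nonZeroDivisors B := by
  refine mem_nonZeroDivisors_iff_right.2 fun b hb => ?_
  rw [mul_comm, ← nsmul_eq_mul] at hb
  exact (smul_eq_zero.1 hb).resolve_left hN

namespace DerivationSystem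

variable {A E : Type*} [CommRing A] [Ring E] [Module A E] [Module E A] {n : ℕ}
  (S : DerivationSystem A E n)

/-- The monomial `x^μ`. -/
def monomial (μ : Fin n → ℕ) : A := ∏ i, S.x i ^ μ i

lemma monomial_zero : S.monomial 0 = 1 := by
  simp [monomial]

section Action

variable [IsScalarTower A E A]

/-- The operator `δ i`, as a derivation of `A`. -/
def derivation (i : Fin n) : Derivation ℤ A A :=
  Derivation.mk' (DistribSMul.toAddMonoidHom A (S.δ i)).toIntLinearMap fun a b => by
    have h := congrArg (fun P : E => P • b) (S.δ_mul_smul i a 1)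
    rw [mul_smul, add_smul, smul_one_smul_eq_mul, smul_one_smul_eq_mul, smul_assoc, mul_one] at h
    rw [smul_eq_mul, smul_eq_mul, mul_comm b]
    exact h

lemma derivation_apply (i : Fin n) (a : A) : S.derivation i a = S.δ i • a := rfl

lemma δ_smul_monomial (i : Fin n) (μ : Fin n → ℕ) :
    S.δ i • S.monomial μ = μ i • S.monomial (μ - Pi.single i 1) := by
  have hrest : S.derivation i (∏ j ∈ Finset.univ.erase i, S.x j ^ μ j) = 0 := by
    refine Finset.prod_induction _ (fun a => S.derivation i a = 0) (fun a b ha hb => ?_)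
      (S.derivation i).map_one_eq_zero fun j hj => ?_
    · rw [Derivation.leibniz, ha, hb, smul_zero, smul_zero, add_zero]
    · rw [Derivation.leibniz_pow, derivation_apply, S.δ_smul_x,
        if_neg (Finset.ne_of_mem_erase hj).symm, smul_zero, smul_zero]
  have hpow : ∏ j ∈ Finset.univ.erase i, S.x j ^ (μ - Pi.single i 1 : Fin n → ℕ) j =
      ∏ j ∈ Finset.univ.erase i, S.x j ^ μ j :=
    Finset.prod_congr rfl fun j hj => by simp [Finset.ne_of_mem_erase hj]
  rw [← derivation_apply, monomial, monomial, ← Finset.mul_prod_erase _ _ (Finset.mem_univ i),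
    ← Finset.mul_prod_erase _ _ (Finset.mem_univ i), hpow, Derivation.leibniz, hrest,
    Derivation.leibniz_pow, derivation_apply, S.δ_smul_x, if_pos rfl]
  simp [mul_comm, mul_assoc]

lemma δ_pow_smul_monomial (i : Fin n) (ν : ℕ) (μ : Fin n → ℕ) :
    S.δ i ^ ν • S.monomial μ = (μ i).descFactorial ν • S.monomial (μ - Pi.single i ν) := by
  induction ν with
  | zero => simp
  | succ ν ih =>
    rw [pow_succ', mul_smul, ih, smul_comm, δ_smul_monomial, smul_smul, Nat.descFactorial_succ,
      tsub_tsub, ← Pi.single_add, Pi.sub_apply, Pi.single_eq_same, mul_comm]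

variable [IsAddTorsionFree E]

lemma dp_smul_monomial (i : Fin n) (ν : ℕ) (μ : Fin n → ℕ) :
    S.dp i ν • S.monomial μ = (μ i).choose ν • S.monomial (μ - Pi.single i ν) := by
  have := isAddTorsionFree_of_isScalarTower A E
  refine nsmul_right_injective ν.factorial_ne_zero ?_
  change ν.factorial • _ = ν.factorial • _
  rw [← smul_assoc, S.factorial_smul_dp, δ_pow_smul_monomial, smul_smul,
    Nat.descFactorial_eq_factorial_mul_choose]

lemma prod_dpc_smul_monomial (s : Finset (Fin n)) (ν μ : Fin n → ℕ) :
    ((∏ i ∈ s, S.dpc i (ν i) : S.constOp) : E) • S.monomial μ =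
      (∏ i ∈ s, (μ i).choose (ν i)) • S.monomial (μ - ∑ i ∈ s, Pi.single i (ν i)) := by
  induction s using Finset.induction_on with
  | empty => simp
  | insert i s hi ih =>
    have hμ : (μ - ∑ j ∈ s, Pi.single j (ν j) : Fin n → ℕ) i = μ i := by
      rw [Pi.sub_apply, Finset.sum_apply, Finset.sum_eq_zero, tsub_zero]
      exact fun j hj => Pi.single_eq_of_ne (by rintro rfl; exact hi hj) _
    rw [Finset.prod_insert hi, Finset.prod_insert hi, Finset.sum_insert hi, Subring.coe_mul,
      mul_smul, ih, smul_comm, dpc, dp_smul_monomial, hμ, smul_smul, tsub_tsub, mul_comm,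
      add_comm]

lemma dpow_smul_monomial (ν μ : Fin n → ℕ) :
    (S.dpow ν : E) • S.monomial μ = (∏ i, (μ i).choose (ν i)) • S.monomial (μ - ν) := by
  rw [dpow, prod_dpc_smul_monomial, Finset.univ_sum_single]

lemma dpow_smul_monomial_self (μ : Fin n → ℕ) : (S.dpow μ : E) • S.monomial μ = 1 := by
  simp [dpow_smul_monomial, monomial_zero]

lemma dpow_smul_monomial_of_not_le {ν μ : Fin n → ℕ} (h : ¬ ν ≤ μ) :
    (S.dpow ν : E) • S.monomial μ = 0 := by
  obtain ⟨i, hi⟩ : ∃ i, μ i < ν i := by simpa [Pi.le_def] using h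
  rw [dpow_smul_monomial, Finset.prod_eq_zero (Finset.mem_univ i) (Nat.choose_eq_zero_of_lt hi),
    zero_smul]

lemma coeff_mem_of_forall_sum_dpow_smul_monomial_mem {B : Type*} [CommRing B] (φ : A →+* B)
    (J : Ideal B) (s : Finset (Fin n → ℕ)) (b : (Fin n → ℕ) → B)
    (h : ∀ μ, ∑ ν ∈ s, b ν * φ ((S.dpow ν : E) • S.monomial μ) ∈ J) : ∀ μ ∈ s, b μ ∈ J := by
  intro μ
  induction μ using WellFoundedLT.induction with
  | ind μ ih =>
    intro hμ
    have hsum := h μ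
    rw [← Finset.add_sum_erase _ _ hμ, dpow_smul_monomial_self, map_one, mul_one] at hsum
    refine (J.add_mem_iff_left (J.sum_mem fun ν hν => ?_)).1 hsum
    obtain ⟨hne, hνs⟩ := Finset.mem_erase.1 hν
    by_cases hle : ν ≤ μ
    · exact J.mul_mem_right _ (ih ν (lt_of_le_of_ne hle hne) hνs)
    · rw [S.dpow_smul_monomial_of_not_le hle, map_zero, mul_zero]
      exact J.zero_mem

end Action

/-- The coefficient `ϖ^{k|ν|} ∏ᵢ qᵢ!`, with `qᵢ = ⌊νᵢ / p^m⌋`, by which `∂̃^ν` differs from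
`∂^[ν]`. -/
def levelCoeff (ϖ : A) (p m k : ℕ) (ν : Fin n → ℕ) : A :=
  ϖ ^ (k * ∑ i, ν i) * (∏ i, (ν i / p ^ m).factorial : ℕ)

variable (ϖ : A) (p m k : ℕ)

lemma levelCoeff_zero : levelCoeff ϖ p m k (0 : Fin n → ℕ) = 1 := by
  simp [levelCoeff]

lemma levelCoeff_of_sum_le {ν : Fin n → ℕ} (h : ∑ i, ν i ≤ p ^ m) :
    levelCoeff ϖ p m k ν = ϖ ^ (k * ∑ i, ν i) := by
  have hfac : ∀ i, (ν i / p ^ m).factorial = 1 := fun i =>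
    Nat.factorial_eq_one.2 (Nat.div_le_of_le_mul (by
      simpa using (Finset.single_le_sum (fun _ _ => Nat.zero_le _) (Finset.mem_univ i)).trans h))
  simp [levelCoeff, hfac]

lemma levelCoeff_eq_leibnizCoeff_mul {ν μ : Fin n → ℕ} (h : μ ≤ ν) :
    levelCoeff ϖ p m k ν =
      leibnizCoeff p m ν μ * (levelCoeff ϖ p m k μ * levelCoeff ϖ p m k (ν - μ)) := by
  have hfac : ∏ i, (ν i / p ^ m).factorial = leibnizCoeff p m ν μ *
      ((∏ i, (μ i / p ^ m).factorial) * ∏ i, ((ν - μ) i / p ^ m).factorial) := by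
    rw [leibnizCoeff, ← Finset.prod_mul_distrib, ← Finset.prod_mul_distrib]
    exact Finset.prod_congr rfl fun i _ =>
      (Nat.div_mul_cancel (factorial_div_mul_factorial_sub_div_dvd _ (h i))).symm
  have hsum : ∑ i, ν i = ∑ i, μ i + ∑ i, (ν - μ) i := by
    rw [← Finset.sum_add_distrib]
    exact Finset.sum_congr rfl fun i _ => (Nat.add_sub_cancel' (h i)).symm
  rw [levelCoeff, levelCoeff, levelCoeff, hfac, hsum, mul_add, pow_add]
  push_cast
  ring

lemma levelCoeff_mul_levelCoeff_mul_prod_choose (ν μ : Fin n → ℕ) :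
    levelCoeff ϖ p m k ν * levelCoeff ϖ p m k μ * (∏ i, (ν i + μ i).choose (ν i) : ℕ) =
      ϖ ^ (k * ∑ i, (ν + μ) i) * ∏ i, (((ν i / p ^ m).factorial * (μ i / p ^ m).factorial *
        (ν i + μ i).choose (ν i) : ℕ) : A) := by
  simp only [levelCoeff, Pi.add_apply, Finset.sum_add_distrib, mul_add, pow_add, Nat.cast_mul,
    Finset.prod_mul_distrib, Nat.cast_prod]
  ring

section Divisibility

variable {p} [Fact p.Prime] (hA : ∀ l : ℕ, ¬ p ∣ l → IsUnit (l : A))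
include hA

lemma levelCoeff_add_dvd (ν μ : Fin n → ℕ) : levelCoeff ϖ p m k (ν + μ) ∣
    levelCoeff ϖ p m k ν * levelCoeff ϖ p m k μ * (∏ i, (ν i + μ i).choose (ν i) : ℕ) := by
  rw [levelCoeff_mul_levelCoeff_mul_prod_choose, levelCoeff, Nat.cast_prod]
  exact mul_dvd_mul_left _ (Finset.prod_dvd_prod_of_dvd _ _ fun i _ =>
    factorial_div_dvd_mul_choose hA m (ν i) (μ i))

lemma dvd_levelCoeff_add {ν μ : Fin n → ℕ} (h : ∀ i, p ^ m ∣ ν i ∨ μ i = 0) :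
    levelCoeff ϖ p m k ν * levelCoeff ϖ p m k μ * (∏ i, (ν i + μ i).choose (ν i) : ℕ) ∣
      levelCoeff ϖ p m k (ν + μ) := by
  rw [levelCoeff_mul_levelCoeff_mul_prod_choose, levelCoeff, Nat.cast_prod]
  exact mul_dvd_mul_left _ (Finset.prod_dvd_prod_of_dvd _ _ fun i _ =>
    mul_choose_dvd_factorial_div hA (h i))

end Divisibility

variable [IsAddTorsionFree E]

/-- The operator `∂̃^ν = ϖ^{k|ν|} ∂^⟨ν⟩`. -/
noncomputable def op (ν : Fin n → ℕ) : E := levelCoeff ϖ p m k ν • (S.dpow ν : E)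

lemma op_zero : S.op ϖ p m k 0 = 1 := by
  rw [op, levelCoeff_zero, dpow_zero, one_smul, Subring.coe_one]

section Leibniz

variable [IsScalarTower A E A]

lemma linearIndependent_op_smul_monomial {B : Type*} [CommRing B] [IsAddTorsionFree B] (φ : A →+* B)
    (hϖ : φ ϖ ∈ nonZeroDivisors B) :
    LinearIndependent B fun ν μ => φ (S.op ϖ p m k ν • S.monomial μ) := by
  have hcoeff : ∀ ν : Fin n → ℕ, φ (levelCoeff ϖ p m k ν) ∈ nonZeroDivisors B := by
    intro ν
    rw [levelCoeff, map_mul, map_pow, map_natCast]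
    refine mul_mem (pow_mem hϖ _) (natCast_mem_nonZeroDivisors ?_)
    exact Finset.prod_ne_zero_iff.2 fun i _ => Nat.factorial_ne_zero _
  refine linearIndependent_iff'.2 fun s b hb ν hν => ?_
  refine (hcoeff ν).2 _ ((Submodule.mem_bot B).1 ?_)
  refine S.coeff_mem_of_forall_sum_dpow_smul_monomial_mem φ ⊥ s
    (fun ν => b ν * φ (levelCoeff ϖ p m k ν)) (fun μ => ?_) ν hν
  rw [Submodule.mem_bot]
  refine Eq.trans ?_ (congrFun hb μ)
  rw [Finset.sum_apply]
  refine Finset.sum_congr rfl fun ν _ => ?_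
  rw [Pi.smul_apply, op, smul_assoc, smul_eq_mul, smul_eq_mul, map_mul, mul_assoc]

variable [IsScalarTower A E E]

lemma op_mul_smul (ν : Fin n → ℕ) (a : A) (P : E) :
    S.op ϖ p m k ν * a • P = ∑ μ ∈ Finset.Iic ν,
      (leibnizCoeff p m ν μ * (S.op ϖ p m k μ • a)) • (S.op ϖ p m k (ν - μ) * P) := by
  rw [op, smul_mul_assoc, dpow_mul_smul, Finset.smul_sum]
  refine Finset.sum_congr rfl fun μ hμ => ?_
  rw [levelCoeff_eq_leibnizCoeff_mul ϖ p m k (Finset.mem_Iic.1 hμ), op, op, smul_mul_assoc,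
    smul_assoc (levelCoeff ϖ p m k μ), smul_smul, smul_smul, smul_eq_mul]
  congr 1
  ring

lemma op_smul_mul (ν : Fin n → ℕ) (a b : A) :
    S.op ϖ p m k ν • (a * b) = ∑ μ ∈ Finset.Iic ν,
      leibnizCoeff p m ν μ * ((S.op ϖ p m k μ • a) * (S.op ϖ p m k (ν - μ) • b)) := by
  rw [← smul_one_smul_eq_mul A E a b, ← mul_smul, op_mul_smul, Finset.sum_smul]
  refine Finset.sum_congr rfl fun μ _ => ?_
  rw [mul_one, smul_assoc, smul_eq_mul, mul_assoc]

end Leibniz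

section Constant

variable {ϖ} (hϖ : ∀ i, S.δ i • ϖ = 0)

omit [IsAddTorsionFree E] in
include hϖ in
lemma δ_smul_levelCoeff [IsScalarTower A E A] (i : Fin n) (ν : Fin n → ℕ) :
    S.δ i • levelCoeff ϖ p m k ν = 0 := by
  have hϖ' : S.derivation i ϖ = 0 := hϖ i
  rw [← derivation_apply, levelCoeff, Derivation.leibniz, Derivation.leibniz_pow, hϖ',
    Derivation.map_natCast, smul_zero, smul_zero, smul_zero, smul_zero, add_zero]

variable [IsScalarTower A E E]

lemma commute_smul_one_of_mem_constOp {c : A} (hc : ∀ i, S.δ i • c = 0) {P : E}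
    (hP : P ∈ S.constOp) : Commute P (c • 1) := by
  suffices S.constOp ≤ Subring.centralizer {c • (1 : E)} from
    (Subring.mem_centralizer_iff.1 (this hP) _ rfl).symm
  refine (Subring.closure_le).2 ?_
  rintro _ ⟨⟨i, ν⟩, rfl⟩
  refine Subring.mem_centralizer_iff.2 ?_
  rintro _ rfl
  have hδ : Commute (c • (1 : E)) (S.δ i) := by
    rw [Commute, SemiconjBy, S.δ_mul_smul, hc, zero_smul, add_zero, mul_one, smul_one_mul]
  refine nsmul_right_injective ν.factorial_ne_zero ?_
  change ν.factorial • _ = ν.factorial • _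
  rw [← mul_smul_comm, ← smul_mul_assoc, S.factorial_smul_dp]
  exact (hδ.pow_right ν).eq

lemma dpow_mul_smul_of_δ_smul_eq_zero {c : A} (hc : ∀ i, S.δ i • c = 0) (ν : Fin n → ℕ) (P : E) :
    S.dpow ν * c • P = c • (S.dpow ν * P) := by
  rw [← smul_one_mul c P, ← mul_assoc, (S.commute_smul_one_of_mem_constOp hc (S.dpow ν).2).eq,
    mul_assoc, smul_one_mul]

variable [IsScalarTower A E A]

include hϖ in
lemma op_mul_op_eq_smul_dpow (ν μ : Fin n → ℕ) : S.op ϖ p m k ν * S.op ϖ p m k μ =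
    (levelCoeff ϖ p m k ν * levelCoeff ϖ p m k μ * (∏ i, (ν i + μ i).choose (ν i) : ℕ)) •
      (S.dpow (ν + μ) : E) := by
  have hdpow : (S.dpow ν * S.dpow μ : E) =
      (∏ i, (ν i + μ i).choose (ν i)) • (S.dpow (ν + μ) : E) :=
    congrArg Subtype.val (S.dpow_mul_dpow ν μ)
  rw [op, op, smul_mul_assoc,
    S.dpow_mul_smul_of_δ_smul_eq_zero (S.δ_smul_levelCoeff p m k hϖ · μ), hdpow, smul_smul,
    mul_smul _ (Nat.cast _), Nat.cast_smul_eq_nsmul]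

variable {p} [Fact p.Prime] (hA : ∀ l : ℕ, ¬ p ∣ l → IsUnit (l : A))
include hϖ hA

lemma exists_op_mul_op_eq_smul (ν μ : Fin n → ℕ) :
    ∃ r : A, S.op ϖ p m k ν * S.op ϖ p m k μ = r • S.op ϖ p m k (ν + μ) := by
  obtain ⟨r, hr⟩ := levelCoeff_add_dvd ϖ m k hA ν μ
  exact ⟨r, by rw [S.op_mul_op_eq_smul_dpow p m k hϖ, hr, op, smul_smul, mul_comm]⟩

lemma exists_op_add_eq_smul {ν μ : Fin n → ℕ} (h : ∀ i, p ^ m ∣ ν i ∨ μ i = 0) :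
    ∃ r : A, S.op ϖ p m k (ν + μ) = r • (S.op ϖ p m k ν * S.op ϖ p m k μ) := by
  obtain ⟨r, hr⟩ := dvd_levelCoeff_add ϖ m k hA h
  exact ⟨r, by rw [S.op_mul_op_eq_smul_dpow p m k hϖ, smul_smul, op, hr, mul_comm]⟩

lemma op_mul_mem_span (ν : Fin n → ℕ) {Q : E}
    (hQ : Q ∈ Submodule.span A (Set.range (S.op ϖ p m k))) :
    S.op ϖ p m k ν * Q ∈ Submodule.span A (Set.range (S.op ϖ p m k)) := by
  induction hQ using Submodule.span_induction generalizing ν with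
  | mem Q hQ =>
    obtain ⟨μ, rfl⟩ := hQ
    obtain ⟨r, hr⟩ := S.exists_op_mul_op_eq_smul m k hϖ hA ν μ
    rw [hr]
    exact Submodule.smul_mem _ _ (Submodule.subset_span ⟨ν + μ, rfl⟩)
  | zero => rw [mul_zero]; exact zero_mem _
  | add Q Q' _ _ hQ hQ' => rw [mul_add]; exact add_mem (hQ ν) (hQ' ν)
  | smul b Q _ hQ =>
    rw [op_mul_smul]
    exact Submodule.sum_mem _ fun μ _ => Submodule.smul_mem _ _ (hQ (ν - μ))

/-- The ring of `A`-linear combinations of the operators `∂̃^ν`. -/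
noncomputable def opSubring : Subring E :=
  { (Submodule.span A (Set.range (S.op ϖ p m k))).toAddSubgroup with
    one_mem' := Submodule.subset_span ⟨0, S.op_zero ϖ p m k⟩
    mul_mem' := fun {_ Q} hP hQ =>
      (Submodule.span_le (p := (Submodule.span A _).comap (LinearMap.mulRight A Q))).2
        (Set.range_subset_iff.2 fun ν => S.op_mul_mem_span m k hϖ hA ν hQ) hP }

lemma mem_opSubring {P : E} : P ∈ S.opSubring m k hϖ hA ↔
    P ∈ Submodule.span A (Set.range (S.op ϖ p m k)) := Iff.rfl

lemma smul_one_mem_opSubring (a : A) : a • 1 ∈ S.opSubring m k hϖ hA :=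
  Submodule.smul_mem _ a (S.opSubring m k hϖ hA).one_mem

lemma op_mem_of_op_single_mem {T : Subring E} (hsmul : ∀ a : A, a • 1 ∈ T)
    (hsingle : ∀ i, ∀ d ≤ p ^ m, S.op ϖ p m k (Pi.single i d) ∈ T) (ν : Fin n → ℕ) :
    S.op ϖ p m k ν ∈ T := by
  induction ν using WellFoundedLT.induction with
  | ind ν ih =>
    rcases eq_or_ne ν 0 with rfl | hν
    · rw [op_zero]
      exact T.one_mem
    obtain ⟨i, hi⟩ := Function.ne_iff.1 hν
    have hpm : 0 < p ^ m := pow_pos (Fact.out : p.Prime).pos m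
    have hle : Pi.single i (min (ν i) (p ^ m)) ≤ ν := by
      intro j
      rcases eq_or_ne j i with rfl | hj
      · rw [Pi.single_eq_same]
        exact min_le_left _ _
      · rw [Pi.single_eq_of_ne hj]
        exact Nat.zero_le _
    have hsplit : ∀ j, p ^ m ∣ (Pi.single i (min (ν i) (p ^ m)) : Fin n → ℕ) j ∨
        (ν - Pi.single i (min (ν i) (p ^ m)) : Fin n → ℕ) j = 0 := by
      intro j
      rcases eq_or_ne j i with rfl | hj
      · rw [Pi.sub_apply, Pi.single_eq_same]
        rcases le_total (ν j) (p ^ m) with h | h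
        · exact Or.inr (by rw [min_eq_left h, Nat.sub_self])
        · exact Or.inl (by rw [min_eq_right h])
      · exact Or.inl (by rw [Pi.single_eq_of_ne hj]; exact dvd_zero _)
    have hlt : ν - Pi.single i (min (ν i) (p ^ m)) < ν := by
      refine lt_of_le_of_ne tsub_le_self fun h => ?_
      have hi' : ν i - min (ν i) (p ^ m) = ν i := by simpa using congrFun h i
      have hi'' : ν i ≠ 0 := hi
      omega
    obtain ⟨r, hr⟩ := S.exists_op_add_eq_smul m k hϖ hA hsplit
    rw [add_tsub_cancel_of_le hle] at hr
    rw [hr, ← smul_one_mul]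
    exact mul_mem (hsmul r) (mul_mem (hsingle i _ (min_le_right _ _)) (ih _ hlt))

end Constant

/-! ### Change of coordinates -/

/-- The operators of order at most `d`. -/
noncomputable def orderLE (d : ℕ) : Submodule A E :=
  Submodule.span A ((fun ν => (S.dpow ν : E)) '' {ν | ∑ i, ν i ≤ d})

lemma pow_smul_mem_span_op_of_mem_orderLE {d : ℕ} (hd : d ≤ p ^ m) {P : E}
    (hP : P ∈ S.orderLE d) :
    ϖ ^ (k * d) • P ∈ Submodule.span A (Set.range (S.op ϖ p m k)) := by
  refine (Submodule.span_le (p := (Submodule.span A (Set.range (S.op ϖ p m k))).comap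
    (LinearMap.lsmul A E (ϖ ^ (k * d))))).2 ?_ hP
  rintro _ ⟨ν, hν, rfl⟩
  have hν' : ∑ i, ν i ≤ d := hν
  have hop : ϖ ^ (k * d) • (S.dpow ν : E) = ϖ ^ (k * (d - ∑ i, ν i)) • S.op ϖ p m k ν := by
    rw [op, levelCoeff_of_sum_le _ _ _ _ (hν'.trans hd), smul_smul, ← pow_add, ← mul_add,
      Nat.sub_add_cancel hν']
  change ϖ ^ (k * d) • (S.dpow ν : E) ∈ Submodule.span A (Set.range (S.op ϖ p m k))
  rw [hop]
  exact Submodule.smul_mem _ _ (Submodule.subset_span ⟨ν, rfl⟩)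

lemma δ_mul_mem_orderLE {d : ℕ} (i : Fin n) {P : E} (hP : P ∈ S.orderLE d) :
    S.δ i * P ∈ S.orderLE (d + 1) := by
  induction hP using Submodule.span_induction with
  | mem P hP =>
    obtain ⟨ν, hν, rfl⟩ := hP
    have hν' : ∑ j, (ν + Pi.single i 1 : Fin n → ℕ) j ≤ d + 1 := by
      simpa [Finset.sum_add_distrib] using hν
    change S.δ i * S.dpow ν ∈ S.orderLE (d + 1)
    rw [δ_mul_dpow]
    have hmem : (S.dpow (ν + Pi.single i 1) : E) ∈ S.orderLE (d + 1) :=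
      Submodule.subset_span ⟨_, hν', rfl⟩
    exact nsmul_mem hmem _
  | zero => rw [mul_zero]; exact zero_mem _
  | add P Q _ _ hP hQ => rw [mul_add]; exact add_mem hP hQ
  | smul a P hP' hP =>
    rw [S.δ_mul_smul]
    refine add_mem (Submodule.smul_mem _ _ hP) (Submodule.smul_mem _ _ ?_)
    exact Submodule.span_mono (Set.image_mono fun ν (h : _ ≤ d) => h.trans d.le_succ) hP'

lemma sum_smul_δ_pow_mem_orderLE [IsScalarTower A E E] (α : Fin n → A) (d : ℕ) :
    (∑ i, α i • S.δ i) ^ d ∈ S.orderLE d := by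
  induction d with
  | zero =>
    rw [pow_zero]
    have h : (S.dpow 0 : E) ∈ S.orderLE 0 := Submodule.subset_span ⟨0, by simp, rfl⟩
    rwa [dpow_zero, Subring.coe_one] at h
  | succ d ih =>
    rw [pow_succ', Finset.sum_mul]
    refine sum_mem fun i _ => ?_
    rw [smul_mul_assoc]
    exact Submodule.smul_mem _ _ (S.δ_mul_mem_orderLE i ih)

variable [IsScalarTower A E A]

lemma mem_orderLE_of_nsmul_mem {d N : ℕ} (hN : N ≠ 0) {P : E} (hP : N • P ∈ S.orderLE d) :
    P ∈ S.orderLE d := by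
  obtain ⟨b, hb, hbP⟩ := (Finsupp.mem_span_image_iff_linearCombination A).1 hP
  have hdvd : ∀ ν ∈ b.support, (N : A) ∣ b ν := by
    intro ν hν
    refine Ideal.mem_span_singleton.1 (S.coeff_mem_of_forall_sum_dpow_smul_monomial_mem
      (RingHom.id A) (Ideal.span {(N : A)}) b.support b (fun μ => ?_) ν hν)
    have hμ := congrArg (fun Q : E => Q • S.monomial μ) hbP
    simp only [Finsupp.linearCombination_apply, Finsupp.sum, Finset.sum_smul, smul_assoc,
      smul_eq_mul] at hμ
    exact Ideal.mem_span_singleton.2 ⟨P • S.monomial μ, hμ.trans (nsmul_eq_mul _ _)⟩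
  choose! c hc using hdvd
  have hPc : P = ∑ ν ∈ b.support, c ν • (S.dpow ν : E) := by
    refine nsmul_right_injective hN ?_
    change N • P = N • _
    rw [← hbP, Finsupp.linearCombination_apply, Finsupp.sum, Finset.smul_sum]
    refine Finset.sum_congr rfl fun ν hν => ?_
    rw [hc ν hν, mul_smul, Nat.cast_smul_eq_nsmul]
  rw [hPc]
  exact sum_mem fun ν hν => Submodule.smul_mem _ _ (Submodule.subset_span ⟨ν, hb hν, rfl⟩)

variable [IsScalarTower A E E]

lemma op_mem_opSubring_of_δ_eq_sum {p : ℕ} [Fact p.Prime] (hA : ∀ l : ℕ, ¬ p ∣ l → IsUnit (l : A))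
    {ϖ : A} (hϖ : ∀ i, S.δ i • ϖ = 0) {n' : ℕ} (S' : DerivationSystem A E n')
    (hϖ' : ∀ j, S'.δ j • ϖ = 0) (α : Fin n' → Fin n → A) (hα : ∀ j, S'.δ j = ∑ i, α j i • S.δ i)
    (ν : Fin n' → ℕ) : S'.op ϖ p m k ν ∈ S.opSubring m k hϖ hA := by
  refine S'.op_mem_of_op_single_mem m k hϖ' hA (S.smul_one_mem_opSubring m k hϖ hA)
    (fun j d hd => ?_) ν
  have hdp : S'.dp j d ∈ S.orderLE d := by
    refine S.mem_orderLE_of_nsmul_mem d.factorial_ne_zero ?_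
    rw [S'.factorial_smul_dp, hα]
    exact S.sum_smul_δ_pow_mem_orderLE _ _
  have hsum : ∑ i, (Pi.single j d : Fin n' → ℕ) i = d := by simp
  rw [op, dpow_single, levelCoeff_of_sum_le _ _ _ _ (hsum.trans_le hd), hsum]
  exact S.pow_smul_mem_span_op_of_mem_orderLE _ _ _ _ hd hdp

end DerivationSystem

/-! ### Operators on the structure sheaf -/

lemma exists_section_of_locally_unique {C : Type (u + 1)} [Category.{u} C]
    {FC : C → C → Type*} {CC : C → Type u} [∀ X Y, FunLike (FC X Y) (CC X) (CC Y)]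
    [ConcreteCategory.{u} C FC] [Limits.HasLimits C] [(forget C).ReflectsIsomorphisms]
    [Limits.PreservesLimits (forget C)] {X : TopCat.{u}} (F : TopCat.Sheaf C X) {V : Opens X}
    (Q : ∀ W : Opens X, ToType (F.obj.obj (op W)) → Prop)
    (hres : ∀ (W W' : Opens X) (h : W' ≤ W) t, Q W t → Q W' (F.obj.map (homOfLE h).op t))
    (huniq : ∀ W ≤ V, ∀ t t', Q W t → Q W t' → t = t')
    (hex : ∀ x ∈ V, ∃ W ≤ V, x ∈ W ∧ ∃ t, Q W t) :
    ∃ t, ∀ x ∈ V, ∃ (W : Opens X) (h : W ≤ V), x ∈ W ∧ Q W (F.obj.map (homOfLE h).op t) := by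
  choose W hW hxW t ht using fun x : V => hex x.1 x.2
  obtain ⟨t', ht', -⟩ := F.existsUnique_gluing' W V (fun x => homOfLE (hW x))
    (fun x hx => Opens.mem_iSup.2 ⟨⟨x, hx⟩, hxW ⟨x, hx⟩⟩) t
    (fun x y => huniq _ (inf_le_left.trans (hW x)) _ _ (hres _ _ inf_le_left _ (ht x))
      (hres _ _ inf_le_right _ (ht y)))
  refine ⟨t', fun x hx => ⟨W ⟨x, hx⟩, hW _, hxW _, ?_⟩⟩
  have hQ := ht ⟨x, hx⟩
  rwa [← ht' ⟨x, hx⟩] at hQ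

section Restriction

variable {X : Scheme.{u}} {V W W' : X.Opens}

/-- Restriction of functions along an inclusion of opens, as a ring homomorphism between the rings
`Γ(X, V)` rather than as a morphism of `CommRingCat`. -/
def resHom (h : W ≤ V) : Γ(X, V) →+* Γ(X, W) := (X.presheaf.map (homOfLE h).op).hom

lemma resHom_resHom (h : W ≤ V) (h' : W' ≤ W) (s : Γ(X, V)) :
    resHom h' (resHom h s) = resHom (h'.trans h) s := by
  change (X.presheaf.map (homOfLE h).op ≫ X.presheaf.map (homOfLE h').op) s = _
  rw [← Functor.map_comp]
  rfl

lemma resHom_self (h : V ≤ V) (s : Γ(X, V)) : resHom h s = s := by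
  change (X.presheaf.map (𝟙 (op V))) s = s
  rw [X.presheaf.map_id]
  rfl

lemma eq_of_locally_resHom_eq {s t : Γ(X, V)}
    (h : ∀ x ∈ V, ∃ (W : X.Opens) (h : W ≤ V), x ∈ W ∧ resHom h s = resHom h t) : s = t := by
  choose W hW hxW hs using fun x : V => h x.1 x.2
  exact X.sheaf.eq_of_locally_eq' W V (fun x => homOfLE (hW x))
    (fun x hx => Opens.mem_iSup.2 ⟨⟨x, hx⟩, hxW ⟨x, hx⟩⟩) s t hs

lemma app_resHom {Y : Scheme.{u}} (pr : Y ⟶ X) (h : W ≤ V) (s : Γ(X, V)) :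
    pr.app W (resHom h s) = resHom (pr.preimage_mono h) (pr.app V s) := by
  change (X.presheaf.map (homOfLE h).op ≫ pr.app W) s = _
  rw [pr.naturality]
  rfl

end Restriction

section EndRing

instance (X : Scheme.{u}) (V : X.Opens) : Ring (endRing X V) := (endRing X V).toRing

instance (X : Scheme.{u}) (S : LocalSubrings X) (V : X.Opens) : Ring (S.ring V) := (S.ring V).toRing

instance (X : Scheme.{u}) (S : LocalSubrings X) (V : X.Opens) : NonAssocSemiring (S.ring V) :=
  (S.ring V).toRing.toNonAssocSemiring

variable {X : Scheme.{u}} {V W W' : X.Opens}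

lemma evalOp_resHom (P : endRing X V) (h : W ≤ V) (h' : W' ≤ W) (s : Γ(X, W)) :
    evalOp P (h'.trans h) (resHom h' s) = resHom h' (evalOp P h s) :=
  P.2 ⟨W, h⟩ ⟨W', h'.trans h⟩ h' s

lemma evalOp_res (P : endRing X V) (h : W ≤ V) (h' : W' ≤ W) :
    evalOp (endRing.res h P) h' = evalOp P (h'.trans h) := rfl

lemma evalOp_mulOp (a : Γ(X, V)) (h : W ≤ V) (s : Γ(X, W)) :
    evalOp (mulOp V a) h s = resHom h a * s := rfl

lemma evalOp_mul (P Q : endRing X V) (h : W ≤ V) (s : Γ(X, W)) :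
    evalOp (P * Q) h s = evalOp P h (evalOp Q h s) := rfl

lemma evalOp_add (P Q : endRing X V) (h : W ≤ V) (s : Γ(X, W)) :
    evalOp (P + Q) h s = evalOp P h s + evalOp Q h s := rfl

lemma evalOp_sub (P Q : endRing X V) (h : W ≤ V) (s : Γ(X, W)) :
    evalOp (P - Q) h s = evalOp P h s - evalOp Q h s := rfl

lemma evalOp_sum {κ : Type*} (S : Finset κ) (P : κ → endRing X V) (h : W ≤ V) (s : Γ(X, W)) :
    evalOp (∑ i ∈ S, P i) h s = ∑ i ∈ S, evalOp (P i) h s :=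
  map_sum (AddMonoidHom.mk' (fun P => evalOp P h s) fun P Q => evalOp_add P Q h s) P S

lemma evalOp_nsmul (n : ℕ) (P : endRing X V) (h : W ≤ V) (s : Γ(X, W)) :
    evalOp (n • P) h s = n • evalOp P h s :=
  map_nsmul (AddMonoidHom.mk' (fun P => evalOp P h s) fun P Q => evalOp_add P Q h s) n P

lemma endRing_ext {P Q : endRing X V}
    (h : ∀ (W : X.Opens) (h : W ≤ V) (s : Γ(X, W)), evalOp P h s = evalOp Q h s) : P = Q := by
  ext W s
  exact h W.1 W.2 s

lemma endRing_eq_of_locally_res_eq {X : Scheme.{u}} {V : X.Opens} {P Q : endRing X V}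
    (h : ∀ x ∈ V, ∃ (W : X.Opens) (h : W ≤ V), x ∈ W ∧ endRing.res h P = endRing.res h Q) :
    P = Q := by
  refine endRing_ext fun U hU s => eq_of_locally_resHom_eq fun x hx => ?_
  obtain ⟨W, hW, hxW, hPQ⟩ := h x (hU hx)
  refine ⟨U ⊓ W, inf_le_left, ⟨hx, hxW⟩, ?_⟩
  rw [← evalOp_resHom, ← evalOp_resHom]
  exact congrArg (fun P => evalOp P inf_le_right (resHom inf_le_left s)) hPQ

lemma mulOp_injective : Function.Injective (mulOp (X := X) V) := by
  intro a b h
  have hone := congrArg (fun P : endRing X V => evalOp P le_rfl 1) h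
  simpa only [evalOp_mulOp, resHom_self, mul_one] using hone

instance : Module Γ(X, V) (endRing X V) := Module.compHom _ (mulOp V)

lemma smul_eq_mulOp_mul (a : Γ(X, V)) (P : endRing X V) : a • P = mulOp V a * P := rfl

lemma evalOp_smul (a : Γ(X, V)) (P : endRing X V) (h : W ≤ V) (s : Γ(X, W)) :
    evalOp (a • P) h s = resHom h a * evalOp P h s := rfl

lemma res_smul (h : W ≤ V) (a : Γ(X, V)) (P : endRing X V) :
    endRing.res h (a • P) = resHom h a • endRing.res h P := by
  rw [smul_eq_mulOp_mul, map_mul, res_mulOp]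
  rfl

instance : Module (endRing X V) Γ(X, V) where
  smul P s := evalOp P le_rfl s
  one_smul _ := rfl
  mul_smul _ _ _ := rfl
  smul_zero P := map_zero (evalOp P le_rfl)
  smul_add P := map_add (evalOp P le_rfl)
  add_smul _ _ _ := rfl
  zero_smul _ := rfl

lemma smul_eq_evalOp (P : endRing X V) (s : Γ(X, V)) : P • s = evalOp P le_rfl s := rfl

instance : IsScalarTower Γ(X, V) (endRing X V) (endRing X V) :=
  ⟨fun a P Q => mul_assoc (mulOp V a) P Q⟩

instance : IsScalarTower Γ(X, V) (endRing X V) Γ(X, V) where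
  smul_assoc a P s := by
    rw [smul_eq_evalOp, evalOp_smul, resHom_self, smul_eq_mul, smul_eq_evalOp]

instance [∀ W : X.Opens, IsAddTorsionFree Γ(X, W)] : IsAddTorsionFree (endRing X V) where
  nsmul_right_injective n hn P Q h := endRing_ext fun W hW s => nsmul_right_injective hn (by
    have hs := congrArg (fun P => evalOp P hW s) h
    simpa only [evalOp_nsmul] using hs)

end EndRing

/-! ### Flat schemes over a base ring -/

section Torsion

variable {X : Scheme.{u}} {R : CommRingCat.{u}} (f : X ⟶ Spec R)

lemma resHom_const {V W : X.Opens} (h : W ≤ V) (r : R) : resHom h (const f V r) = const f W r := by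
  change resHom h (resHom le_top (f.appTop _)) = resHom le_top (f.appTop _)
  rw [resHom_resHom]

variable [Flat f]

lemma flat_const {V : X.Opens} (hV : IsAffineOpen V) : (const f V).Flat := by
  have h := HasRingHomProperty.appLE @Flat f inferInstance ⟨⊤, isAffineOpen_top (Spec R)⟩ ⟨V, hV⟩
    le_top
  have h' : const f V = (f.appLE ⊤ V le_top).hom.comp (Scheme.ΓSpecIso R).inv.hom := rfl
  rw [h']
  exact RingHom.Flat.comp (RingHom.Flat.of_bijective
    (ConcreteCategory.bijective_of_isIso (Scheme.ΓSpecIso R).inv)) h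

lemma const_mem_nonZeroDivisors {r : R} (hr : r ∈ nonZeroDivisors R) (V : X.Opens) :
    const f V r ∈ nonZeroDivisors Γ(X, V) := by
  rw [mem_nonZeroDivisors_iff_right]
  intro s hs
  refine eq_of_locally_resHom_eq fun x hx => ?_
  obtain ⟨W, hW, hxW, hWV⟩ := exists_isAffineOpen_mem_and_subset hx
  replace hWV : W ≤ V := hWV
  refine ⟨W, hWV, hxW, ?_⟩
  let := (const f W).toAlgebra
  have : Module.Flat R Γ(X, W) := flat_const f hW
  refine Module.Flat.isSMulRegular_of_nonZeroDivisors (M := Γ(X, W)) hr ?_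
  change const f W r * resHom hWV s = const f W r * resHom hWV 0
  rw [← resHom_const f hWV, ← map_mul, mul_comm, hs, map_zero, mul_zero]

include f in
lemma isAddTorsionFree_sections [IsAddTorsionFree R] (V : X.Opens) :
    IsAddTorsionFree Γ(X, V) where
  nsmul_right_injective n hn s t h := by
    have hnV := const_mem_nonZeroDivisors f (natCast_mem_nonZeroDivisors (B := R) hn) V
    rw [map_natCast] at hnV
    refine (mul_cancel_left_mem_nonZeroDivisors hnV).1 ?_
    simpa only [nsmul_eq_mul] using h

end Torsion

/-! ### Derivations in local coordinates -/

section Derivation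

lemma derivation_eq_zero_of_span_D_eq_top {R A M ι : Type*} [CommRing R] [CommRing A] [Algebra R A]
    [AddCommGroup M] [Module A M] [Module R M] [IsScalarTower R A M] {x : ι → A}
    (hx : Submodule.span A (Set.range fun i => KaehlerDifferential.D R A (x i)) = ⊤)
    (d : Derivation R A M) (hd : ∀ i, d (x i) = 0) : d = 0 := by
  have hlift : d.liftKaehlerDifferential = 0 := by
    refine LinearMap.ext_on_range hx fun i => ?_
    rw [d.liftKaehlerDifferential_comp_D, hd, LinearMap.zero_apply]
  ext a
  rw [← d.liftKaehlerDifferential_comp_D, hlift]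
  rfl

lemma derivation_eq_zero_of_isLocalization {R A B M : Type*} [CommRing R] [CommRing A] [CommRing B]
    [Algebra R B] [Algebra A B] [AddCommGroup M] [Module B M] [Module R M] (S : Submonoid A)
    [IsLocalization S B] (d : Derivation R B M) (hd : ∀ a : A, d (algebraMap A B a) = 0) :
    d = 0 := by
  ext t
  obtain ⟨⟨a, b⟩, hab⟩ := IsLocalization.surj S t
  have hdt := congrArg d hab
  rw [d.leibniz, hd, hd, smul_zero, zero_add] at hdt
  exact (IsLocalization.map_units B b).smul_eq_zero.1 hdt

variable {X : Scheme.{u}} {R : CommRingCat.{u}} {f : X ⟶ Spec R}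

variable (f) in
/-- An endomorphism of the sheaf `𝒪_X|_V` is a derivation over the base ring `R`. -/
structure IsSheafDerivation {V : X.Opens} (P : endRing X V) : Prop where
  mul : ∀ {W : X.Opens} (h : W ≤ V) (a b : Γ(X, W)),
    evalOp P h (a * b) = a * evalOp P h b + b * evalOp P h a
  const : ∀ {W : X.Opens} (h : W ≤ V) (r : R), evalOp P h (const f W r) = 0

lemma Coordinates.isSheafDerivation_pd {U : X.Opens} (c : Coordinates f U) (i : Fin c.n) :
    IsSheafDerivation f (c.pd i) :=
  ⟨c.pd_mul i, c.pd_const i⟩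

namespace IsSheafDerivation

variable {V W : X.Opens} {P Q : endRing X V}

lemma res (hP : IsSheafDerivation f P) (h : W ≤ V) : IsSheafDerivation f (endRing.res h P) :=
  ⟨fun h' => hP.mul (h'.trans h), fun h' => hP.const (h'.trans h)⟩

lemma commutator (hP : IsSheafDerivation f P) (hQ : IsSheafDerivation f Q) :
    IsSheafDerivation f (P * Q - Q * P) where
  mul h a b := by
    simp only [evalOp_sub, evalOp_mul, hP.mul, hQ.mul, map_add]
    ring
  const h r := by
    simp only [evalOp_sub, evalOp_mul, hP.const, hQ.const, map_zero, sub_zero]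

lemma sub (hP : IsSheafDerivation f P) (hQ : IsSheafDerivation f Q) :
    IsSheafDerivation f (P - Q) where
  mul h a b := by
    simp only [evalOp_sub, hP.mul, hQ.mul]
    ring
  const h r := by simp only [evalOp_sub, hP.const, hQ.const, sub_zero]

lemma sum_smul {κ : Type*} (s : Finset κ) (a : κ → Γ(X, V)) {P : κ → endRing X V}
    (hP : ∀ i, IsSheafDerivation f (P i)) : IsSheafDerivation f (∑ i ∈ s, a i • P i) where
  mul h b c := by
    simp only [evalOp_sum, evalOp_smul, (hP _).mul, Finset.mul_sum, ← Finset.sum_add_distrib]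
    exact Finset.sum_congr rfl fun i _ => by ring
  const h r := by
    simp only [evalOp_sum, evalOp_smul, (hP _).const, mul_zero, Finset.sum_const_zero]

lemma map_one (hP : IsSheafDerivation f P) (h : W ≤ V) : evalOp P h 1 = 0 := by
  have := hP.const h 1
  rwa [RingHom.map_one] at this

/-- The derivation of `Γ(X, W)` over `R` induced by a derivation of `𝒪_X|_V`. -/
noncomputable def toDerivation (hP : IsSheafDerivation f P) (h : W ≤ V) :
    letI := (ArithDiff.const f W).toAlgebra
    Derivation R Γ(X, W) Γ(X, W) :=
  letI := (ArithDiff.const f W).toAlgebra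
  .mk' { toFun := evalOp P h
         map_add' := map_add _
         map_smul' := fun r a => by
           rw [Algebra.smul_def, RingHom.algebraMap_toAlgebra, hP.mul, hP.const, mul_zero,
             add_zero]
           rfl } (hP.mul h)

lemma evalOp_basicOpen_eq_zero (hP : IsSheafDerivation f P) {U : X.Opens} (c : Coordinates f U)
    (g : Γ(X, U)) (hg : X.basicOpen g ≤ V)
    (hx : ∀ i, evalOp P hg (resHom (X.basicOpen_le g) (c.x i)) = 0) (t : Γ(X, X.basicOpen g)) :
    evalOp P hg t = 0 := by
  let := (ArithDiff.const f U).toAlgebra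
  let : Algebra Γ(X, U) Γ(X, X.basicOpen g) := (resHom (X.basicOpen_le g)).toAlgebra
  let := (ArithDiff.const f (X.basicOpen g)).toAlgebra
  have : IsScalarTower R Γ(X, U) Γ(X, X.basicOpen g) :=
    IsScalarTower.of_algebraMap_eq fun r => (resHom_const f (X.basicOpen_le g) r).symm
  have : IsLocalization.Away g Γ(X, X.basicOpen g) := c.affine.isLocalization_basicOpen g
  have hU : (hP.toDerivation hg).compAlgebraMap Γ(X, U) = 0 :=
    derivation_eq_zero_of_span_D_eq_top c.span_dx _ hx
  exact congrArg (· t) (derivation_eq_zero_of_isLocalization (Submonoid.powers g)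
    (hP.toDerivation hg) fun a => congrArg (· a) hU)

lemma eq_zero (hP : IsSheafDerivation f P) {U : X.Opens} (c : Coordinates f U) (h : V ≤ U)
    (hx : ∀ i, evalOp P le_rfl (resHom h (c.x i)) = 0) : P = 0 := by
  refine endRing_ext fun W hW s => eq_of_locally_resHom_eq fun y hy => ?_
  obtain ⟨g, hgW, hyg⟩ := c.affine.exists_basicOpen_le ⟨y, hy⟩ (h (hW hy))
  refine ⟨X.basicOpen g, hgW, hyg, ?_⟩
  rw [← evalOp_resHom, ← evalOp_resHom]
  refine hP.evalOp_basicOpen_eq_zero c g (hgW.trans hW) (fun i => ?_) _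
  rw [← resHom_resHom h (hgW.trans hW)]
  exact (evalOp_resHom P le_rfl (hgW.trans hW) _).trans (by rw [hx, map_zero])

end IsSheafDerivation

end Derivation

/-! ### The operators attached to local coordinates -/

lemma DerivationSystem.op_eq_smul_prod_ofFn {A E : Type*} [CommRing A] [Ring E] [Module A E]
    [Module E A] [IsScalarTower A E E] [IsAddTorsionFree E] {n : ℕ} (S : DerivationSystem A E n)
    (ϖ : A) (p m k : ℕ) (ν : Fin n → ℕ) :
    S.op ϖ p m k ν = ϖ ^ (k * ∑ i, ν i) •
      (List.ofFn fun i => ((ν i / p ^ m).factorial : E) * S.dp i (ν i)).prod := by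
  have hprod : (List.ofFn fun i => ((ν i / p ^ m).factorial : E) * S.dp i (ν i)).prod =
      ((∏ i, ((ν i / p ^ m).factorial : S.constOp) * S.dpc i (ν i) : S.constOp) : E) := by
    rw [← List.prod_ofFn, ← Subring.coe_subtype, map_list_prod, List.map_ofFn]
    congr 2
  rw [hprod, op, levelCoeff, mul_smul, Finset.prod_mul_distrib, ← Nat.cast_prod, ← dpow,
    Nat.cast_smul_eq_nsmul, ← nsmul_eq_mul]
  rfl

namespace Coordinates

variable {X : Scheme.{u}} {R : CommRingCat.{u}} {f : X ⟶ Spec R} {U : X.Opens}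
  (c : Coordinates f U)

lemma pd_commute (i j : Fin c.n) : Commute (c.pd i) (c.pd j) := by
  rw [commute_iff_eq, ← sub_eq_zero]
  refine ((c.isSheafDerivation_pd i).commutator (c.isSheafDerivation_pd j)).eq_zero c le_rfl
    fun l => ?_
  have h : ∀ i j, evalOp (c.pd i) le_rfl (if j = l then 1 else 0) = 0 := by
    intro i j
    split_ifs
    · exact (c.isSheafDerivation_pd i).map_one _
    · exact map_zero _
  rw [resHom_self, evalOp_sub, evalOp_mul, evalOp_mul, c.pd_x, c.pd_x, h, h, sub_zero]

variable {W : X.Opens} (h : W ≤ U)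

lemma evalOp_pd_resHom_x (i j : Fin c.n) :
    evalOp (c.pd i) h (resHom h (c.x j)) = if i = j then 1 else 0 := by
  refine (evalOp_resHom (c.pd i) le_rfl h (c.x j)).trans ?_
  rw [c.pd_x, apply_ite (resHom h), map_one, map_zero]

/-- The derivations attached to coordinates on `U`, restricted to an open `W` contained in `U`. -/
noncomputable def derivationSystem : DerivationSystem Γ(X, W) (endRing X W) c.n where
  x i := resHom h (c.x i)
  δ i := endRing.res h (c.pd i)
  dp i ν := endRing.res h (c.dpd i ν)
  δ_comm i j := (c.pd_commute i j).map (endRing.res h)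
  δ_mul_smul i a P := endRing_ext fun W' h' s => by
    rw [evalOp_add, evalOp_mul, evalOp_smul, evalOp_smul, evalOp_smul, evalOp_res, c.pd_mul,
      evalOp_mul, evalOp_res, smul_eq_evalOp, evalOp_res, ← evalOp_resHom,
      mul_comm (evalOp P h' s)]
  δ_smul_x i j := c.evalOp_pd_resHom_x h i j
  factorial_smul_dp i ν := by
    rw [nsmul_eq_mul, ← map_natCast (endRing.res h), ← map_mul, c.factorial_mul_dpd, map_pow]

lemma derivationSystem_δ_smul_const (i : Fin c.n) (r : R) :
    (c.derivationSystem h).δ i • const f W r = 0 :=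
  c.pd_const i h r

section Level

variable [∀ W : X.Opens, IsAddTorsionFree Γ(X, W)] (ϖ : R) (p m k : ℕ)

lemma derivationSystem_op (ν : Fin c.n → ℕ) :
    (c.derivationSystem h).op (const f W ϖ) p m k ν = endRing.res h (c.op ϖ p m k ν) := by
  rw [DerivationSystem.op_eq_smul_prod_ofFn, Coordinates.op, ← smul_eq_mulOp_mul, res_smul,
    map_pow (resHom h), resHom_const, map_list_prod, List.map_ofFn]
  congr 4

lemma derivationSystem_op_smul (ν : Fin c.n → ℕ) (s : Γ(X, W)) :
    (c.derivationSystem h).op (const f W ϖ) p m k ν • s = evalOp (c.op ϖ p m k ν) h s := by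
  rw [derivationSystem_op]
  rfl

lemma op_zero : c.op ϖ p m k 0 = 1 :=
  (c.derivationSystem_op le_rfl ϖ p m k 0).symm.trans (DerivationSystem.op_zero _ _ _ _ _)

lemma evalOp_op_mul (ν : Fin c.n → ℕ) (s t : Γ(X, W)) :
    evalOp (c.op ϖ p m k ν) h (s * t) = ∑ μ ∈ Finset.Iic ν, (leibnizCoeff p m ν μ : Γ(X, W)) *
      (evalOp (c.op ϖ p m k μ) h s * evalOp (c.op ϖ p m k (ν - μ)) h t) := by
  simp only [← derivationSystem_op_smul, DerivationSystem.op_smul_mul]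

lemma op_mul_smul (ν : Fin c.n → ℕ) (a : Γ(X, W)) (P : endRing X W) :
    endRing.res h (c.op ϖ p m k ν) * a • P =
      ∑ μ ∈ Finset.Iic ν, (leibnizCoeff p m ν μ * evalOp (c.op ϖ p m k μ) h a) •
        (endRing.res h (c.op ϖ p m k (ν - μ)) * P) := by
  simp only [← derivationSystem_op_smul, ← derivationSystem_op, DerivationSystem.op_mul_smul]

lemma linearIndependent_evalOp_op {B : Type*} [CommRing B] [IsAddTorsionFree B] (φ : Γ(X, W) →+* B)
    (hϖ : φ (const f W ϖ) ∈ nonZeroDivisors B) :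
    LinearIndependent B fun ν (a : Γ(X, W)) => φ (evalOp (c.op ϖ p m k ν) h a) := by
  have hind := (c.derivationSystem h).linearIndependent_op_smul_monomial _ p m k φ hϖ
  simp only [derivationSystem_op_smul] at hind
  exact hind.of_comp (LinearMap.funLeft B B (c.derivationSystem h).monomial)

variable {p} in
lemma op_mem_opSubring [Fact p.Prime] (hA : ∀ l : ℕ, ¬ p ∣ l → IsUnit (l : Γ(X, W)))
    {U' : X.Opens} (c' : Coordinates f U') (h' : W ≤ U') (ν : Fin c'.n → ℕ) :
    endRing.res h' (c'.op ϖ p m k ν) ∈ (c.derivationSystem h).opSubring m k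
      (c.derivationSystem_δ_smul_const h · ϖ) hA := by
  rw [← derivationSystem_op]
  refine (c.derivationSystem h).op_mem_opSubring_of_δ_eq_sum m k hA _ (c'.derivationSystem h')
    (c'.derivationSystem_δ_smul_const h' · ϖ) (fun j i => evalOp (c'.pd j) h' (resHom h (c.x i)))
    (fun j => ?_) ν
  change endRing.res h' (c'.pd j) = ∑ i, _ • endRing.res h (c.pd i)
  rw [← sub_eq_zero]
  refine (((c'.isSheafDerivation_pd j).res h').sub (.sum_smul _ _ fun i =>
    (c.isSheafDerivation_pd i).res h)).eq_zero c h fun i => ?_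
  simp only [evalOp_sub, evalOp_sum, evalOp_smul, evalOp_res, resHom_self, evalOp_pd_resHom_x,
    mul_ite, mul_one, mul_zero, Finset.sum_ite_eq', Finset.mem_univ, if_true, sub_self]

variable {p} in
lemma mem_span_op_of_mem_closure_generators [Fact p.Prime]
    (hR : ∀ l : ℕ, ¬ p ∣ l → IsUnit (l : R)) {P : endRing X W}
    (hP : P ∈ Subring.closure (generators f ϖ p m k W)) :
    P ∈ Submodule.span Γ(X, W) (Set.range fun ν => endRing.res h (c.op ϖ p m k ν)) := by
  have hA : ∀ l : ℕ, ¬ p ∣ l → IsUnit (l : Γ(X, W)) := fun l hl => by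
    simpa only [map_natCast] using (hR l hl).map (const f W)
  have hclosure : Subring.closure (generators f ϖ p m k W) ≤
      (c.derivationSystem h).opSubring m k (c.derivationSystem_δ_smul_const h · ϖ) hA := by
    rw [Subring.closure_le]
    rintro Q (⟨a, rfl⟩ | ⟨U', h', c', ν, rfl⟩)
    · rw [← mul_one (mulOp W a)]
      exact (c.derivationSystem h).smul_one_mem_opSubring m k _ hA a
    · exact c.op_mem_opSubring h ϖ m k hA c' h' ν
  have hspan := (c.derivationSystem h).mem_opSubring m k _ hA |>.1 (hclosure hP)
  simp only [funext (c.derivationSystem_op h ϖ p m k)] at hspan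
  exact hspan

lemma evalOp_op_mem {J : Ideal Γ(X, W)} (hJ : const f W (ϖ ^ k) ∈ J) (ν : Fin c.n → ℕ)
    {a : Γ(X, W)} (ha : a ∈ J) : evalOp (c.op ϖ p m k ν) h a ∈ J := by
  rcases eq_or_ne ν 0 with rfl | hν
  · rw [op_zero]
    exact ha
  · have hsum : ∑ i, ν i ≠ 0 := fun h0 =>
      hν (funext fun i => Finset.sum_eq_zero_iff.1 h0 i (Finset.mem_univ i))
    rw [Coordinates.op, evalOp_mul, evalOp_mulOp, map_pow, resHom_const, pow_mul, ← map_pow]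
    exact J.mul_mem_right _ (J.pow_mem_of_mem hJ _ hsum.pos)

lemma evalOp_op_mem_pow {J : Ideal Γ(X, W)} (hJ : const f W (ϖ ^ k) ∈ J) (r : ℕ)
    (ν : Fin c.n → ℕ) {a : Γ(X, W)} (ha : a ∈ J ^ r) : evalOp (c.op ϖ p m k ν) h a ∈ J ^ r := by
  induction r generalizing ν a with
  | zero => simp
  | succ r ih =>
    rw [pow_succ'] at ha ⊢
    refine Submodule.mul_induction_on ha (fun b hb d hd => ?_) fun b d hb hd => ?_
    · rw [evalOp_op_mul]
      exact sum_mem fun μ _ => Ideal.mul_mem_left _ _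
        (Ideal.mul_mem_mul (c.evalOp_op_mem h ϖ p m k hJ _ hb) (ih _ hd))
    · rw [map_add]
      exact add_mem hb hd

end Level

end Coordinates

/-! ### Charts of the blow-up -/

section Rees

variable {A : Type u} [CommRing A] (I : Ideal A)

/-- The element `a Tⁿ` of the Rees algebra. -/
noncomputable def reesMonomial {n : ℕ} {a : A} (ha : a ∈ I ^ n) : reesAlgebra I :=
  ⟨Polynomial.monomial n a, reesAlgebra.monomial_mem.2 ha⟩

lemma reesMonomial_mem {n : ℕ} {a : A} (ha : a ∈ I ^ n) : reesMonomial I ha ∈ reesGrading I n :=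
  fun i hi => by simp [reesMonomial, Polynomial.coeff_monomial, hi.symm]

lemma exists_eq_reesMonomial {n : ℕ} {z : reesAlgebra I} (hz : z ∈ reesGrading I n) :
    ∃ (a : A) (ha : a ∈ I ^ n), z = reesMonomial I ha := by
  refine ⟨(z : A[X]).coeff n, z.2 n, Subtype.ext (Polynomial.ext fun i => ?_)⟩
  by_cases hi : i = n
  · subst hi; simp [reesMonomial]
  · rw [hz i hi]; simp [reesMonomial, Polynomial.coeff_monomial, Ne.symm hi]

lemma reesMonomial_mul {n m : ℕ} {a b : A} (ha : a ∈ I ^ n) (hb : b ∈ I ^ m) :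
    reesMonomial I ha * reesMonomial I hb =
      reesMonomial I (n := n + m) (a := a * b) (by rw [pow_add]; exact Ideal.mul_mem_mul ha hb) :=
  Subtype.ext (Polynomial.monomial_mul_monomial _ _ _ _)

lemma reesMonomial_pow {n : ℕ} {a : A} (ha : a ∈ I ^ n) (r : ℕ) :
    reesMonomial I ha ^ r =
      reesMonomial I (n := n * r) (a := a ^ r) (by rw [pow_mul]; exact Ideal.pow_mem_pow ha r) :=
  Subtype.ext (Polynomial.monomial_pow _ _ _)

lemma algebraMap_mul_reesMonomial (c : A) {n : ℕ} {a : A} (ha : a ∈ I ^ n) :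
    algebraMap A (reesAlgebra I) c * reesMonomial I ha =
      reesMonomial I (n := n) (a := c * a) (Ideal.mul_mem_left _ _ ha) :=
  Subtype.ext (Polynomial.C_mul_monomial)

lemma reesMonomial_congr {n m : ℕ} {a b : A} (ha : a ∈ I ^ n) (hb : b ∈ I ^ m) (h : n = m)
    (h' : a = b) : reesMonomial I ha = reesMonomial I hb := by
  subst h h'; rfl

/-- The map from `A` to the degree `0` part of the localization of the Rees algebra at `z`. -/
noncomputable def awayHom (z : reesAlgebra I) :
    A →+* HomogeneousLocalization.Away (reesGrading I) z :=
  (HomogeneousLocalization.fromZeroRingHom (reesGrading I) _).comp (algebraMap A (reesGrading I 0))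

lemma val_awayHom (z : reesAlgebra I) (c : A) :
    (awayHom I z c).val = algebraMap (reesAlgebra I) (Localization.Away z)
      (algebraMap A (reesAlgebra I) c) := by
  rw [← Localization.mk_one_eq_algebraMap]
  rfl

variable {I} {n : ℕ} {a : A} (ha : a ∈ I ^ n)

/-- The element `b Tⁿʳ / (a Tⁿ)ʳ`. -/
noncomputable def awayFrac (r : ℕ) {b : A} (hb : b ∈ I ^ (n * r)) :
    HomogeneousLocalization.Away (reesGrading I) (reesMonomial I ha) :=
  HomogeneousLocalization.Away.mk _ (reesMonomial_mem I ha) r (reesMonomial I hb) (by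
    rw [smul_eq_mul, mul_comm]
    exact reesMonomial_mem I hb)

lemma exists_eq_awayFrac (z : HomogeneousLocalization.Away (reesGrading I) (reesMonomial I ha)) :
    ∃ (r : ℕ) (b : A) (hb : b ∈ I ^ (n * r)), z = awayFrac ha r hb := by
  obtain ⟨r, y, hy, rfl⟩ :=
    HomogeneousLocalization.Away.mk_surjective _ (reesMonomial_mem I ha) z
  have hy' : y ∈ reesGrading I (n * r) := by
    rwa [smul_eq_mul, mul_comm] at hy
  obtain ⟨b, hb, rfl⟩ := exists_eq_reesMonomial I hy'
  exact ⟨r, b, hb, rfl⟩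

lemma awayHom_pow_mul_awayFrac (r : ℕ) {b : A} (hb : b ∈ I ^ (n * r)) :
    awayHom I (reesMonomial I ha) (a ^ r) * awayFrac ha r hb = awayHom I (reesMonomial I ha) b := by
  ext
  rw [HomogeneousLocalization.val_mul, val_awayHom, val_awayHom, awayFrac,
    HomogeneousLocalization.Away.val_mk, ← Localization.mk_one_eq_algebraMap,
    ← Localization.mk_one_eq_algebraMap, Localization.mk_mul, Localization.mk_eq_mk_iff,
    Localization.r_iff_exists]
  refine ⟨1, ?_⟩
  simp only [Submonoid.coe_one, one_mul]
  rw [algebraMap_mul_reesMonomial, reesMonomial_pow, mul_comm _ (algebraMap _ _ b),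
    algebraMap_mul_reesMonomial]
  exact reesMonomial_congr I _ _ rfl (mul_comm _ _)

lemma eq_zero_of_awayHom_mul_eq_zero {c : A} (hc : c ∈ nonZeroDivisors A)
    {z : HomogeneousLocalization.Away (reesGrading I) (reesMonomial I ha)}
    (h : awayHom I (reesMonomial I ha) c * z = 0) : z = 0 := by
  obtain ⟨r, b, hb, rfl⟩ := exists_eq_awayFrac ha z
  have h' := congrArg HomogeneousLocalization.val h
  rw [HomogeneousLocalization.val_mul, val_awayHom, HomogeneousLocalization.val_zero, awayFrac,
    HomogeneousLocalization.Away.val_mk, Localization.mk_eq_mk', ← IsLocalization.mk'_one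
      (M := Submonoid.powers (reesMonomial I ha)), ← IsLocalization.mk'_mul,
    IsLocalization.mk'_eq_zero_iff] at h'
  obtain ⟨⟨_, q, rfl⟩, hq⟩ := h'
  ext
  rw [awayFrac, HomogeneousLocalization.Away.val_mk, HomogeneousLocalization.val_zero,
    Localization.mk_eq_mk', IsLocalization.mk'_eq_zero_iff]
  refine ⟨⟨_, q, rfl⟩, ?_⟩
  dsimp only at hq ⊢
  rw [algebraMap_mul_reesMonomial, reesMonomial_pow, reesMonomial_mul] at hq
  rw [reesMonomial_pow, reesMonomial_mul]
  have hcoeff := congrArg (fun z : reesAlgebra I => (z : A[X]).coeff (n * q + n * r)) hq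
  simp only [reesMonomial, Polynomial.coeff_monomial, if_true] at hcoeff
  have hab : a ^ q * b = 0 :=
    mem_nonZeroDivisors_iff_left.1 hc _ (by rw [mul_left_comm, hcoeff]; simp)
  exact Subtype.ext (by simp [reesMonomial, hab])

end Rees

section Chart

variable {X Y : Scheme.{u}} {pr : X ⟶ Y}

lemma fromSpec_appLE_top {V : Y.Opens} (hV : IsAffineOpen V) (e : ⊤ ≤ hV.fromSpec ⁻¹ᵁ V) :
    hV.fromSpec.appLE V ⊤ e = (Scheme.ΓSpecIso Γ(Y, V)).inv := by
  rw [Scheme.Hom.appLE, hV.fromSpec_app_self, Category.assoc, ← Functor.map_comp]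
  exact (congrArg _ ((Spec Γ(Y, V)).presheaf.map_id _)).trans (Category.comp_id _)

lemma exists_ringHom_chart {B : CommRingCat.{u}} (j : Spec B ⟶ X) [IsOpenImmersion j]
    {V : Y.Opens} (hV : IsAffineOpen V) (φ : Γ(Y, V) ⟶ B)
    (h : j ≫ pr = Spec.map φ ≫ hV.fromSpec) :
    ∃ (hle : j ''ᵁ ⊤ ≤ pr ⁻¹ᵁ V) (ψ : B →+* Γ(X, j ''ᵁ ⊤)), Function.Bijective ψ ∧
      ∀ c, ψ (φ c) = resHom hle (pr.app V c) := by
  have hle : j ''ᵁ ⊤ ≤ pr ⁻¹ᵁ V := by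
    rintro _ ⟨y, -, rfl⟩
    change pr (j y) ∈ V
    rw [← Scheme.Hom.comp_apply, h, Scheme.Hom.comp_apply]
    have : hV.fromSpec (Spec.map φ y) ∈ hV.fromSpec.opensRange := ⟨_, rfl⟩
    rwa [hV.opensRange_fromSpec] at this
  have htop : ⊤ ≤ hV.fromSpec ⁻¹ᵁ V := by rw [hV.fromSpec_preimage_self]
  refine ⟨hle, ((Scheme.ΓSpecIso B).inv ≫ (j.appIso ⊤).inv).hom,
    ConcreteCategory.bijective_of_isIso ((Scheme.ΓSpecIso B).inv ≫ (j.appIso ⊤).inv), fun c => ?_⟩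
  have happ : φ ≫ (Scheme.ΓSpecIso B).inv = pr.appLE V (j ''ᵁ ⊤) hle ≫
      j.appLE (j ''ᵁ ⊤) ⊤ (j.preimage_image_eq ⊤).ge := by
    rw [Scheme.Hom.appLE_comp_appLE]
    simp only [h]
    rw [← Scheme.Hom.appLE_comp_appLE _ _ V ⊤ ⊤ htop (by simp), fromSpec_appLE_top,
      Scheme.ΓSpecIso_inv_naturality]
    refine congrArg (_ ≫ ·) ?_
    exact ((congrArg _ ((Spec B).presheaf.map_id _)).trans (Category.comp_id _)).symm
  change (φ ≫ (Scheme.ΓSpecIso B).inv ≫ (j.appIso ⊤).inv) c = _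
  rw [← Category.assoc, happ, ← Scheme.Hom.appIso_hom', Category.assoc, Iso.hom_inv_id,
    Category.comp_id]
  rfl

lemma exists_pos_homogeneous_mem_basicOpen {σ A : Type u} [CommRing A] [SetLike σ A]
    [AddSubgroupClass σ A] (𝒜 : ℕ → σ) [GradedRing 𝒜] (x : Proj 𝒜) :
    ∃ n, 0 < n ∧ ∃ z ∈ 𝒜 n, x ∈ Proj.basicOpen 𝒜 z := by
  have hcover := Proj.iSup_basicOpen_eq_top 𝒜 (fun w : {w // ∃ n, 0 < n ∧ w ∈ 𝒜 n} => w.1) (by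
    classical
    intro z hz
    rw [← DirectSum.sum_support_decompose 𝒜 z]
    refine Ideal.sum_mem _ fun i _ => ?_
    rcases Nat.eq_zero_or_pos i with rfl | hi
    · rw [← GradedRing.proj_apply, (HomogeneousIdeal.mem_irrelevant_iff _ _).1 hz]
      exact zero_mem _
    · exact Ideal.subset_span ⟨⟨_, i, hi, SetLike.coe_mem _⟩, rfl⟩)
  obtain ⟨⟨z, n, hn, hz⟩, hxz⟩ := Opens.mem_iSup.1 (hcover.ge (Set.mem_univ x))
  exact ⟨n, hn, z, hz, hxz⟩

lemma exists_pos_homogeneous_basicOpen_le {σ A : Type u} [CommRing A] [SetLike σ A]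
    [AddSubgroupClass σ A] (𝒜 : ℕ → σ) [GradedRing 𝒜] {U : (Proj 𝒜).Opens}
    {x : Proj 𝒜} (hx : x ∈ U) :
    ∃ n, 0 < n ∧ ∃ z ∈ 𝒜 n, x ∈ Proj.basicOpen 𝒜 z ∧ Proj.basicOpen 𝒜 z ≤ U := by
  obtain ⟨_, ⟨z, rfl⟩, hxz, hzU⟩ :=
    (Opens.isBasis_iff_nbhd.1 (Proj.isBasis_basicOpen 𝒜)) hx
  rw [Proj.basicOpen_eq_iSup_proj, Opens.mem_iSup] at hxz
  obtain ⟨i, hi⟩ := hxz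
  have hle : Proj.basicOpen 𝒜 (GradedRing.proj 𝒜 i z) ≤ U := by
    refine le_trans ?_ hzU
    rw [Proj.basicOpen_eq_iSup_proj 𝒜 z]
    exact le_iSup (fun i => Proj.basicOpen 𝒜 (GradedRing.proj 𝒜 i z)) i
  obtain ⟨l, hl, w, hwl, hw⟩ := exists_pos_homogeneous_mem_basicOpen 𝒜 x
  refine ⟨i + l, Nat.add_pos_right _ hl, GradedRing.proj 𝒜 i z * w,
    SetLike.mul_mem_graded (SetLike.coe_mem _) hwl, ?_, ?_⟩
  · rw [Proj.basicOpen_mul]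
    exact ⟨hi, hw⟩
  · rw [Proj.basicOpen_mul]
    exact inf_le_left.trans hle

lemma exists_ringHom_chart_of_iso {B : Type u} [CommRing B] {P : Scheme.{u}}
    (j : Spec (.of B) ⟶ P) [IsOpenImmersion j] {V : Y.Opens} (hV : IsAffineOpen V)
    (e : (pr ⁻¹ᵁ V).toScheme ≅ P) (φ : Γ(Y, V) →+* B)
    (h : j ≫ e.inv ≫ (pr ⁻¹ᵁ V).ι ≫ pr = Spec.map (CommRingCat.ofHom φ) ≫ hV.fromSpec)
    {U : X.Opens} {x : (pr ⁻¹ᵁ V).toScheme} (hx : e.hom x ∈ j.opensRange)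
    (hU : j.opensRange ≤ e.inv ⁻¹ᵁ ((pr ⁻¹ᵁ V).ι ⁻¹ᵁ U)) :
    ∃ (D : X.Opens) (hD : D ≤ pr ⁻¹ᵁ V) (ψ : B →+* Γ(X, D)), x.1 ∈ D ∧ D ≤ U ∧
      Function.Bijective ψ ∧ ∀ c, ψ (φ c) = ((resHom hD).comp (pr.app V).hom) c := by
  obtain ⟨hle, ψ, hψ, hψc⟩ := exists_ringHom_chart (pr := pr) (j ≫ e.inv ≫ (pr ⁻¹ᵁ V).ι) hV
    (CommRingCat.ofHom φ) (by simpa only [Category.assoc] using h)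
  refine ⟨_, hle, ψ, ?_, ?_, hψ, hψc⟩
  · obtain ⟨w, hw⟩ := hx
    refine ⟨w, trivial, ?_⟩
    change ((pr ⁻¹ᵁ V).ι (e.inv (j w)) : X) = x.1
    rw [hw, Scheme.hom_inv_apply]
    rfl
  · rintro _ ⟨w, -, rfl⟩
    exact hU ⟨w, rfl⟩

lemma specMap_awayHom {A : Type u} [CommRing A] (J : Ideal A) (z : reesAlgebra J) :
    Spec.map (CommRingCat.ofHom (HomogeneousLocalization.fromZeroRingHom (reesGrading J)
      (Submonoid.powers z))) ≫ Spec.map (CommRingCat.ofHom (S := reesGrading J 0)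
        (algebraMap A (reesGrading J 0))) = Spec.map (CommRingCat.ofHom (awayHom J z)) := by
  rw [← Spec.map_comp]
  rfl

/-- `g : A → C` makes `C` the ring of fractions `b / aʳ` with `b ∈ Jⁿʳ`, that is, the ring of
functions on the chart of the blow-up of `J` given by `a ∈ Jⁿ`. -/
structure IsFractionChart {A C : Type*} [CommRing A] [CommRing C] (J : Ideal A) (n : ℕ) (a : A)
    (g : A →+* C) : Prop where
  mem : a ∈ J ^ n
  exists_eq : ∀ s : C, ∃ (r : ℕ), ∃ b ∈ J ^ (n * r), g (a ^ r) * s = g b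
  dvd : ∀ r, ∀ b ∈ J ^ (n * r), ∃ t, g b = g (a ^ r) * t
  map_mem_nonZeroDivisors : ∀ c ∈ nonZeroDivisors A, g c ∈ nonZeroDivisors C

lemma IsFractionChart.map_map_pow_mem_nonZeroDivisors {A C C' : Type*} [CommRing A] [CommRing C]
    [CommRing C'] {J : Ideal A} {n : ℕ} {a : A} {g : A →+* C} (hF : IsFractionChart J n a g)
    (φ : C →+* C') {r : ℕ} {b : A} (hb : b ∈ J ^ (n * r)) (hφ : φ (g b) ∈ nonZeroDivisors C') :
    φ (g (a ^ r)) ∈ nonZeroDivisors C' := by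
  obtain ⟨t, ht⟩ := hF.dvd r b hb
  rw [ht, map_mul] at hφ
  exact (mul_mem_nonZeroDivisors.1 hφ).1

lemma isFractionChart_awayHom {A : Type u} {C : Type*} [CommRing A] [CommRing C] {J : Ideal A}
    {n : ℕ} {a : A} (ha : a ∈ J ^ n)
    (ψ : HomogeneousLocalization.Away (reesGrading J) (reesMonomial J ha) →+* C)
    (hψ : Function.Bijective ψ) (g : A →+* C)
    (hg : ∀ c, ψ (awayHom J (reesMonomial J ha) c) = g c) :
    IsFractionChart J n a g where
  mem := ha
  exists_eq s := by
    obtain ⟨s, rfl⟩ := hψ.2 s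
    obtain ⟨r, b, hb, rfl⟩ := exists_eq_awayFrac ha s
    exact ⟨r, b, hb, by rw [← hg, ← hg, ← map_mul, awayHom_pow_mul_awayFrac]⟩
  dvd r b hb := ⟨ψ (awayFrac ha r hb), by rw [← hg, ← hg, ← map_mul, awayHom_pow_mul_awayFrac]⟩
  map_mem_nonZeroDivisors c hc := by
    rw [mem_nonZeroDivisors_iff_left]
    intro t ht
    obtain ⟨t, rfl⟩ := hψ.2 t
    rw [← hg, ← map_mul] at ht
    rw [eq_zero_of_awayHom_mul_eq_zero ha hc (hψ.1 (ht.trans (map_zero ψ).symm)), map_zero]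

lemma IsBlowup.exists_chart {I : Y.IdealSheafData} (hpr : IsBlowup pr I) (V : Y.affineOpens)
    {U : X.Opens} {x : X} (hxU : x ∈ U) (hxV : x ∈ pr ⁻¹ᵁ V.1) :
    ∃ (D : X.Opens) (hD : D ≤ pr ⁻¹ᵁ V.1) (n : ℕ) (a : Γ(Y, V.1)), x ∈ D ∧ D ≤ U ∧
      IsFractionChart (I.ideal V) n a ((resHom hD).comp (pr.app V.1).hom) := by
  obtain ⟨e, he⟩ := hpr V
  obtain ⟨n, hn, z, hz, hxz, hzU⟩ := exists_pos_homogeneous_basicOpen_le (reesGrading (I.ideal V))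
    (U := e.inv ⁻¹ᵁ ((pr ⁻¹ᵁ V.1).ι ⁻¹ᵁ U)) (x := e.hom ⟨x, hxV⟩) (by
      have hx : (pr ⁻¹ᵁ V.1).ι (e.inv (e.hom ⟨x, hxV⟩)) = x :=
        congrArg (pr ⁻¹ᵁ V.1).ι (Scheme.hom_inv_apply e ⟨x, hxV⟩)
      exact (congrArg (· ∈ U) hx).mpr hxU)
  obtain ⟨a, ha, rfl⟩ := exists_eq_reesMonomial _ hz
  rw [← Proj.opensRange_awayι (reesGrading (I.ideal V)) _ hz hn] at hxz hzU
  have hinv : e.inv ≫ (pr ⁻¹ᵁ V.1).ι ≫ pr = reesProjToSpec (I.ideal V) ≫ V.2.fromSpec := by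
    rw [Iso.inv_comp_eq]
    exact he.symm
  obtain ⟨D, hD, ψ, hxD, hDU, hψ, hψc⟩ := exists_ringHom_chart_of_iso
    (Proj.awayι (reesGrading (I.ideal V)) _ hz hn) V.2 e
    (awayHom (I.ideal V) (reesMonomial (I.ideal V) ha)) (by
      rw [hinv, reesProjToSpec, Category.assoc, Proj.awayι_toSpecZero_assoc, ← specMap_awayHom,
        Category.assoc]) hxz hzU
  exact ⟨D, hD, n, a, hxD, hDU, isFractionChart_awayHom ha ψ hψ _ hψc⟩

/-! ### The blow-up is an isomorphism where the ideal is trivial -/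

lemma coeff_zero_proj_zero {A : Type u} [CommRing A] (I : Ideal A) (z : reesAlgebra I) :
    ((GradedRing.proj (reesGrading I) 0 z : reesAlgebra I) : A[X]).coeff 0 =
      (z : A[X]).coeff 0 := by
  have h : (reesDecompose I z) 0 = reesComponent I 0 z := by
    rw [reesDecompose, DFinsupp.finsetSum_apply]
    by_cases hs : 0 ∈ (z : A[X]).support
    · rw [Finset.sum_eq_single_of_mem 0 hs fun j _ hj =>
        DirectSum.of_eq_of_ne _ _ _ (Ne.symm hj)]
      exact DirectSum.of_eq_same _ _
    · rw [Finset.sum_eq_zero fun j hj =>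
        DirectSum.of_eq_of_ne j 0 _ (by rintro rfl; exact hs hj)]
      ext
      simp [reesComponent, Polynomial.notMem_support_iff.1 hs]
  rw [GradedRing.proj_apply]
  change ((reesDecompose I z 0 : reesAlgebra I) : A[X]).coeff 0 = _
  rw [h]
  simp [reesComponent]

lemma reesMonomial_one_dvd {A : Type u} [CommRing A] (hone : (1 : A) ∈ (⊤ : Ideal A) ^ 1)
    {z : reesAlgebra (⊤ : Ideal A)} (hz : (z : A[X]).coeff 0 = 0) : reesMonomial _ hone ∣ z := by
  obtain ⟨y, hy⟩ := Polynomial.X_dvd_iff.2 hz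
  refine ⟨⟨y, fun i => by rw [Ideal.top_pow]; trivial⟩, Subtype.ext ?_⟩
  rw [hy]
  simp [reesMonomial, Polynomial.monomial_one_one_eq_X]

lemma awayHom_injective {A : Type u} [CommRing A] (hone : (1 : A) ∈ (⊤ : Ideal A) ^ 1) :
    Function.Injective (awayHom ⊤ (reesMonomial _ hone)) := by
  rw [injective_iff_map_eq_zero]
  intro c hc
  have h' := congrArg HomogeneousLocalization.val hc
  rw [val_awayHom, HomogeneousLocalization.val_zero, IsLocalization.map_eq_zero_iff
    (Submonoid.powers (reesMonomial (⊤ : Ideal A) hone))] at h'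
  obtain ⟨⟨_, q, rfl⟩, hq⟩ := h'
  dsimp only at hq
  rw [mul_comm, reesMonomial_pow, algebraMap_mul_reesMonomial] at hq
  have hcoeff := congrArg (fun z : reesAlgebra (⊤ : Ideal A) => (z : A[X]).coeff (1 * q)) hq
  simpa [reesMonomial, Polynomial.coeff_monomial] using hcoeff

lemma awayHom_surjective {A : Type u} [CommRing A] (hone : (1 : A) ∈ (⊤ : Ideal A) ^ 1) :
    Function.Surjective (awayHom ⊤ (reesMonomial _ hone)) := by
  intro z
  obtain ⟨r, b, hb, rfl⟩ := exists_eq_awayFrac hone z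
  refine ⟨b, ?_⟩
  rw [← awayHom_pow_mul_awayFrac hone r hb, one_pow, map_one]
  exact one_mul (awayFrac hone r hb)

lemma isIso_reesProjToSpec {A : Type u} [CommRing A] : IsIso (reesProjToSpec (⊤ : Ideal A)) := by
  have hone : (1 : A) ∈ (⊤ : Ideal A) ^ 1 := by simp
  have hT := reesMonomial_mem _ hone
  have htop : (Proj.awayι (reesGrading (⊤ : Ideal A)) _ hT one_pos).opensRange = ⊤ := by
    rw [Proj.opensRange_awayι, ← Proj.iSup_basicOpen_eq_top (reesGrading (⊤ : Ideal A))
      (fun _ : Unit => reesMonomial _ hone)]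
    · simp
    · intro z hz
      rw [Set.range_const, Ideal.mem_span_singleton]
      refine reesMonomial_one_dvd hone ?_
      have hproj := congrArg (fun y : reesAlgebra (⊤ : Ideal A) => (y : A[X]).coeff 0)
        ((HomogeneousIdeal.mem_irrelevant_iff _ _).1 hz)
      exact (coeff_zero_proj_zero _ z).symm.trans hproj
  have hcomp : Proj.awayι (reesGrading (⊤ : Ideal A)) _ hT one_pos ≫ reesProjToSpec (⊤ : Ideal A) =
      Spec.map (CommRingCat.ofHom (awayHom ⊤ (reesMonomial _ hone))) := by
    rw [reesProjToSpec, Proj.awayι_toSpecZero_assoc, ← specMap_awayHom]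
  have hiso : IsIso (Proj.awayι (reesGrading (⊤ : Ideal A)) _ hT one_pos) :=
    isIso_of_isOpenImmersion_of_opensRange_eq_top _ htop
  have : IsIso (CommRingCat.ofHom (awayHom ⊤ (reesMonomial _ hone))) :=
    (ConcreteCategory.isIso_iff_bijective _).2 ⟨awayHom_injective hone, awayHom_surjective hone⟩
  exact IsIso.of_isIso_fac_left hcomp

lemma isIso_reesProjToSpec_of_eq_top {A : Type u} [CommRing A] {J : Ideal A} (hJ : J = ⊤) :
    IsIso (reesProjToSpec J) := by
  subst hJ
  exact isIso_reesProjToSpec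

lemma isIso_morphismRestrict_of_isAffineOpen {I : Y.IdealSheafData} (hpr : IsBlowup pr I)
    (V : Y.affineOpens) (hV : I.ideal V = ⊤) : IsIso (pr ∣_ V.1) := by
  obtain ⟨e, he⟩ := hpr V
  have := isIso_reesProjToSpec_of_eq_top hV
  have h : pr ∣_ V.1 = e.hom ≫ reesProjToSpec _ ≫ V.2.isoSpec.inv := by
    rw [← cancel_mono V.1.ι, morphismRestrict_ι, ← he]
    simp only [Category.assoc]
    rfl
  rw [h]
  infer_instance

lemma isIso_morphismRestrict {I : Y.IdealSheafData} (hpr : IsBlowup pr I) (U : Y.Opens)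
    (hU : ∀ V : Y.affineOpens, V.1 ≤ U → I.ideal V = ⊤) : IsIso (pr ∣_ U) := by
  change MorphismProperty.isomorphisms Scheme.{u} (pr ∣_ U)
  refine IsZariskiLocalAtTarget.of_forall_exists_morphismRestrict fun x => ?_
  obtain ⟨W, hW, hxW, hWU⟩ := exists_isAffineOpen_mem_and_subset x.2
  refine ⟨U.ι ⁻¹ᵁ W, hxW, ?_⟩
  rw [MorphismProperty.arrow_mk_iso_iff (MorphismProperty.isomorphisms Scheme.{u})
      (morphismRestrictRestrict pr U (U.ι ⁻¹ᵁ W)),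
    MorphismProperty.arrow_mk_iso_iff (MorphismProperty.isomorphisms Scheme.{u})
      (morphismRestrictEq pr (V := W) (by
        rw [Scheme.Hom.image_preimage_eq_opensRange_inf, Scheme.Opens.opensRange_ι]
        exact inf_eq_right.2 hWU))]
  exact isIso_morphismRestrict_of_isAffineOpen hpr ⟨W, hW⟩ (hU ⟨W, hW⟩ hWU)

end Chart

/-! ### Modifications -/

section Modification

variable {X Y : Scheme.{u}} (pr : X ⟶ Y) (Z : Y.Opens)

/-- `pr` is an isomorphism over the open subset `Z`, and functions on `X` are determined by their
restrictions to the inverse image of `Z`. -/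
structure IsModification : Prop where
  isIso : IsIso (pr ∣_ Z)
  resHom_injective :
    ∀ U : X.Opens, Function.Injective (resHom (inf_le_left : U ⊓ pr ⁻¹ᵁ Z ≤ U))

variable {pr Z}

lemma isIso_morphismRestrict_of_le [IsIso (pr ∣_ Z)] {W : Y.Opens} (hW : W ≤ Z) :
    IsIso (pr ∣_ W) := by
  change MorphismProperty.isomorphisms Scheme.{u} (pr ∣_ W)
  rw [← MorphismProperty.arrow_mk_iso_iff (MorphismProperty.isomorphisms Scheme.{u})
      (morphismRestrictEq pr (U := Z.ι ''ᵁ (Z.ι ⁻¹ᵁ W)) (V := W) (by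
        rw [Scheme.Hom.image_preimage_eq_opensRange_inf, Scheme.Opens.opensRange_ι]
        exact inf_eq_right.2 hW)),
    ← MorphismProperty.arrow_mk_iso_iff (MorphismProperty.isomorphisms Scheme.{u})
      (morphismRestrictRestrict pr Z (Z.ι ⁻¹ᵁ W))]
  exact inferInstanceAs (IsIso (pr ∣_ Z ∣_ (Z.ι ⁻¹ᵁ W)))

lemma bijective_app_of_isIso_morphismRestrict (W : Y.Opens) [IsIso (pr ∣_ W)] :
    Function.Bijective (pr.app W) := by
  have happ : IsIso (pr.app (W.ι ''ᵁ ⊤)) := by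
    have : IsIso (pr.app (W.ι ''ᵁ ⊤) ≫
        X.presheaf.map (eqToHom (image_morphismRestrict_preimage pr W ⊤)).op) := by
      rw [← morphismRestrict_appTop pr W]
      exact inferInstanceAs (IsIso ((pr ∣_ W).app ⊤))
    exact IsIso.of_isIso_comp_right _
      (X.presheaf.map (eqToHom (image_morphismRestrict_preimage pr W ⊤)).op)
  rw [W.ι_image_top] at happ
  exact ConcreteCategory.bijective_of_isIso (pr.app W)

namespace IsModification

lemma bijective_app (hM : IsModification pr Z) {W : Y.Opens} (hW : W ≤ Z) :
    Function.Bijective (pr.app W) := by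
  have := hM.isIso
  have : IsIso (pr ∣_ W) := isIso_morphismRestrict_of_le hW
  exact bijective_app_of_isIso_morphismRestrict W

lemma le_of_preimage_le (hM : IsModification pr Z) {W W' : Y.Opens} (hW : W ≤ Z)
    (hWW' : pr ⁻¹ᵁ W ≤ pr ⁻¹ᵁ W') : W ≤ W' := by
  have := hM.isIso
  intro y hy
  obtain ⟨x, hx⟩ : ∃ x, pr x = y := by
    refine ⟨(inv (pr ∣_ Z) ⟨y, hW hy⟩).1, ?_⟩
    rw [← morphismRestrict_base_coe]
    exact congrArg Subtype.val (Scheme.inv_hom_apply (asIso (pr ∣_ Z)) _)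
  subst hx
  exact hWW' hy

lemma exists_eq_preimage (hM : IsModification pr Z) {U : X.Opens} (hU : U ≤ pr ⁻¹ᵁ Z) :
    ∃ W ≤ Z, U = pr ⁻¹ᵁ W := by
  have := hM.isIso
  refine ⟨Z.ι ''ᵁ (inv (pr ∣_ Z) ⁻¹ᵁ ((pr ⁻¹ᵁ Z).ι ⁻¹ᵁ U)), Scheme.Opens.ι_image_le _ _, ?_⟩
  rw [← image_morphismRestrict_preimage, ← Scheme.Hom.comp_preimage, IsIso.hom_inv_id,
    Scheme.Hom.id_preimage, Scheme.Hom.image_preimage_eq_opensRange_inf,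
    Scheme.Opens.opensRange_ι]
  exact (inf_eq_right.2 hU).symm

end IsModification

end Modification

section Blowup

variable {X Y : Scheme.{u}} {R : CommRingCat.{u}} (f : Y ⟶ Spec R) {pr : X ⟶ Y}
  {I : Y.IdealSheafData}

lemma app_const (V : Y.Opens) (r : R) : pr.app V (const f V r) = const (pr ≫ f) (pr ⁻¹ᵁ V) r := by
  change pr.app V (resHom le_top (f.appTop _)) = resHom le_top ((pr ≫ f).appTop _)
  rw [app_resHom]
  rfl

variable [Flat f] (hpr : IsBlowup pr I)

include hpr

lemma IsBlowup.const_mem_nonZeroDivisors {r : R} (hr : r ∈ nonZeroDivisors R) (U : X.Opens) :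
    const (pr ≫ f) U r ∈ nonZeroDivisors Γ(X, U) := by
  rw [mem_nonZeroDivisors_iff_left]
  intro s hs
  refine eq_of_locally_resHom_eq fun x hx => ?_
  obtain ⟨V, hV, hxV, -⟩ := exists_isAffineOpen_mem_and_subset (U := ⊤) (x := pr x) trivial
  obtain ⟨D, hD, n, a, hxD, hDU, hF⟩ := hpr.exists_chart ⟨V, hV⟩ hx hxV
  have hrD := hF.map_mem_nonZeroDivisors _ (ArithDiff.const_mem_nonZeroDivisors f hr V)
  rw [RingHom.comp_apply] at hrD
  change resHom hD (pr.app V _) ∈ _ at hrD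
  rw [app_const, resHom_const] at hrD
  refine ⟨D, hDU, hxD, ?_⟩
  rw [map_zero]
  refine mem_nonZeroDivisors_iff_left.1 hrD _ ?_
  rw [← resHom_const (pr ≫ f) hDU, ← map_mul, hs, map_zero]

include f in
lemma IsBlowup.isAddTorsionFree_sections [IsAddTorsionFree R] (U : X.Opens) :
    IsAddTorsionFree Γ(X, U) where
  nsmul_right_injective n hn s t h := by
    have hnU := hpr.const_mem_nonZeroDivisors f (natCast_mem_nonZeroDivisors (B := R) hn) U
    rw [map_natCast] at hnU
    refine (mul_cancel_left_mem_nonZeroDivisors hnU).1 ?_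
    simpa only [nsmul_eq_mul] using h

lemma IsBlowup.resHom_basicOpen_injective {ϖ : R} (hϖ : ϖ ∈ nonZeroDivisors R) (U : X.Opens) :
    Function.Injective
      (resHom (inf_le_left : U ⊓ pr ⁻¹ᵁ Y.basicOpen (const f ⊤ ϖ) ≤ U)) := by
  rw [injective_iff_map_eq_zero]
  refine fun s hs => eq_of_locally_resHom_eq fun x hx => ?_
  obtain ⟨D, hD, hxD, hDU⟩ := exists_isAffineOpen_mem_and_subset hx
  refine ⟨D, hDU, hxD, ?_⟩
  have hle : X.basicOpen (const (pr ≫ f) D ϖ) ≤ U ⊓ pr ⁻¹ᵁ Y.basicOpen (const f ⊤ ϖ) := by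
    refine le_inf ((X.basicOpen_le _).trans hDU) ?_
    rw [Scheme.preimage_basicOpen]
    change _ ≤ X.basicOpen (pr.app ⊤ (const f ⊤ ϖ))
    rw [app_const, ← resHom_const (pr ≫ f) (le_top : D ≤ ⊤)]
    change X.basicOpen (X.presheaf.map _ _) ≤ _
    rw [Scheme.basicOpen_res]
    exact inf_le_right
  have hs' := congrArg (resHom hle) hs
  rw [resHom_resHom, map_zero] at hs'
  obtain ⟨n, hn⟩ := exists_pow_mul_eq_zero_of_res_basicOpen_eq_zero_of_isCompact X hD.isCompact
    (resHom hDU s) (const (pr ≫ f) D ϖ) (by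
      exact (resHom_resHom hDU (X.basicOpen_le _) s).trans hs')
  rw [map_zero]
  exact mem_nonZeroDivisors_iff_left.1
    (pow_mem (hpr.const_mem_nonZeroDivisors f hϖ D) n) _ hn

omit [Flat f] in
lemma IsBlowup.isIso_morphismRestrict_basicOpen {ϖ : R} {N : ℕ}
    (hI : ∀ U : Y.affineOpens, const f U.1 (ϖ ^ N) ∈ I.ideal U) :
    IsIso (pr ∣_ Y.basicOpen (const f ⊤ ϖ)) := by
  refine isIso_morphismRestrict hpr _ fun V hV => Ideal.eq_top_of_isUnit_mem _ (hI V) ?_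
  have hunit : IsUnit
      (resHom (Y.basicOpen_le _) (const f ⊤ ϖ) : Γ(Y, Y.basicOpen (const f ⊤ ϖ))) :=
    RingedSpace.isUnit_res_basicOpen _ _
  have hunit' := hunit.map (resHom hV)
  rw [resHom_resHom, resHom_const] at hunit'
  rw [map_pow]
  exact hunit'.pow _

lemma IsBlowup.isModification {ϖ : R} (hϖ : ϖ ∈ nonZeroDivisors R) {N : ℕ}
    (hI : ∀ U : Y.affineOpens, const f U.1 (ϖ ^ N) ∈ I.ideal U) :
    IsModification pr (Y.basicOpen (const f ⊤ ϖ)) where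
  isIso := hpr.isIso_morphismRestrict_basicOpen f hI
  resHom_injective := hpr.resHom_basicOpen_injective f hϖ

end Blowup

/-! ### Extension of operators to the blow-up -/

section Extension

variable {X Y : Scheme.{u}} (pr : X ⟶ Y) (Z : Y.Opens) {V : Y.Opens}

/-- The section `t` of `𝒪_X` is the value at `s` of the operator `P` on `𝒪_Y`, as far as can be
seen over `Z`. -/
def IsValue (P : endRing Y V) {U : X.Opens} (s t : Γ(X, U)) : Prop :=
  ∀ (W : Y.Opens) (hV : W ≤ V) (_ : W ≤ Z) (hU : pr ⁻¹ᵁ W ≤ U) (a : Γ(Y, W)),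
    resHom hU s = pr.app W a → resHom hU t = pr.app W (evalOp P hV a)

variable {pr Z} (hZ : IsModification pr Z) {P Q : endRing Y V} {U : X.Opens} {s s' t t' : Γ(X, U)}

namespace IsValue

lemma res (h : IsValue pr Z P s t) {V' : Y.Opens} (hV : V' ≤ V) {U' : X.Opens} (hU : U' ≤ U) :
    IsValue pr Z (endRing.res hV P) (resHom hU s) (resHom hU t) := by
  intro W hWV hWZ hWU a ha
  rw [resHom_resHom] at ha ⊢
  exact h W (hWV.trans hV) hWZ (hWU.trans hU) a ha

lemma res_section (h : IsValue pr Z P s t) {U' : X.Opens} (hU : U' ≤ U) :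
    IsValue pr Z P (resHom hU s) (resHom hU t) :=
  h.res le_rfl hU

include hZ

lemma of_res {V' : Y.Opens} (hV : V' ≤ V) (hU : U ≤ pr ⁻¹ᵁ V')
    (h : IsValue pr Z (endRing.res hV P) s t) : IsValue pr Z P s t := fun W _ hWZ hWU a ha =>
  h W (hZ.le_of_preimage_le hWZ (hWU.trans hU)) hWZ hWU a ha

lemma unique (hU : U ≤ pr ⁻¹ᵁ V) (h : IsValue pr Z P s t) (h' : IsValue pr Z P s t') : t = t' := by
  obtain ⟨W, hWZ, hW⟩ := hZ.exists_eq_preimage (U := U ⊓ pr ⁻¹ᵁ Z) inf_le_right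
  have hWU : pr ⁻¹ᵁ W ≤ U := hW.symm.le.trans inf_le_left
  have hWV : W ≤ V := hZ.le_of_preimage_le hWZ (hWU.trans hU)
  obtain ⟨a, ha⟩ := (hZ.bijective_app hWZ).2 (resHom hWU s)
  have htt' : resHom hWU t = resHom hWU t' :=
    (h W hWV hWZ hWU a ha.symm).trans (h' W hWV hWZ hWU a ha.symm).symm
  refine hZ.resHom_injective U ?_
  rw [← resHom_resHom hWU hW.le, htt', resHom_resHom]

lemma add (h : IsValue pr Z P s t) (h' : IsValue pr Z P s' t') :
    IsValue pr Z P (s + s') (t + t') := by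
  intro W hWV hWZ hWU a ha
  obtain ⟨b, hb⟩ := (hZ.bijective_app hWZ).2 (resHom hWU s)
  obtain ⟨b', hb'⟩ := (hZ.bijective_app hWZ).2 (resHom hWU s')
  have hab : a = b + b' := (hZ.bijective_app hWZ).1 (by
    rw [← ha, map_add, map_add]
    exact congrArg₂ _ hb.symm hb'.symm)
  rw [map_add, h W hWV hWZ hWU b hb.symm, h' W hWV hWZ hWU b' hb'.symm, hab, map_add, map_add]

omit hZ

lemma comp (h : IsValue pr Z Q s t) (h' : IsValue pr Z P t t') : IsValue pr Z (P * Q) s t' :=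
  fun W hWV hWZ hWU a ha => h' W hWV hWZ hWU _ (h W hWV hWZ hWU a ha)

lemma op_add (h : IsValue pr Z P s t) (h' : IsValue pr Z Q s t') :
    IsValue pr Z (P + Q) s (t + t') := by
  intro W hWV hWZ hWU a ha
  rw [evalOp_add, map_add, map_add, h W hWV hWZ hWU a ha, h' W hWV hWZ hWU a ha]

lemma op_neg (h : IsValue pr Z P s t) : IsValue pr Z (-P) s (-t) := by
  intro W hWV hWZ hWU a ha
  have : evalOp (-P) hWV a = -evalOp P hWV a := rfl
  rw [this, map_neg, map_neg, h W hWV hWZ hWU a ha]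

lemma op_zero : IsValue pr Z (0 : endRing Y V) s 0 := by
  intro W hWV _ hWU a _
  have : evalOp (0 : endRing Y V) hWV a = 0 := rfl
  rw [this, map_zero, map_zero]

lemma op_one : IsValue pr Z (1 : endRing Y V) s s := fun _ _ _ _ _ ha => ha

end IsValue

lemma isValue_mulOp (hU : U ≤ pr ⁻¹ᵁ V) (a : Γ(Y, V)) (s : Γ(X, U)) :
    IsValue pr Z (mulOp V a) s (resHom hU (pr.app V a) * s) := by
  intro W hWV _ hWU b hb
  rw [evalOp_mulOp, map_mul, map_mul, hb, resHom_resHom, app_resHom]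

include hZ

lemma isValue_app {W : Y.Opens} (hW : W ≤ V) (a : Γ(Y, W)) :
    IsValue pr Z P (pr.app W a) (pr.app W (evalOp P hW a)) := by
  intro W' hWV hWZ hWU b hb
  have hWW := hZ.le_of_preimage_le hWZ hWU
  rw [← app_resHom pr hWW, ← evalOp_resHom P hW hWW]
  rw [← app_resHom pr hWW] at hb
  rw [(hZ.bijective_app hWZ).1 hb]

lemma isValue_of_locally (h : ∀ x ∈ U, ∃ (U' : X.Opens) (hU : U' ≤ U), x ∈ U' ∧
    IsValue pr Z P (resHom hU s) (resHom hU t)) : IsValue pr Z P s t := by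
  intro W hWV hWZ hWU a ha
  refine eq_of_locally_resHom_eq fun x hx => ?_
  obtain ⟨U', hU, hxU', hU'⟩ := h x (hWU hx)
  obtain ⟨W', hWZ', hW'⟩ := hZ.exists_eq_preimage (U := U' ⊓ pr ⁻¹ᵁ W)
    (inf_le_right.trans (pr.preimage_mono hWZ))
  have hWW : W' ≤ W := hZ.le_of_preimage_le hWZ' (hW'.symm.le.trans inf_le_right)
  have hWU' : pr ⁻¹ᵁ W' ≤ U' := hW'.symm.le.trans inf_le_left
  refine ⟨pr ⁻¹ᵁ W', pr.preimage_mono hWW, hW'.le ⟨hxU', hx⟩, ?_⟩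
  have hW't := hU' W' (hWW.trans hWV) hWZ' hWU' (resHom hWW a) (by
    rw [app_resHom, ← ha, resHom_resHom, resHom_resHom])
  rw [resHom_resHom, evalOp_resHom P hWV hWW, app_resHom] at hW't
  rw [resHom_resHom, hW't]

lemma exists_isValue_of_locally (hU : U ≤ pr ⁻¹ᵁ V)
    (h : ∀ x ∈ U, ∃ (U' : X.Opens) (hU : U' ≤ U), x ∈ U' ∧ ∃ t, IsValue pr Z P (resHom hU s) t) :
    ∃ t, IsValue pr Z P s t := by
  obtain ⟨t, ht⟩ := exists_section_of_locally_unique X.sheaf (V := U)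
    (fun U' (t : Γ(X, U')) => ∃ h : U' ≤ U, IsValue pr Z P (resHom h s) t)
    (fun W W' h t ht => by
      obtain ⟨h', ht⟩ := ht
      refine ⟨h.trans h', ?_⟩
      have ht' := ht.res_section h
      rwa [resHom_resHom] at ht')
    (fun W hW t t' ht ht' => ht.2.unique hZ (hW.trans hU) ht'.2)
    (fun x hx => by
      obtain ⟨U', hU', hx', t, ht⟩ := h x hx
      exact ⟨U', hU', hx', t, hU', ht⟩)
  refine ⟨t, isValue_of_locally hZ fun x hx => ?_⟩
  obtain ⟨U', hU', hx', ht'⟩ := ht x hx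
  exact ⟨U', hU', hx', ht'.2⟩

variable (pr Z) in
omit hZ in
/-- The operator `P` on `𝒪_Y|_V` extends to an operator on `𝒪_X|_{pr⁻¹ V}`. -/
def Extends (P : endRing Y V) : Prop :=
  ∀ (U : X.Opens) (_ : U ≤ pr ⁻¹ᵁ V) (s : Γ(X, U)), ∃ t, IsValue pr Z P s t

/-- The ring of the operators on `𝒪_Y|_V` that extend to `X`. -/
def extendSubring (V : Y.Opens) : Subring (endRing Y V) where
  carrier := {P | Extends pr Z P}
  mul_mem' hP hQ U hU s := by
    obtain ⟨t, ht⟩ := hQ U hU s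
    obtain ⟨t', ht'⟩ := hP U hU t
    exact ⟨t', ht.comp ht'⟩
  one_mem' _ _ s := ⟨s, .op_one⟩
  add_mem' hP hQ U hU s := by
    obtain ⟨t, ht⟩ := hP U hU s
    obtain ⟨t', ht'⟩ := hQ U hU s
    exact ⟨t + t', ht.op_add ht'⟩
  zero_mem' _ _ _ := ⟨0, .op_zero⟩
  neg_mem' hP U hU s := by
    obtain ⟨t, ht⟩ := hP U hU s
    exact ⟨-t, ht.op_neg⟩

lemma extends_of_locally (h : ∀ y ∈ V, ∃ (W : Y.Opens) (h : W ≤ V), y ∈ W ∧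
    Extends pr Z (endRing.res h P)) : Extends pr Z P := by
  intro U hU s
  refine exists_isValue_of_locally hZ hU fun x hx => ?_
  obtain ⟨W, hW, hxW, hWP⟩ := h (pr x) (hU hx)
  obtain ⟨t, ht⟩ := hWP (U ⊓ pr ⁻¹ᵁ W) inf_le_right (resHom inf_le_left s)
  exact ⟨U ⊓ pr ⁻¹ᵁ W, inf_le_left, ⟨hx, hxW⟩, t, ht.of_res hZ hW inf_le_right⟩

omit hZ in
lemma Extends.res (h : Extends pr Z P) {V' : Y.Opens} (hV : V' ≤ V) :
    Extends pr Z (endRing.res hV P) := by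
  intro U hU s
  obtain ⟨t, ht⟩ := h U (hU.trans (pr.preimage_mono hV)) s
  refine ⟨t, ?_⟩
  have := ht.res hV le_rfl
  rwa [resHom_self, resHom_self] at this

/-- The extension to `X` of an operator on `𝒪_Y|_V`. -/
noncomputable def Extends.extend (h : Extends pr Z P) : endRing X (pr ⁻¹ᵁ V) :=
  ⟨fun U => AddMonoidHom.mk' (fun s => (h U.1 U.2 s).choose) fun s s' =>
      IsValue.unique hZ U.2 (h U.1 U.2 (s + s')).choose_spec
        ((h U.1 U.2 s).choose_spec.add hZ (h U.1 U.2 s').choose_spec),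
    fun U U' hU s => IsValue.unique hZ U'.2 (h U'.1 U'.2 _).choose_spec
      ((h U.1 U.2 s).choose_spec.res_section hU)⟩

lemma Extends.isValue (h : Extends pr Z P) (hU : U ≤ pr ⁻¹ᵁ V) (s : Γ(X, U)) :
    IsValue pr Z P s (evalOp (h.extend hZ) hU s) :=
  (h U hU s).choose_spec

lemma Extends.eq_of_isValue (h : Extends pr Z P) (hU : U ≤ pr ⁻¹ᵁ V) (hst : IsValue pr Z P s t) :
    evalOp (h.extend hZ) hU s = t :=
  (h.isValue hZ hU s).unique hZ hU hst

end Extension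

section Blowup

variable {X Y : Scheme.{u}} {R : CommRingCat.{u}} {f : Y ⟶ Spec R} {pr : X ⟶ Y} {Z : Y.Opens}

lemma leibnizCoeff_self (p m : ℕ) {n : ℕ} (ν : Fin n → ℕ) : leibnizCoeff p m ν ν = 1 := by
  refine Finset.prod_eq_one fun i _ => ?_
  rw [Nat.sub_self, Nat.zero_div, Nat.factorial_zero, mul_one, Nat.div_self (Nat.factorial_pos _)]

namespace Coordinates

variable [∀ W : Y.Opens, IsAddTorsionFree Γ(Y, W)] (hZ : IsModification pr Z) {V : Y.Opens}
  (c : Coordinates f V) (ϖ : R) (p m k : ℕ) (ν : Fin c.n → ℕ) {U : X.Opens} {s t : Γ(X, U)}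

include hZ

lemma isValue_op_mul {S T : (Fin c.n → ℕ) → Γ(X, U)}
    (hS : ∀ μ, IsValue pr Z (c.op ϖ p m k μ) s (S μ))
    (hT : ∀ μ, IsValue pr Z (c.op ϖ p m k μ) t (T μ)) :
    IsValue pr Z (c.op ϖ p m k ν) (s * t)
      (∑ μ ∈ Finset.Iic ν, (leibnizCoeff p m ν μ : Γ(X, U)) * (S μ * T (ν - μ))) := by
  intro W hWV hWZ hWU a ha
  obtain ⟨b, hb⟩ := (hZ.bijective_app hWZ).2 (resHom hWU s)
  obtain ⟨d, hd⟩ := (hZ.bijective_app hWZ).2 (resHom hWU t)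
  have hab : a = b * d := (hZ.bijective_app hWZ).1 (by
    rw [← ha, map_mul, map_mul]
    exact congrArg₂ _ hb.symm hd.symm)
  rw [hab, c.evalOp_op_mul, map_sum, map_sum]
  refine Finset.sum_congr rfl fun μ _ => ?_
  rw [map_mul, map_mul, map_mul, map_mul, map_natCast, map_natCast, hS μ W hWV hWZ hWU b hb.symm,
    hT (ν - μ) W hWV hWZ hWU d hd.symm]

lemma isValue_op_of_isValue_mul {u B : Γ(X, U)} {S A : (Fin c.n → ℕ) → Γ(X, U)} (hU : U ≤ pr ⁻¹ᵁ V)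
    (hu : ∀ (U' : X.Opens) (h : U' ≤ U), resHom h u ∈ nonZeroDivisors Γ(X, U'))
    (hS : ∀ μ < ν, IsValue pr Z (c.op ϖ p m k μ) s (S μ))
    (hA : ∀ μ, IsValue pr Z (c.op ϖ p m k μ) u (A μ))
    (hB : IsValue pr Z (c.op ϖ p m k ν) (s * u) B)
    (ht : t * u + ∑ μ ∈ Finset.Iio ν, (leibnizCoeff p m ν μ : Γ(X, U)) * (S μ * A (ν - μ)) = B) :
    IsValue pr Z (c.op ϖ p m k ν) s t := by
  intro W hWV hWZ hWU a ha
  have hleibniz := c.isValue_op_mul hZ ϖ p m k ν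
    (fun μ => isValue_app (P := c.op ϖ p m k μ) hZ hWV a) fun μ => (hA μ).res_section hWU
  rw [← ha, ← map_mul] at hleibniz
  have hsum := hleibniz.unique hZ (pr.preimage_mono hWV) (hB.res_section hWU)
  have hA0 : A 0 = u := (hA 0).unique hZ hU (by rw [op_zero]; exact .op_one)
  have hSa : ∀ μ ∈ Finset.Iio ν, resHom hWU (S μ) = pr.app W (evalOp (c.op ϖ p m k μ) hWV a) :=
    fun μ hμ => hS μ (Finset.mem_Iio.1 hμ) W hWV hWZ hWU a ha
  rw [← ht, map_add, map_mul, ← Finset.Iio_insert, Finset.sum_insert Finset.notMem_Iio_self,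
    leibnizCoeff_self, Nat.cast_one, one_mul, tsub_self, hA0, map_sum] at hsum
  refine (mul_cancel_right_mem_nonZeroDivisors (hu _ hWU)).1 (add_right_cancel (hsum.symm.trans ?_))
  refine congrArg _ (Finset.sum_congr rfl fun μ hμ => ?_)
  rw [map_mul, map_mul, map_natCast, hSa μ hμ]

end Coordinates

variable {I : Y.IdealSheafData} [Flat f] [∀ W : Y.Opens, IsAddTorsionFree Γ(Y, W)]
  (hpr : IsBlowup pr I) (hZ : IsModification pr Z) {ϖ : R} (hϖ : ϖ ∈ nonZeroDivisors R) {N : ℕ}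
  (hI : ∀ U : Y.affineOpens, const f U.1 (ϖ ^ N) ∈ I.ideal U) (p m : ℕ) {k : ℕ} (hk : N ≤ k)
  {V : Y.Opens}

include hpr hZ hϖ hI hk

lemma Coordinates.extends_op (c : Coordinates f V) (ν : Fin c.n → ℕ) :
    Extends pr Z (c.op ϖ p m k ν) := by
  intro U hU s
  refine exists_isValue_of_locally hZ hU fun x hx => ?_
  obtain ⟨D, hD, n, a, hxD, hDU, hF⟩ := hpr.exists_chart ⟨V, c.affine⟩ hx (hU hx)
  refine ⟨D, hDU, hxD, ?_⟩
  generalize resHom hDU s = s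
  set g := (resHom hD).comp (pr.app V).hom
  have hvalue : ∀ μ b, IsValue pr Z (c.op ϖ p m k μ) (g b) (g (evalOp (c.op ϖ p m k μ) le_rfl b)) :=
    fun μ b => (isValue_app hZ le_rfl b).res_section hD
  obtain ⟨r, b, hb, hs⟩ := hF.exists_eq s
  have hmem : ∀ μ, ∀ b ∈ I.ideal ⟨V, c.affine⟩ ^ (n * r),
      evalOp (c.op ϖ p m k μ) le_rfl b ∈ I.ideal ⟨V, c.affine⟩ ^ (n * r) := fun μ b hb =>
    c.evalOp_op_mem_pow le_rfl ϖ p m k (by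
      rw [← Nat.sub_add_cancel hk, pow_add, map_mul]
      exact Ideal.mul_mem_left _ _ (hI ⟨V, c.affine⟩)) _ _ hb
  have ha : a ^ r ∈ I.ideal ⟨V, c.affine⟩ ^ (n * r) := by
    rw [pow_mul]
    exact Ideal.pow_mem_pow hF.mem r
  choose α hα using fun μ => hF.dvd r _ (hmem μ _ ha)
  choose β hβ using fun μ => hF.dvd r _ (hmem μ _ hb)
  have hregular : ∀ (U' : X.Opens) (h : U' ≤ D),
      resHom h (g (a ^ r)) ∈ nonZeroDivisors Γ(X, U') := by
    intro U' h
    have hconst := hpr.const_mem_nonZeroDivisors f (pow_mem (pow_mem hϖ N) (n * r)) U'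
    rw [← resHom_const _ (h.trans hD), ← app_const f V, ← resHom_resHom hD h, map_pow (const f V)]
      at hconst
    exact hF.map_map_pow_mem_nonZeroDivisors (resHom h)
      (Ideal.pow_mem_pow (hI ⟨V, c.affine⟩) (n * r)) hconst
  induction ν using WellFoundedLT.induction with
  | ind ν ih =>
  choose! S hS using ih
  refine ⟨β ν - ∑ μ ∈ Finset.Iio ν, (leibnizCoeff p m ν μ : Γ(X, D)) * (S μ * α (ν - μ)),
    c.isValue_op_of_isValue_mul hZ ϖ p m k ν hD hregular hS (fun μ => hvalue μ _)
      (B := g (evalOp (c.op ϖ p m k ν) le_rfl b)) ?_ ?_⟩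
  · rw [mul_comm, hs]
    exact hvalue ν b
  · simp only [hα, hβ, mul_left_comm _ (g (a ^ r)), ← Finset.mul_sum]
    ring

lemma extends_of_mem_levelSubrings {P : endRing Y V} (hP : P ∈ (levelSubrings f ϖ p m k).ring V) :
    Extends pr Z P := by
  refine extends_of_locally hZ fun y hy => ?_
  obtain ⟨W, hW, hyW, hWP⟩ := hP y hy
  refine ⟨W, hW, hyW, ?_⟩
  have hle : Subring.closure (generators f ϖ p m k W) ≤ extendSubring (pr := pr) (Z := Z) W := by
    rw [Subring.closure_le]
    rintro Q (⟨a, rfl⟩ | ⟨U, hU, c, ν, rfl⟩)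
    · exact fun U hU s => ⟨_, isValue_mulOp hU a s⟩
    · exact (c.extends_op hpr hZ hϖ hI p m hk ν).res hU
  exact hle hWP

end Blowup

section OfSections

variable {X Y : Scheme.{u}} {pr : X ⟶ Y} {𝒜 : TopCat.Sheaf RingCat.{u} Y}
  {ℬ : TopCat.Sheaf RingCat.{u} X}

/-- The morphism `pr⁻¹ 𝒜 ⟶ ℬ` with given maps `𝒜(V) → ℬ(pr⁻¹ V)`. -/
noncomputable def ofSections (φ : 𝒜 ⟶ (TopCat.Sheaf.pushforward RingCat.{u} pr.base).obj ℬ) :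
    inverseImage pr 𝒜 ⟶ ℬ :=
  ((TopCat.Sheaf.pullbackPushforwardAdjunction RingCat.{u} pr.base).homEquiv 𝒜 ℬ).symm φ

lemma onSections_ofSections (φ : 𝒜 ⟶ (TopCat.Sheaf.pushforward RingCat.{u} pr.base).obj ℬ)
    (V : Y.Opens) : onSections (ofSections φ) V = (φ.hom.app (op V)).hom :=
  congrArg (fun φ : 𝒜 ⟶ (TopCat.Sheaf.pushforward RingCat.{u} pr.base).obj ℬ =>
    (φ.hom.app (op V)).hom) (Equiv.apply_symm_apply
      ((TopCat.Sheaf.pullbackPushforwardAdjunction RingCat.{u} pr.base).homEquiv 𝒜 ℬ) φ)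

end OfSections

section Action

variable {X Y : Scheme.{u}} {R : CommRingCat.{u}} {f : Y ⟶ Spec R} {pr : X ⟶ Y} {ϖ : R}
  {p m k : ℕ} {Z : Y.Opens} (hZ : IsModification pr Z)
  (hE : ∀ {V : Y.Opens} {P : endRing Y V}, P ∈ (levelSubrings f ϖ p m k).ring V → Extends pr Z P)

lemma extend_eq {V : Y.Opens} {P : (levelSubrings f ϖ p m k).ring V} {Q : endRing X (pr ⁻¹ᵁ V)}
    (h : ∀ (U : X.Opens) (hU : U ≤ pr ⁻¹ᵁ V) (s : Γ(X, U)), IsValue pr Z P.1 s (evalOp Q hU s)) :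
    (hE P.2).extend hZ = Q :=
  endRing_ext fun U hU s => (hE P.2).eq_of_isValue hZ hU (h U hU s)

/-- The extension to `X` of the operators of level `m`, on sections. -/
noncomputable def extendHom (V : Y.Opens) :
    (levelSubrings f ϖ p m k).ring V →+* (endSubrings X).ring (pr ⁻¹ᵁ V) :=
  RingHom.codRestrict
    { toFun P := (hE P.2).extend hZ
      map_one' := extend_eq hZ hE (V := V) (P := 1) fun _ _ _ => .op_one
      map_mul' P Q := extend_eq hZ hE (V := V) (P := P * Q) fun _ hU s =>
        ((hE Q.2).isValue hZ hU s).comp ((hE P.2).isValue hZ hU _)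
      map_zero' := extend_eq hZ hE (V := V) (P := 0) fun _ _ _ => .op_zero
      map_add' P Q := extend_eq hZ hE (V := V) (P := P + Q) fun _ hU s =>
        ((hE P.2).isValue hZ hU s).op_add ((hE Q.2).isValue hZ hU s) }
    ((endSubrings X).ring (pr ⁻¹ᵁ V)) fun _ => trivial

lemma isValue_extendHom {V : Y.Opens} (P : (levelSubrings f ϖ p m k).ring V) {U : X.Opens}
    (hU : U ≤ pr ⁻¹ᵁ V) (s : Γ(X, U)) :
    IsValue pr Z P.1 s (evalOp (extendHom hZ hE V P).1 hU s) :=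
  (hE P.2).isValue hZ hU s

/-- The action on `𝒪_X` of the operators of level `m` on `𝒪_Y`. -/
noncomputable def extendAction : inverseImage pr (levelSheaf f ϖ p m k) ⟶ endSheaf X :=
  ofSections
    { hom :=
        { app V := RingCat.ofHom (extendHom hZ hE V.unop)
          naturality V V' i := by
            ext P
            refine Subtype.ext (endRing_ext fun W hW s => ?_)
            refine IsValue.unique hZ hW (isValue_extendHom hZ hE _ hW s) ?_
            have h := (isValue_extendHom hZ hE (V := V.unop) P
              (hW.trans (pr.preimage_mono i.unop.le)) s).res i.unop.le le_rfl
            rw [resHom_self, resHom_self] at h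
            exact h } }

lemma onSections_extendAction (V : Y.Opens) :
    onSections (extendAction hZ hE) V = extendHom hZ hE V :=
  onSections_ofSections _ V

lemma isCompatibleAction_extendAction [∀ W : Y.Opens, IsAddTorsionFree Γ(Y, W)] :
    IsCompatibleAction f ϖ p m k pr (extendAction hZ hE) where
  linear V P W h a := by
    rw [onSections_extendAction]
    exact (isValue_extendHom hZ hE P _ _).unique hZ (pr.preimage_mono h) (isValue_app hZ h a)
  mul V a := by
    rw [onSections_extendAction]
    exact endRing_ext fun W hW s =>
      (isValue_extendHom hZ hE _ hW s).unique hZ hW (isValue_mulOp hW a s)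
  leibniz {V} c ν U h s t := by
    rw [onSections_extendAction]
    refine (isValue_extendHom hZ hE _ h _).unique hZ h ?_
    exact c.isValue_op_mul hZ ϖ p m k ν
      (fun μ => isValue_extendHom hZ hE (c.levelSection ϖ p m k μ) h s)
      (fun μ => isValue_extendHom hZ hE (c.levelSection ϖ p m k μ) h t)

end Action

/-! ### Rings generated by functions and an action -/

section Modules

variable {X : Scheme.{u}} (M : X.Modules) {N : X.Modules} {U V W : X.Opens}

/-- Restriction of sections of a module, as a map that is semilinear over the restriction of
functions. -/
noncomputable def moduleRes (h : W ≤ V) : Γ(M, V) →ₛₗ[resHom h] Γ(M, W) where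
  toFun := M.presheaf.map (homOfLE h).op
  map_add' := map_add _
  map_smul' := Scheme.Modules.map_smul M (homOfLE h)

variable {M}

lemma moduleRes_moduleRes (h : V ≤ U) (h' : W ≤ V) (s : Γ(M, U)) :
    moduleRes M h' (moduleRes M h s) = moduleRes M (h'.trans h) s := by
  change (M.presheaf.map (homOfLE h).op ≫ M.presheaf.map (homOfLE h').op) s = _
  rw [← Functor.map_comp]
  rfl

lemma moduleRes_self (h : V ≤ V) (s : Γ(M, V)) : moduleRes M h s = s := by
  change (M.presheaf.map (𝟙 (op V))) s = s
  rw [M.presheaf.map_id]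
  rfl

lemma eq_of_locally_moduleRes_eq {s t : Γ(M, V)}
    (h : ∀ x ∈ V, ∃ (W : X.Opens) (h : W ≤ V), x ∈ W ∧ moduleRes M h s = moduleRes M h t) :
    s = t := by
  choose W hW hxW hs using fun x : V => h x.1 x.2
  exact TopCat.Sheaf.eq_of_locally_eq' ⟨M.presheaf, M.isSheaf⟩ W V (fun x => homOfLE (hW x))
    (fun x hx => Opens.mem_iSup.2 ⟨⟨x, hx⟩, hxW ⟨x, hx⟩⟩) s t hs

lemma app_moduleRes (φ : M ⟶ N) (h : W ≤ V) (s : Γ(M, V)) :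
    φ.app W (moduleRes M h s) = moduleRes N h (φ.app V s) :=
  congr($(φ.mapPresheaf.naturality (homOfLE h).op) s)

/-- The morphism of modules with given maps on sections. -/
noncomputable def homOfSections (g : ∀ U : X.Opens, Γ(M, U) →ₗ[Γ(X, U)] Γ(N, U))
    (hg : ∀ {U W : X.Opens} (h : W ≤ U) s, g W (moduleRes M h s) = moduleRes N h (g U s)) :
    M ⟶ N where
  val :=
    { app U := ModuleCat.ofHom (g U.unop)
      naturality {U W} i := by
        ext s
        exact hg i.unop.le s }

end Modules

section LocalClosure

variable {X : Scheme.{u}} {V W : X.Opens}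

/-- Restriction of endomorphisms, as a map that is semilinear over the restriction of functions. -/
def endRes (h : W ≤ V) : endRing X V →ₛₗ[resHom h] endRing X W where
  __ := endRing.res h
  map_smul' := res_smul h

/-- The sections that lie locally in a family of submodules stable under the restriction maps
`r`. -/
def localClosure {E : X.Opens → Type u} [∀ W, AddCommGroup (E W)] [∀ W, Module Γ(X, W) (E W)]
    (r : ∀ {V W : X.Opens} (h : W ≤ V), E V →ₛₗ[resHom h] E W)
    (hr : ∀ {U V W : X.Opens} (h : V ≤ U) (h' : W ≤ V) s, r h' (r h s) = r (h'.trans h) s)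
    (N : ∀ W, Submodule Γ(X, W) (E W))
    (hN : ∀ {V W : X.Opens} (h : W ≤ V) {s}, s ∈ N V → r h s ∈ N W) (W : X.Opens) :
    Submodule Γ(X, W) (E W) where
  carrier := {s | ∀ x ∈ W, ∃ (W' : X.Opens) (h : W' ≤ W), x ∈ W' ∧ r h s ∈ N W'}
  zero_mem' _ hx := ⟨W, le_rfl, hx, by rw [map_zero]; exact zero_mem _⟩
  add_mem' {s t} hs ht x hx := by
    obtain ⟨W₁, h₁, hx₁, hs⟩ := hs x hx
    obtain ⟨W₂, h₂, hx₂, ht⟩ := ht x hx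
    refine ⟨W₁ ⊓ W₂, inf_le_left.trans h₁, ⟨hx₁, hx₂⟩, ?_⟩
    rw [map_add, ← hr h₁ inf_le_left, ← hr h₂ inf_le_right]
    exact add_mem (hN inf_le_left hs) (hN inf_le_right ht)
  smul_mem' a s hs x hx := by
    obtain ⟨W', h, hx', hs⟩ := hs x hx
    exact ⟨W', h, hx', by rw [map_smulₛₗ]; exact Submodule.smul_mem _ _ hs⟩

end LocalClosure

namespace LocalSubrings

variable {X : Scheme.{u}} (S : LocalSubrings X) {U V : X.Opens}

/-- Restriction of sections of a local family of subrings. -/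
def restrict (h : U ≤ V) : S.ring V →+* S.ring U :=
  ((endRing.res h).comp (S.ring V).subtype).codRestrict (S.ring U) fun P => S.res_mem h P.1 P.2

/-- The functions on `U`, as sections of a local family of subrings. -/
def mulSection (U : X.Opens) : Γ(X, U) →+* S.ring U :=
  (mulOp U).codRestrict (S.ring U) fun a => S.mulOp_mem a

instance : Module Γ(X, U) (S.ring U) := Module.compHom _ (S.mulSection U)

lemma smul_eq_mulSection_mul (a : Γ(X, U)) (P : S.ring U) : a • P = S.mulSection U a * P := rfl

/-- The inclusion of a local family of subrings into all endomorphisms. -/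
def inclusion (U : X.Opens) : S.ring U →ₗ[Γ(X, U)] endRing X U where
  toFun P := P.1
  map_add' _ _ := rfl
  map_smul' _ _ := rfl

/-- The identification of a local family of subrings with the sections of the module attached to
it. -/
noncomputable def sectionsEquiv (U : X.Opens) : S.ring U ≃ₗ[Γ(X, U)] Γ(S.leftModule, U) where
  toFun P := P
  invFun P := P
  left_inv _ := rfl
  right_inv _ := rfl
  map_add' _ _ := rfl
  map_smul' _ _ := rfl

variable {S}

lemma mem_span_of_coe_mem_span {ι : Type*} {B : ι → S.ring U} {P : S.ring U}
    (h : P.1 ∈ Submodule.span Γ(X, U) (Set.range fun i => (B i).1)) :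
    P ∈ Submodule.span Γ(X, U) (Set.range B) := by
  refine (Submodule.apply_mem_span_image_iff_mem_span (f := S.inclusion U)
    Subtype.val_injective).1 ?_
  rwa [← Set.range_comp]

end LocalSubrings

section Action

variable {X Y : Scheme.{u}} (pr : X ⟶ Y) (S₀ : LocalSubrings Y)

/-- An action on `𝒪_X` of a sheaf of rings of operators on `𝒪_Y`, given on the inverse images of
the opens of `Y`. -/
structure OperatorAction where
  hom : ∀ V : Y.Opens, S₀.ring V →+* endRing X (pr ⁻¹ᵁ V)
  res : ∀ {V V' : Y.Opens} (h : V' ≤ V) (P : S₀.ring V),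
    hom V' (S₀.restrict h P) = endRing.res (pr.preimage_mono h) (hom V P)
  mul : ∀ {V : Y.Opens} (a : Γ(Y, V)), hom V (S₀.mulSection V a) = mulOp _ (pr.app V a)

namespace OperatorAction

variable {pr S₀} (A : OperatorAction pr S₀) {V V' : Y.Opens} {W W' : X.Opens}

/-- The endomorphism of `𝒪_X|_W` given by an operator on an open whose inverse image
contains `W`. -/
def on (h : W ≤ pr ⁻¹ᵁ V) : S₀.ring V →+* endRing X W := (endRing.res h).comp (A.hom V)

lemma res_on (h : W ≤ pr ⁻¹ᵁ V) (h' : W' ≤ W) (P : S₀.ring V) :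
    endRing.res h' (A.on h P) = A.on (h'.trans h) P := rfl

lemma on_restrict (h : V' ≤ V) (h' : W ≤ pr ⁻¹ᵁ V') (P : S₀.ring V) :
    A.on h' (S₀.restrict h P) = A.on (h'.trans (pr.preimage_mono h)) P :=
  congrArg (endRing.res h') (A.res h P)

lemma on_mulSection (h : W ≤ pr ⁻¹ᵁ V) (a : Γ(Y, V)) :
    A.on h (S₀.mulSection V a) = mulOp W (pr.appLE V W h a) :=
  (congrArg (endRing.res h) (A.mul a)).trans (res_mulOp h _)

lemma on_smul (h : W ≤ pr ⁻¹ᵁ V) (a : Γ(Y, V)) (P : S₀.ring V) :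
    A.on h (a • P) = pr.appLE V W h a • A.on h P := by
  rw [LocalSubrings.smul_eq_mulSection_mul, RingHom.map_mul, on_mulSection, smul_eq_mulOp_mul]

lemma exists_on_mul_on (h : W ≤ pr ⁻¹ᵁ V) (h' : W ≤ pr ⁻¹ᵁ V') (P : S₀.ring V) (Q : S₀.ring V') :
    ∃ (V'' : Y.Opens) (h'' : W ≤ pr ⁻¹ᵁ V'') (PQ : S₀.ring V''),
      A.on h P * A.on h' Q = A.on h'' PQ := by
  have hVV' : W ≤ pr ⁻¹ᵁ (V ⊓ V') := fun _ hx => ⟨h hx, h' hx⟩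
  refine ⟨V ⊓ V', hVV', S₀.restrict inf_le_left P * S₀.restrict inf_le_right Q, ?_⟩
  rw [RingHom.map_mul, on_restrict, on_restrict]

/-- The `𝒪_X(W)`-linear combinations of the endomorphisms of `𝒪_X|_W` given by operators. -/
def combinations (W : X.Opens) : Submodule Γ(X, W) (endRing X W) :=
  Submodule.span _ {T | ∃ (V : Y.Opens) (h : W ≤ pr ⁻¹ᵁ V) (P : S₀.ring V), T = A.on h P}

variable {A}

lemma on_mem_combinations (h : W ≤ pr ⁻¹ᵁ V) (P : S₀.ring V) : A.on h P ∈ A.combinations W :=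
  Submodule.subset_span ⟨V, h, P, rfl⟩

lemma res_mem_combinations (h : W' ≤ W) {T : endRing X W} (hT : T ∈ A.combinations W) :
    endRing.res h T ∈ A.combinations W' := by
  induction hT using Submodule.closure_induction with
  | zero => rw [map_zero]; exact zero_mem _
  | add S T _ _ hS hT => rw [map_add]; exact add_mem hS hT
  | smul_mem a T hT =>
    obtain ⟨V, hV, P, rfl⟩ := hT
    rw [res_smul]
    exact Submodule.smul_mem _ _ (on_mem_combinations (h.trans hV) P)

lemma mul_on_mem_combinations (h : W ≤ pr ⁻¹ᵁ V) (P : S₀.ring V) {T : endRing X W}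
    (hT : T ∈ A.combinations W) : T * A.on h P ∈ A.combinations W := by
  induction hT using Submodule.closure_induction with
  | zero => rw [zero_mul]; exact zero_mem _
  | add S T _ _ hS hT => rw [add_mul]; exact add_mem hS hT
  | smul_mem a T hT =>
    obtain ⟨V', h', Q, rfl⟩ := hT
    obtain ⟨V'', h'', QP, hQP⟩ := A.exists_on_mul_on h' h Q P
    rw [smul_mul_assoc, hQP]
    exact Submodule.smul_mem _ _ (on_mem_combinations h'' QP)

variable (A) in
/-- The endomorphisms of `𝒪_X|_W` that are locally combinations of operators. -/
def localCombinations (W : X.Opens) : Submodule Γ(X, W) (endRing X W) :=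
  localClosure (X := X) (E := fun W => endRing X W) (fun h => endRes h) (fun _ _ _ => rfl)
    A.combinations (fun h _ hT => res_mem_combinations h hT) W

lemma mem_localCombinations_iff {T : endRing X W} :
    T ∈ A.localCombinations W ↔ ∀ x ∈ W, ∃ (W' : X.Opens) (h : W' ≤ W), x ∈ W' ∧
      endRing.res h T ∈ A.combinations W' := Iff.rfl

lemma mem_localCombinations {T : endRing X W} (hT : T ∈ A.combinations W) :
    T ∈ A.localCombinations W := fun _ hx => ⟨W, le_rfl, hx, hT⟩

lemma mem_localCombinations_of_locally {T : endRing X W}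
    (hT : ∀ x ∈ W, ∃ (W' : X.Opens) (h : W' ≤ W), x ∈ W' ∧
      endRing.res h T ∈ A.localCombinations W') : T ∈ A.localCombinations W := by
  intro x hx
  obtain ⟨W₁, h₁, hx₁, hT⟩ := hT x hx
  obtain ⟨W₂, h₂, hx₂, hT⟩ := hT x hx₁
  exact ⟨W₂, h₂.trans h₁, hx₂, hT⟩

lemma mul_on_mem_localCombinations (h : W ≤ pr ⁻¹ᵁ V) (P : S₀.ring V) {T : endRing X W}
    (hT : T ∈ A.localCombinations W) : T * A.on h P ∈ A.localCombinations W := by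
  refine mem_localCombinations_iff.2 fun x hx => ?_
  obtain ⟨W', h', hx', hT⟩ := mem_localCombinations_iff.1 hT x hx
  refine ⟨W', h', hx', ?_⟩
  rw [map_mul, res_on]
  exact mul_on_mem_combinations _ P hT

variable (A) in
/-- A family of operators that is a basis over `𝒪_Y` of the operators near `pr x`, and whose images
in the endomorphisms of `𝒪_X` remain linearly independent and can be moved to the right of
functions. -/
structure IsFrame {ι : Type} (B : ι → S₀.ring V) (x : X) : Prop where
  mem : pr x ∈ V
  exists_mem_span : ∀ {V' : Y.Opens} (P : S₀.ring V'), pr x ∈ V' →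
    ∃ (V'' : Y.Opens) (h' : V'' ≤ V') (h : V'' ≤ V), pr x ∈ V'' ∧
      S₀.restrict h' P ∈ Submodule.span Γ(Y, V'') (Set.range fun i => S₀.restrict h (B i))
  on_mul_mulOp_mem : ∀ {W : X.Opens} (h : W ≤ pr ⁻¹ᵁ V) i (s : Γ(X, W)),
    A.on h (B i) * mulOp W s ∈ A.combinations W
  linearIndependent : ∀ {W : X.Opens} (h : W ≤ pr ⁻¹ᵁ V),
    LinearIndependent Γ(X, W) fun i => A.on h (B i)

variable (A) in
/-- Every point of `X` has a frame of operators. -/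
def HasFrames : Prop :=
  ∀ x : X, ∃ (V : Y.Opens) (ι : Type) (B : ι → S₀.ring V), A.IsFrame B x

lemma IsFrame.exists_map_mem_span {ι : Type} {B : ι → S₀.ring V} {x : X} (hB : A.IsFrame B x)
    {E : X.Opens → Type u} [∀ W, AddCommGroup (E W)] [∀ W, Module Γ(X, W) (E W)]
    (χ : ∀ {V : Y.Opens} {W : X.Opens} (h : W ≤ pr ⁻¹ᵁ V),
      S₀.ring V →ₛₗ[(pr.appLE V W h).hom] E W)
    (hχ : ∀ {V V' : Y.Opens} {W : X.Opens} (h : V' ≤ V) (h' : W ≤ pr ⁻¹ᵁ V') (P : S₀.ring V),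
      χ h' (S₀.restrict h P) = χ (h'.trans (pr.preimage_mono h)) P)
    (h : W ≤ pr ⁻¹ᵁ V') (hx : x ∈ W) (P : S₀.ring V') :
    ∃ (W' : X.Opens) (h' : W' ≤ W) (hV : W' ≤ pr ⁻¹ᵁ V), x ∈ W' ∧
      χ (h'.trans h) P ∈ Submodule.span Γ(X, W') (Set.range fun i => χ hV (B i)) := by
  obtain ⟨V'', hV', hV, hxV, hP⟩ := hB.exists_mem_span P (h hx)
  have hW : W ⊓ pr ⁻¹ᵁ V'' ≤ pr ⁻¹ᵁ V'' := inf_le_right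
  refine ⟨W ⊓ pr ⁻¹ᵁ V'', inf_le_left, hW.trans (pr.preimage_mono hV), ⟨hx, hxV⟩, ?_⟩
  have hmem := Submodule.image_span_subset_span (χ hW) _ ⟨_, hP, rfl⟩
  rw [← Set.range_comp, hχ hV' hW] at hmem
  simpa only [Function.comp_def, hχ hV hW, SetLike.mem_coe] using hmem

variable (A) in
/-- `A.on h` as a semilinear map. -/
def onLinear (h : W ≤ pr ⁻¹ᵁ V) : S₀.ring V →ₛₗ[(pr.appLE V W h).hom] endRing X W where
  __ := A.on h
  map_smul' := A.on_smul h

section HasFrames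

variable (hA : A.HasFrames)

include hA

lemma on_mul_mulOp_mem_localCombinations (h : W ≤ pr ⁻¹ᵁ V) (P : S₀.ring V) (s : Γ(X, W)) :
    A.on h P * mulOp W s ∈ A.localCombinations W := by
  refine mem_localCombinations_iff.2 fun x hx => ?_
  obtain ⟨_, ι, B, hB⟩ := hA x
  obtain ⟨W', h', hV, hx', hP⟩ := hB.exists_map_mem_span A.onLinear A.on_restrict h hx P
  refine ⟨W', h', hx', ?_⟩
  rw [map_mul, res_on, res_mulOp]
  change A.on (h'.trans h) P ∈ Submodule.span _ (Set.range fun i => A.on hV (B i)) at hP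
  generalize A.on (h'.trans h) P = T at hP
  induction hP using Submodule.span_induction with
  | mem T hT =>
    obtain ⟨i, rfl⟩ := hT
    exact hB.on_mul_mulOp_mem hV i _
  | zero => rw [zero_mul]; exact zero_mem _
  | add S T _ _ hS hT => rw [add_mul]; exact add_mem hS hT
  | smul a T _ hT => rw [smul_mul_assoc]; exact Submodule.smul_mem _ a hT

lemma on_mul_mem_localCombinations (h : W ≤ pr ⁻¹ᵁ V) (P : S₀.ring V) {T : endRing X W}
    (hT : T ∈ A.combinations W) : A.on h P * T ∈ A.localCombinations W := by
  induction hT using Submodule.closure_induction with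
  | zero => rw [mul_zero]; exact zero_mem _
  | add S T _ _ hS hT => rw [mul_add]; exact add_mem hS hT
  | smul_mem a T hT =>
    obtain ⟨V', h', Q, rfl⟩ := hT
    rw [smul_eq_mulOp_mul, ← mul_assoc]
    exact mul_on_mem_localCombinations h' Q (on_mul_mulOp_mem_localCombinations hA h P a)

lemma mul_mem_localCombinations_of_mem_combinations {S T : endRing X W}
    (hS : S ∈ A.combinations W) (hT : T ∈ A.combinations W) : S * T ∈ A.localCombinations W := by
  induction hS using Submodule.closure_induction with
  | zero => rw [zero_mul]; exact zero_mem _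
  | add S S' _ _ hS hS' => rw [add_mul]; exact add_mem hS hS'
  | smul_mem a S hS =>
    obtain ⟨V, h, P, rfl⟩ := hS
    rw [smul_mul_assoc]
    exact Submodule.smul_mem _ a (on_mul_mem_localCombinations hA h P hT)

lemma mul_mem_localCombinations {S T : endRing X W} (hS : S ∈ A.localCombinations W)
    (hT : T ∈ A.localCombinations W) : S * T ∈ A.localCombinations W := by
  refine mem_localCombinations_of_locally fun x hx => ?_
  obtain ⟨W₁, h₁, hx₁, hS⟩ := hS x hx
  obtain ⟨W₂, h₂, hx₂, hT⟩ := hT x hx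
  refine ⟨W₁ ⊓ W₂, inf_le_left.trans h₁, ⟨hx₁, hx₂⟩, ?_⟩
  rw [map_mul]
  exact mul_mem_localCombinations_of_mem_combinations hA
    (res_mem_combinations inf_le_left hS) (res_mem_combinations inf_le_right hT)

/-- The sheaf of rings of endomorphisms of `𝒪_X` generated by the functions and the operators: in
the presence of frames, it consists of the local combinations of operators. -/
def subrings : LocalSubrings X where
  ring W :=
    { A.localCombinations W with
      mul_mem' := mul_mem_localCombinations hA
      one_mem' := by
        have h := on_mem_combinations (A := A) (V := ⊤) (W := W) le_top 1
        rw [map_one] at h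
        exact mem_localCombinations h
      neg_mem' := (A.localCombinations W).neg_mem }
  res_mem {V V'} h T hT x hx := by
    obtain ⟨W, hW, hxW, hT⟩ := hT x (h hx)
    exact ⟨W ⊓ V', inf_le_right, ⟨hxW, hx⟩, res_mem_combinations inf_le_left hT⟩
  mem_of_local _ := mem_localCombinations_of_locally
  mulOp_mem {W} a := by
    have h := on_mem_combinations (A := A) (V := ⊤) (W := W) le_top 1
    rw [map_one] at h
    rw [← mul_one (mulOp W a)]
    exact Submodule.smul_mem _ a (mem_localCombinations h)

end HasFrames

end OperatorAction

end Action

/-! ### The inverse image of a sheaf of rings of operators -/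

section Modules

variable {X : Scheme.{u}} {M N : X.Modules} (S : LocalSubrings X) {V W : X.Opens}

/-- A morphism of modules on sections, as a linear map. -/
noncomputable def appLinear (φ : M ⟶ N) (W : X.Opens) : Γ(M, W) →ₗ[Γ(X, W)] Γ(N, W) where
  __ := (φ.app W).hom
  map_smul' := φ.app_smul

variable {S} in
/-- A morphism to the module attached to a local family of subrings, with values in the
endomorphisms. -/
noncomputable def endOf (g : M ⟶ S.leftModule) (W : X.Opens) : Γ(M, W) →ₗ[Γ(X, W)] endRing X W :=
  S.inclusion W ∘ₗ (S.sectionsEquiv W).symm.toLinearMap ∘ₗ appLinear g W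

variable {S} (g : M ⟶ S.leftModule)

lemma res_endOf (h : W ≤ V) (s : Γ(M, V)) :
    endRing.res h (endOf g V s) = endOf g W (moduleRes M h s) :=
  congrArg (fun t => S.inclusion W ((S.sectionsEquiv W).symm t)) (app_moduleRes g h s).symm

lemma app_eq_of_endOf_eq {s : Γ(M, W)} {T : S.ring W} (h : endOf g W s = T) :
    g.app W s = S.sectionsEquiv W T :=
  (S.sectionsEquiv W).symm.injective (Subtype.ext h)

end Modules

section SectionMap

variable {X Y : Scheme.{u}} {pr : X ⟶ Y} {S₀ : LocalSubrings Y} {N : X.Modules}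
  (χ : S₀.leftModule ⟶ (Scheme.Modules.pushforward pr).obj N) {V V' : Y.Opens} {W W' : X.Opens}

/-- The section over `W` that a morphism to a direct image attaches to an operator on an open
whose inverse image contains `W`. -/
noncomputable def sectionMap (h : W ≤ pr ⁻¹ᵁ V) : S₀.ring V →ₛₗ[(pr.appLE V W h).hom] Γ(N, W) where
  toFun P := moduleRes N h (χ.app V (S₀.sectionsEquiv V P))
  map_add' P Q := by
    rw [map_add, map_add]
    exact map_add (moduleRes N h) _ _
  map_smul' a P :=
    (congrArg (moduleRes N h) (χ.app_smul a (S₀.sectionsEquiv V P))).trans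
      (map_smulₛₗ (moduleRes N h) (pr.app V a) (χ.app V (S₀.sectionsEquiv V P) : Γ(N, pr ⁻¹ᵁ V)))

lemma sectionMap_self (P : S₀.ring V) :
    sectionMap χ (le_refl (pr ⁻¹ᵁ V)) P = χ.app V (S₀.sectionsEquiv V P) :=
  moduleRes_self _ _

lemma moduleRes_sectionMap (h : W ≤ pr ⁻¹ᵁ V) (h' : W' ≤ W) (P : S₀.ring V) :
    moduleRes N h' (sectionMap χ h P) = sectionMap χ (h'.trans h) P :=
  moduleRes_moduleRes h h' _

lemma sectionMap_restrict (h : V' ≤ V) (h' : W ≤ pr ⁻¹ᵁ V') (P : S₀.ring V) :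
    sectionMap χ h' (S₀.restrict h P) = sectionMap χ (h'.trans (pr.preimage_mono h)) P :=
  (congrArg (moduleRes N h') (app_moduleRes χ h (S₀.sectionsEquiv V P))).trans
    (moduleRes_moduleRes (pr.preimage_mono h) h' _)

/-- The `𝒪_X(W)`-linear combinations of the sections given by operators. -/
noncomputable def sectionCombinations (W : X.Opens) : Submodule Γ(X, W) Γ(N, W) :=
  Submodule.span _ {s | ∃ (V : Y.Opens) (h : W ≤ pr ⁻¹ᵁ V) (P : S₀.ring V), s = sectionMap χ h P}

variable {χ}

lemma sectionMap_mem_sectionCombinations (h : W ≤ pr ⁻¹ᵁ V) (P : S₀.ring V) :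
    sectionMap χ h P ∈ sectionCombinations χ W :=
  Submodule.subset_span ⟨V, h, P, rfl⟩

lemma moduleRes_mem_sectionCombinations (h : W' ≤ W) {s : Γ(N, W)}
    (hs : s ∈ sectionCombinations χ W) : moduleRes N h s ∈ sectionCombinations χ W' := by
  induction hs using Submodule.closure_induction with
  | zero => rw [map_zero]; exact zero_mem _
  | add s t _ _ hs ht => rw [map_add]; exact add_mem hs ht
  | smul_mem a s hs =>
    obtain ⟨V, hV, P, rfl⟩ := hs
    rw [map_smulₛₗ, moduleRes_sectionMap]
    exact Submodule.smul_mem _ _ (sectionMap_mem_sectionCombinations (h.trans hV) P)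

variable (χ) in
/-- The sections that are locally combinations of sections given by operators. -/
noncomputable def localSectionCombinations (W : X.Opens) : Submodule Γ(X, W) Γ(N, W) :=
  localClosure (X := X) (E := fun W => Γ(N, W)) (fun h => moduleRes N h)
    (fun h h' s => moduleRes_moduleRes h h' s) (sectionCombinations χ)
    (fun h _ hs => moduleRes_mem_sectionCombinations h hs) W

lemma mem_localSectionCombinations_iff {s : Γ(N, W)} :
    s ∈ localSectionCombinations χ W ↔ ∀ x ∈ W, ∃ (W' : X.Opens) (h : W' ≤ W), x ∈ W' ∧
      moduleRes N h s ∈ sectionCombinations χ W' := Iff.rfl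

lemma mem_localSectionCombinations {s : Γ(N, W)} (hs : s ∈ sectionCombinations χ W) :
    s ∈ localSectionCombinations χ W :=
  fun _ hx => ⟨W, le_rfl, hx, moduleRes_mem_sectionCombinations le_rfl hs⟩

lemma moduleRes_mem_localSectionCombinations (h : W' ≤ W) {s : Γ(N, W)}
    (hs : s ∈ localSectionCombinations χ W) : moduleRes N h s ∈ localSectionCombinations χ W' := by
  refine mem_localSectionCombinations_iff.2 fun x hx => ?_
  obtain ⟨W₁, h₁, hx₁, hs⟩ := mem_localSectionCombinations_iff.1 hs x (h hx)
  refine ⟨W₁ ⊓ W', inf_le_right, ⟨hx₁, hx⟩, ?_⟩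
  have hres := moduleRes_mem_sectionCombinations (inf_le_left : W₁ ⊓ W' ≤ W₁) hs
  rw [moduleRes_moduleRes] at hres ⊢
  exact hres

end SectionMap

namespace OperatorAction

variable {X Y : Scheme.{u}} {pr : X ⟶ Y} {S₀ : LocalSubrings Y} {A : OperatorAction pr S₀}

section Lift

variable (hA : A.HasFrames) {N : X.Modules}
  {χ : S₀.leftModule ⟶ (Scheme.Modules.pushforward pr).obj N} {g : N ⟶ (subrings hA).leftModule}
  (hg : ∀ {V : Y.Opens} (P : S₀.ring V), endOf g _ (sectionMap χ le_rfl P) = A.on le_rfl P)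
  {V : Y.Opens} {W : X.Opens}

lemma IsFrame.exists_mem_span_of_mem_sectionCombinations {ι : Type} {B : ι → S₀.ring V} {x : X}
    (hB : A.IsFrame B x) (hx : x ∈ W) {s : Γ(N, W)} (hs : s ∈ sectionCombinations χ W) :
    ∃ (W' : X.Opens) (h : W' ≤ W) (hV : W' ≤ pr ⁻¹ᵁ V), x ∈ W' ∧
      moduleRes N h s ∈ Submodule.span Γ(X, W') (Set.range fun i => sectionMap χ hV (B i)) := by
  have hres : ∀ {W₁ W₂ : X.Opens} (h₁ : W₁ ≤ pr ⁻¹ᵁ V) (h : W₂ ≤ W₁) {t : Γ(N, W₁)},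
      t ∈ Submodule.span Γ(X, W₁) (Set.range fun i => sectionMap χ h₁ (B i)) →
      moduleRes N h t ∈
        Submodule.span Γ(X, W₂) (Set.range fun i => sectionMap χ (h.trans h₁) (B i)) := by
    intro W₁ W₂ h₁ h t ht
    have hmem := Submodule.image_span_subset_span (moduleRes N h) _ ⟨t, ht, rfl⟩
    rw [← Set.range_comp] at hmem
    simpa only [Function.comp_def, moduleRes_sectionMap, SetLike.mem_coe] using hmem
  induction hs using Submodule.closure_induction with
  | zero =>
    exact ⟨W ⊓ pr ⁻¹ᵁ V, inf_le_left, inf_le_right, ⟨hx, hB.mem⟩, by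
      rw [map_zero]; exact zero_mem _⟩
  | add s t _ _ hs ht =>
    obtain ⟨W₁, h₁, hV₁, hx₁, hs⟩ := hs
    obtain ⟨W₂, h₂, hV₂, hx₂, ht⟩ := ht
    refine ⟨W₁ ⊓ W₂, inf_le_left.trans h₁, inf_le_left.trans hV₁, ⟨hx₁, hx₂⟩, ?_⟩
    rw [map_add, ← moduleRes_moduleRes h₁ inf_le_left, ← moduleRes_moduleRes h₂ inf_le_right]
    exact add_mem (hres hV₁ inf_le_left hs) (hres hV₂ inf_le_right ht)
  | smul_mem a s hs =>
    obtain ⟨V', h, P, rfl⟩ := hs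
    obtain ⟨W', h', hV, hx', hP⟩ :=
      hB.exists_map_mem_span (sectionMap χ) (sectionMap_restrict χ) h hx P
    refine ⟨W', h', hV, hx', ?_⟩
    rw [map_smulₛₗ, moduleRes_sectionMap]
    exact Submodule.smul_mem _ _ hP

include hg

lemma endOf_sectionMap (h : W ≤ pr ⁻¹ᵁ V) (P : S₀.ring V) :
    endOf g W (sectionMap χ h P) = A.on h P := by
  have hres := congrArg (endRing.res h) (hg P)
  rwa [res_endOf, moduleRes_sectionMap] at hres

lemma eq_zero_of_endOf_eq_zero {s : Γ(N, W)} (hs : s ∈ localSectionCombinations χ W)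
    (h : endOf g W s = 0) : s = 0 := by
  refine eq_of_locally_moduleRes_eq fun x hx => ?_
  obtain ⟨_, ι, B, hB⟩ := hA x
  obtain ⟨W₁, h₁, hx₁, hs⟩ := mem_localSectionCombinations_iff.1 hs x hx
  obtain ⟨W₂, h₂, hV, hx₂, hs⟩ := hB.exists_mem_span_of_mem_sectionCombinations hx₁ hs
  refine ⟨W₂, h₂.trans h₁, hx₂, ?_⟩
  rw [moduleRes_moduleRes] at hs
  rw [map_zero]
  obtain ⟨c, hc⟩ := Finsupp.mem_span_range_iff_exists_finsupp.1 hs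
  have hcomb : c.sum (fun i a => a • A.on hV (B i)) = 0 := by
    have hmap := congrArg (endOf g W₂) hc
    rw [← res_endOf, h, map_zero, map_finsuppSum] at hmap
    simpa only [map_smul, endOf_sectionMap hA hg] using hmap
  rw [← hc, linearIndependent_iff.1 (hB.linearIndependent hV) c hcomb, Finsupp.sum_zero_index]

lemma exists_endOf_eq_of_mem_combinations {T : endRing X W} (hT : T ∈ A.combinations W) :
    ∃ s ∈ sectionCombinations χ W, endOf g W s = T := by
  induction hT using Submodule.closure_induction with
  | zero => exact ⟨0, zero_mem _, map_zero _⟩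
  | add S T _ _ hS hT =>
    obtain ⟨s, hs, rfl⟩ := hS
    obtain ⟨t, ht, rfl⟩ := hT
    exact ⟨s + t, add_mem hs ht, map_add _ _ _⟩
  | smul_mem a T hT =>
    obtain ⟨V, h, P, rfl⟩ := hT
    refine ⟨a • sectionMap χ h P,
      Submodule.smul_mem _ a (sectionMap_mem_sectionCombinations h P), ?_⟩
    rw [map_smul, endOf_sectionMap hA hg]

lemma exists_endOf_eq {T : endRing X W} (hT : T ∈ A.localCombinations W) :
    ∃ s ∈ localSectionCombinations χ W, endOf g W s = T := by
  obtain ⟨s, hs⟩ := exists_section_of_locally_unique (C := Ab.{u}) ⟨N.presheaf, N.isSheaf⟩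
    (V := W) (fun W' (s : Γ(N, W')) => ∃ h : W' ≤ W,
      s ∈ localSectionCombinations χ W' ∧ endOf g W' s = endRing.res h T)
    (fun _ _ h s ⟨h', hs, hsT⟩ => ⟨h.trans h', moduleRes_mem_localSectionCombinations h hs,
      (res_endOf g h s).symm.trans (congrArg (endRing.res h) hsT)⟩)
    (fun _ _ s t ⟨_, hs, hsT⟩ ⟨_, ht, htT⟩ => by
      refine sub_eq_zero.1 (eq_zero_of_endOf_eq_zero hA hg (sub_mem hs ht) ?_)
      rw [map_sub, hsT, htT, sub_self])
    (fun x hx => by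
      obtain ⟨W', h, hx', hT⟩ := mem_localCombinations_iff.1 hT x hx
      obtain ⟨s, hs, hsT⟩ := exists_endOf_eq_of_mem_combinations hA hg hT
      exact ⟨W', h, hx', s, h, mem_localSectionCombinations hs, hsT⟩)
  refine ⟨s, mem_localSectionCombinations_iff.2 fun x hx => ?_,
    endRing_eq_of_locally_res_eq fun x hx => ?_⟩
  · obtain ⟨W₁, h₁, hx₁, _, hs, -⟩ := hs x hx
    obtain ⟨W₂, h₂, hx₂, hs⟩ := mem_localSectionCombinations_iff.1 hs x hx₁
    exact ⟨W₂, h₂.trans h₁, hx₂, (moduleRes_moduleRes h₁ h₂ s).symm ▸ hs⟩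
  · obtain ⟨W', h, hx', _, -, hsT⟩ := hs x hx
    exact ⟨W', h, hx', (res_endOf g h s).trans hsT⟩

lemma bijective_app_localSectionCombinations (W : X.Opens) : Function.Bijective
    (appLinear g W ∘ₗ (localSectionCombinations χ W).subtype) := by
  refine ⟨(injective_iff_map_eq_zero _).2 fun s hs => Subtype.ext ?_, fun T => ?_⟩
  · exact eq_zero_of_endOf_eq_zero hA hg s.2
      (congrArg (fun t => ((subrings hA).sectionsEquiv W).symm t |>.1) hs)
  · obtain ⟨s, hs, hsT⟩ := exists_endOf_eq hA hg (((subrings hA).sectionsEquiv W).symm T).2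
    exact ⟨⟨s, hs⟩, app_eq_of_endOf_eq g hsT⟩

/-- The section of `g` with values in the local combinations of sections given by operators, over
an open. -/
noncomputable def liftLinear (W : X.Opens) :
    Γ((subrings hA).leftModule, W) →ₗ[Γ(X, W)] Γ(N, W) :=
  (localSectionCombinations χ W).subtype ∘ₗ
    (LinearEquiv.ofBijective _ (bijective_app_localSectionCombinations hA hg W)).symm

lemma liftLinear_app {s : Γ(N, W)} (hs : s ∈ localSectionCombinations χ W) :
    liftLinear hA hg W (g.app W s) = s :=
  congrArg Subtype.val (LinearEquiv.symm_apply_apply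
    (LinearEquiv.ofBijective _ (bijective_app_localSectionCombinations hA hg W)) ⟨s, hs⟩)

lemma app_liftLinear (T : Γ((subrings hA).leftModule, W)) :
    g.app W (liftLinear hA hg W T) = T :=
  LinearEquiv.apply_symm_apply
    (LinearEquiv.ofBijective _ (bijective_app_localSectionCombinations hA hg W)) T

lemma liftLinear_mem (T : Γ((subrings hA).leftModule, W)) :
    liftLinear hA hg W T ∈ localSectionCombinations χ W :=
  Subtype.prop _

/-- The section of a morphism to the sheaf of rings generated by functions and operators that is
determined by compatible images of the operators. -/
noncomputable def lift : (subrings hA).leftModule ⟶ N :=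
  homOfSections (liftLinear hA hg) fun h T => by
    conv_lhs => rw [← app_liftLinear hA hg T, ← app_moduleRes]
    exact liftLinear_app hA hg (moduleRes_mem_localSectionCombinations h (liftLinear_mem hA hg T))

lemma lift_comp : lift hA hg ≫ g = 𝟙 _ := by
  ext W T
  exact app_liftLinear hA hg T

lemma lift_app_sectionsEquiv (P : S₀.ring V) (hP : A.on le_rfl P ∈ (subrings hA).ring _) :
    (lift hA hg).app (pr ⁻¹ᵁ V) ((subrings hA).sectionsEquiv _ ⟨A.on le_rfl P, hP⟩) =
      χ.app V (S₀.sectionsEquiv V P) := by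
  rw [← app_eq_of_endOf_eq g (T := ⟨_, hP⟩) (hg P)]
  exact (liftLinear_app hA hg (mem_localSectionCombinations
    (sectionMap_mem_sectionCombinations le_rfl P))).trans (sectionMap_self χ P)

end Lift

section Pullback

variable (hA : A.HasFrames) {V : Y.Opens} {W : X.Opens}

/-- An operator on `𝒪_Y`, as a section of the sheaf of rings generated by functions and
operators. -/
def onSection (h : W ≤ pr ⁻¹ᵁ V) : S₀.ring V →+* (subrings hA).ring W :=
  (A.on h).codRestrict ((subrings hA).ring W) fun P =>
    mem_localCombinations (on_mem_combinations h P)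

/-- The map from the operators to the endomorphisms of `𝒪_X`, as a morphism of modules. -/
noncomputable def toPushforward :
    S₀.leftModule ⟶ (Scheme.Modules.pushforward pr).obj (subrings hA).leftModule :=
  homOfSections (M := S₀.leftModule)
    (N := (Scheme.Modules.pushforward pr).obj (subrings hA).leftModule)
    (fun V =>
      { toFun P := (subrings hA).sectionsEquiv _ (onSection hA le_rfl ((S₀.sectionsEquiv V).symm P))
        map_add' P Q := congrArg ((subrings hA).sectionsEquiv _) ((onSection hA le_rfl).map_add _ _)
        map_smul' a P := congrArg ((subrings hA).sectionsEquiv _) (Subtype.ext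
          ((A.on_smul le_rfl a _).trans (by rw [pr.appLE_eq_app]; rfl))) })
    fun h P => congrArg ((subrings hA).sectionsEquiv _)
      (Subtype.ext (A.on_restrict h le_rfl ((S₀.sectionsEquiv _).symm P)))

/-- The map `s ⊗ P ↦ s ρ(P)`. -/
noncomputable def fromPullback :
    (Scheme.Modules.pullback pr).obj S₀.leftModule ⟶ (subrings hA).leftModule :=
  ((Scheme.Modules.pullbackPushforwardAdjunction pr).homEquiv _ _).symm (toPushforward hA)

lemma homEquiv_fromPullback :
    (Scheme.Modules.pullbackPushforwardAdjunction pr).homEquiv _ _ (fromPullback hA) =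
      toPushforward hA :=
  Equiv.apply_symm_apply _ _

variable (pr S₀) in
/-- The map `P ↦ 1 ⊗ P`, as a morphism of modules. -/
noncomputable def pullbackUnit : S₀.leftModule ⟶
    (Scheme.Modules.pushforward pr).obj ((Scheme.Modules.pullback pr).obj S₀.leftModule) :=
  (Scheme.Modules.pullbackPushforwardAdjunction pr).unit.app S₀.leftModule

lemma fromPullback_app (P : S₀.ring V) :
    (fromPullback hA).app (pr ⁻¹ᵁ V)
      (pullbackSection pr S₀.leftModule V (S₀.sectionsEquiv V P)) =
      (subrings hA).sectionsEquiv _ (onSection hA le_rfl P) := by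
  have h := congrArg (fun g => g.app V (S₀.sectionsEquiv V P)) (homEquiv_fromPullback hA)
  rw [Adjunction.homEquiv_unit] at h
  exact h

lemma endOf_fromPullback (P : S₀.ring V) :
    endOf (fromPullback hA) _ (sectionMap (pullbackUnit pr S₀) le_rfl P) = A.on le_rfl P := by
  rw [sectionMap_self]
  exact congrArg (fun s => (((subrings hA).sectionsEquiv (pr ⁻¹ᵁ V)).symm s).1)
    (fromPullback_app hA P)

/-- The isomorphism `s ρ(P) ↦ s ⊗ P`. -/
noncomputable def pullbackIso :
    (subrings hA).leftModule ≅ (Scheme.Modules.pullback pr).obj S₀.leftModule where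
  hom := lift hA (endOf_fromPullback hA)
  inv := fromPullback hA
  hom_inv_id := lift_comp hA _
  inv_hom_id := by
    refine ((Scheme.Modules.pullbackPushforwardAdjunction pr).homEquiv _ _).injective ?_
    rw [Adjunction.homEquiv_naturality_right, homEquiv_fromPullback, Adjunction.homEquiv_id]
    refine Scheme.Modules.hom_ext _ _ fun V => ?_
    ext P
    exact lift_app_sectionsEquiv hA (endOf_fromPullback hA) ((S₀.sectionsEquiv V).symm P) _

lemma pullbackIso_onSection (P : S₀.ring V) :
    (pullbackIso hA).hom.app (pr ⁻¹ᵁ V)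
      ((subrings hA).sectionsEquiv _ (onSection hA le_rfl P)) =
      pullbackSection pr S₀.leftModule V (S₀.sectionsEquiv V P) :=
  lift_app_sectionsEquiv hA (endOf_fromPullback hA) P _

end Pullback

end OperatorAction

/-! ### The operators of level `m` -/

section Level

variable {X Y : Scheme.{u}} {R : CommRingCat.{u}} {f : Y ⟶ Spec R} {ϖ : R} {p m k : ℕ} {pr : X ⟶ Y}

lemma onSections_restrict {S₀ : LocalSubrings Y} (ρ : inverseImage pr S₀.sheaf ⟶ endSheaf X)
    {V V' : Y.Opens} (h : V' ≤ V) (P : S₀.ring V) :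
    (onSections ρ V' (S₀.restrict h P)).1 =
      endRing.res (pr.preimage_mono h) (onSections ρ V P).1 :=
  congrArg Subtype.val congr($(((TopCat.Sheaf.pullbackPushforwardAdjunction RingCat.{u}
    pr.base).homEquiv _ _ ρ).hom.naturality (homOfLE h).op) P)

/-- The ring homomorphism `P ↦ 1 ⊗ P`. -/
noncomputable def OperatorAction.fromInverseImage {S₀ : LocalSubrings Y} {A : OperatorAction pr S₀}
    (hA : A.HasFrames) : inverseImage pr S₀.sheaf ⟶ (subrings hA).sheaf :=
  ofSections
    { hom :=
        { app V := RingCat.ofHom (onSection hA (V := V.unop) le_rfl)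
          naturality V V' i := by
            ext P
            exact Subtype.ext (A.on_restrict i.unop.le le_rfl P) } }

lemma OperatorAction.onSections_fromInverseImage {S₀ : LocalSubrings Y} {A : OperatorAction pr S₀}
    (hA : A.HasFrames) {V : Y.Opens} (P : S₀.ring V) :
    onSections (fromInverseImage hA) V P = onSection hA le_rfl P :=
  congrArg (fun g : S₀.ring V →+* (subrings hA).ring (pr ⁻¹ᵁ V) => g P) (onSections_ofSections _ V)

lemma mem_range_mulOp_of_mem_closure_generators {W : Y.Opens}
    (hW : ∀ U : Y.Opens, W ≤ U → IsEmpty (Coordinates f U)) {P : endRing Y W}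
    (hP : P ∈ Subring.closure (generators f ϖ p m k W)) : P ∈ (mulOp W).range := by
  refine (Subring.closure_le.2 ?_) hP
  rintro Q (⟨a, rfl⟩ | ⟨U, hU, c, ν, rfl⟩)
  · exact ⟨a, rfl⟩
  · exact ((hW U hU).false c).elim

namespace IsCompatibleAction

variable {ρ : inverseImage pr (levelSheaf f ϖ p m k) ⟶ endSheaf X}
  (hρ : IsCompatibleAction f ϖ p m k pr ρ)

/-- A compatible action, as an action of operators. -/
noncomputable def operatorAction : OperatorAction pr (levelSubrings f ϖ p m k) where
  hom V := ((endSubrings X).ring (pr ⁻¹ᵁ V)).subtype.comp (onSections ρ V)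
  res h P := onSections_restrict (S₀ := levelSubrings f ϖ p m k) ρ h P
  mul a := hρ.mul _ a

lemma on_levelSection_mul_mulOp {V : Y.Opens} (c : Coordinates f V) (ν : Fin c.n → ℕ)
    {U : X.Opens} (h : U ≤ pr ⁻¹ᵁ V) (s : Γ(X, U)) :
    hρ.operatorAction.on h (c.levelSection ϖ p m k ν) * mulOp U s =
      ∑ μ ∈ Finset.Iic ν, (leibnizCoeff p m ν μ : endRing X U) *
        (mulOp U (evalOp (onSections ρ V (c.levelSection ϖ p m k μ)).1 h s) *
          hρ.operatorAction.on h (c.levelSection ϖ p m k (ν - μ))) := by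
  simp only [← nsmul_eq_mul]
  refine endRing_ext fun W hW t => ?_
  rw [evalOp_sum, evalOp_mul, evalOp_mulOp]
  refine (hρ.leibniz c ν (hW.trans h) (resHom hW s) t).trans (Finset.sum_congr rfl fun μ _ => ?_)
  rw [evalOp_nsmul, nsmul_eq_mul, evalOp_mul, evalOp_mulOp, ← evalOp_resHom _ h hW]
  rfl

lemma linearIndependent_on_levelSection [Flat f] [∀ W : Y.Opens, IsAddTorsionFree Γ(Y, W)]
    {V : Y.Opens} (c : Coordinates f V) {W : X.Opens} [IsAddTorsionFree Γ(X, W)]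
    (hϖ : const (pr ≫ f) W ϖ ∈ nonZeroDivisors Γ(X, W)) (h : W ≤ pr ⁻¹ᵁ V) :
    LinearIndependent Γ(X, W) fun ν => hρ.operatorAction.on h (c.levelSection ϖ p m k ν) := by
  let φ := (resHom h).comp (pr.app V).hom
  let eval : endRing X W →ₗ[Γ(X, W)] Γ(Y, V) → Γ(X, W) :=
    { toFun P a := evalOp P le_rfl (φ a)
      map_add' P Q := funext fun a => evalOp_add P Q le_rfl _
      map_smul' s P := funext fun a => by
        rw [evalOp_smul, resHom_self]
        rfl }
  have hφ : φ (const f V ϖ) ∈ nonZeroDivisors Γ(X, W) := by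
    rwa [RingHom.comp_apply, app_const, resHom_const]
  have heval : ∀ ν, eval (hρ.operatorAction.on h (c.levelSection ϖ p m k ν)) =
      fun a => φ (evalOp (c.op ϖ p m k ν) le_rfl a) := fun ν => funext fun a =>
    (evalOp_resHom (onSections ρ V (c.levelSection ϖ p m k ν)).1 le_rfl h _).trans
      (congrArg (resHom h) (hρ.linear V (c.levelSection ϖ p m k ν) le_rfl a))
  refine LinearIndependent.of_comp eval ?_
  simpa only [Function.comp_def, heval] using
    c.linearIndependent_evalOp_op le_rfl ϖ p m k φ hφ

lemma isFrame_levelSection [Flat f] [∀ W : Y.Opens, IsAddTorsionFree Γ(Y, W)]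
    [∀ W : X.Opens, IsAddTorsionFree Γ(X, W)] [Fact p.Prime]
    (hR : ∀ l : ℕ, ¬ p ∣ l → IsUnit (l : R))
    (hϖ : ∀ W, const (pr ≫ f) W ϖ ∈ nonZeroDivisors Γ(X, W)) {V : Y.Opens} (c : Coordinates f V)
    {x : X} (hx : pr x ∈ V) :
    hρ.operatorAction.IsFrame (fun ν => c.levelSection ϖ p m k ν) x where
  mem := hx
  exists_mem_span P hx' := by
    obtain ⟨W, hW, hxW, hP⟩ := P.2 _ hx'
    exact ⟨W ⊓ V, inf_le_left.trans hW, inf_le_right, ⟨hxW, hx⟩,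
      LocalSubrings.mem_span_of_coe_mem_span (c.mem_span_op_of_mem_closure_generators
        inf_le_right ϖ m k hR (res_mem_closure f ϖ p m k inf_le_left hP))⟩
  on_mul_mulOp_mem {W} h ν s := by
    rw [hρ.on_levelSection_mul_mulOp]
    refine sum_mem fun μ _ => ?_
    rw [← nsmul_eq_mul]
    exact nsmul_mem (Submodule.smul_mem _ _ (OperatorAction.on_mem_combinations h _)) _
  linearIndependent h := hρ.linearIndependent_on_levelSection c (hϖ _) h

lemma isFrame_one {x : X} (hx : ∀ V : Y.Opens, pr x ∈ V → IsEmpty (Coordinates f V)) :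
    hρ.operatorAction.IsFrame (V := ⊤) (fun _ : Unit => 1) x where
  mem := trivial
  exists_mem_span P hx' := by
    obtain ⟨W, hW, hxW, hP⟩ := P.2 _ hx'
    obtain ⟨a, ha⟩ := mem_range_mulOp_of_mem_closure_generators (fun U hU => hx U (hU hxW)) hP
    refine ⟨W, hW, le_top, hxW, LocalSubrings.mem_span_of_coe_mem_span ?_⟩
    have hmem := Submodule.smul_mem (Submodule.span Γ(Y, W) {1}) a
      (Submodule.mem_span_singleton_self (1 : endRing Y W))
    rw [Set.range_const]
    rwa [smul_eq_mulOp_mul, mul_one, ha] at hmem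
  on_mul_mulOp_mem {W} h _ s := by
    have hmem := Submodule.smul_mem _ s (OperatorAction.on_mem_combinations (A := hρ.operatorAction)
      h 1)
    rw [RingHom.map_one, one_mul]
    rwa [RingHom.map_one, smul_eq_mulOp_mul, mul_one] at hmem
  linearIndependent h := by
    refine Fintype.linearIndependent_iff.2 fun g hg _ => mulOp_injective ?_
    rw [Fintype.sum_unique, RingHom.map_one, smul_eq_mulOp_mul, mul_one] at hg
    rw [map_zero, ← hg]

lemma hasFrames [Flat f] [∀ W : Y.Opens, IsAddTorsionFree Γ(Y, W)]
    [∀ W : X.Opens, IsAddTorsionFree Γ(X, W)] [Fact p.Prime]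
    (hR : ∀ l : ℕ, ¬ p ∣ l → IsUnit (l : R))
    (hϖ : ∀ W, const (pr ≫ f) W ϖ ∈ nonZeroDivisors Γ(X, W)) : hρ.operatorAction.HasFrames := by
  intro x
  by_cases hx : ∀ V : Y.Opens, pr x ∈ V → IsEmpty (Coordinates f V)
  · exact ⟨_, _, _, hρ.isFrame_one hx⟩
  · push Not at hx
    obtain ⟨V, hxV, ⟨c⟩⟩ := hx
    exact ⟨V, _, _, hρ.isFrame_levelSection hR hϖ c hxV⟩

variable (hA : hρ.operatorAction.HasFrames)

lemma onSection_levelSection_mul_mulSection {V : Y.Opens} (c : Coordinates f V) (ν : Fin c.n → ℕ)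
    {U : X.Opens} (h : U ≤ pr ⁻¹ᵁ V) (s : Γ(X, U)) :
    OperatorAction.onSection hA h (c.levelSection ϖ p m k ν) *
        (OperatorAction.subrings hA).mulSection U s =
      ∑ μ ∈ Finset.Iic ν, (leibnizCoeff p m ν μ : (OperatorAction.subrings hA).ring U) *
        ((OperatorAction.subrings hA).mulSection U
            (evalOp (onSections ρ V (c.levelSection ϖ p m k μ)).1 h s) *
          OperatorAction.onSection hA h (c.levelSection ϖ p m k (ν - μ))) := by
  refine Subtype.ext ((hρ.on_levelSection_mul_mulOp c ν h s).trans ?_)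
  rw [AddSubmonoidClass.coe_finsetSum]
  rfl

/-- The structure of sheaf of rings on `pr^* 𝒟̃^{(m)}`. -/
noncomputable def pullbackRingStructure : PullbackRingStructure ρ where
  ring := (OperatorAction.subrings hA).sheaf
  iso := (Scheme.Modules.toPresheaf X).mapIso (OperatorAction.pullbackIso hA)
  left := (OperatorAction.subrings hA).mulHom
  right := OperatorAction.fromInverseImage hA
  left_mul U s r := Scheme.Modules.Hom.app_smul (OperatorAction.pullbackIso hA).hom s
    ((OperatorAction.subrings hA).sectionsEquiv U r)
  right_eq V P :=
    (congrArg (fun z => (OperatorAction.pullbackIso hA).hom.app (pr ⁻¹ᵁ V)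
      ((OperatorAction.subrings hA).sectionsEquiv _ z))
      (OperatorAction.onSections_fromInverseImage hA P)).trans
    (OperatorAction.pullbackIso_onSection hA P)
  commutation {V} c ν U h s := by
    have hright := fun P => congrArg ((OperatorAction.subrings hA).restrict h)
      (OperatorAction.onSections_fromInverseImage hA P)
    refine (congrArg (· * (OperatorAction.subrings hA).mulSection U s) (hright _)).trans
      ((hρ.onSection_levelSection_mul_mulSection hA c ν h s).trans
        (Finset.sum_congr rfl fun μ _ => ?_))
    exact (congrArg (fun z => (leibnizCoeff p m ν μ : (OperatorAction.subrings hA).ring U) *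
        ((OperatorAction.subrings hA).mulSection U
            (evalOp (onSections ρ V (c.levelSection ϖ p m k μ)).1 h s) * z)) (hright _)).symm

end IsCompatibleAction

end Level

lemma isUnit_natCast_of_not_dvd {p : ℕ} [Fact p.Prime] (A : Type*) [CommRing A] [Algebra ℤ_[p] A]
    {n : ℕ} (hn : ¬ p ∣ n) : IsUnit (n : A) := by
  have hunit : IsUnit (n : ℤ_[p]) := by
    rw [PadicInt.isUnit_iff, PadicInt.norm_natCast_eq_one_iff]
    exact (Nat.Prime.coprime_iff_not_dvd Fact.out).2 hn
  simpa only [map_natCast] using hunit.map (algebraMap ℤ_[p] A)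

end ArithDiff

open ArithDiff in
theorem mainTheorem9_general {X Y : Scheme.{u}} {R : CommRingCat.{u}} [IsAddTorsionFree R] {p : ℕ}
    [Fact p.Prime] (hR : ∀ l : ℕ, ¬ p ∣ l → IsUnit (l : R)) {f : Y ⟶ Spec R} [Flat f]
    {pr : X ⟶ Y} {I : Y.IdealSheafData} (hpr : IsBlowup pr I) {ϖ : R} (hϖ : ϖ ∈ nonZeroDivisors R)
    {N : ℕ} (hI : ∀ U : Y.affineOpens, const f U.1 (ϖ ^ N) ∈ I.ideal U) (m : ℕ) {k : ℕ}
    (hk : N ≤ k) :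
    ∃ ρ : inverseImage pr (levelSheaf f ϖ p m k) ⟶ endSheaf X,
      IsCompatibleAction f ϖ p m k pr ρ ∧ Nonempty (PullbackRingStructure ρ) := by
  have := isAddTorsionFree_sections f
  have := hpr.isAddTorsionFree_sections f
  have hmod := hpr.isModification f hϖ hI
  have hρ := isCompatibleAction_extendAction hmod
    fun hP => extends_of_mem_levelSubrings hpr hmod hϖ hI p m hk hP
  exact ⟨_, hρ, ⟨hρ.pullbackRingStructure
    (hρ.hasFrames hR (hpr.const_mem_nonZeroDivisors f hϖ))⟩⟩

theorem mainTheorem9 (p : ℕ) [Fact p.Prime] {L : Type u} [Field L] [Algebra ℚ_[p] L]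
    [FiniteDimensional ℚ_[p] L] [Algebra ℤ_[p] L] [IsScalarTower ℤ_[p] ℚ_[p] L]
    (ϖ : integralClosure ℤ_[p] L) (hϖ : Irreducible ϖ)
    {X X₀ : Scheme.{u}} (f : X₀ ⟶ Spec (.of (integralClosure ℤ_[p] L))) [Smooth f]
    (I : X₀.IdealSheafData) (N : ℕ)
    (hI : ∀ U : X₀.affineOpens, ArithDiff.const f U.1 (ϖ ^ N) ∈ I.ideal U)
    (pr : X ⟶ X₀) (hpr : ArithDiff.IsBlowup pr I) (m k : ℕ) (hk : N ≤ k) :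
    ∃ ρ : ArithDiff.inverseImage pr (ArithDiff.levelSheaf f ϖ p m k) ⟶ ArithDiff.endSheaf X,
      ArithDiff.IsCompatibleAction f ϖ p m k pr ρ ∧
        Nonempty (ArithDiff.PullbackRingStructure ρ) := by
  have : CharZero L := charZero_of_injective_algebraMap (algebraMap ℚ_[p] L).injective
  exact mainTheorem9_general
    (fun _ => ArithDiff.isUnit_natCast_of_not_dvd (integralClosure ℤ_[p] L)) hpr
    (mem_nonZeroDivisors_of_ne_zero hϖ.ne_zero) hI m hk
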